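/- Let $\alpha>0$ and $0<p\le q<\infty$. For $0<s<\infty$ let $\mathcal F^s_\alpha$ be the space of entire functions $f$ with $$\|f\|_{(s,\alpha)}^s=\frac{\alpha s}{2\pi}\int_{\mathbb C}|f(z)|^s e^{-\frac{\alpha s}{2}|z|^2}\,dm(z)<\infty ,$$ where $m$ is Lebesgue measure on $\mathbb C$. For entire functions $\psi,g$ put $$C_{(\psi,g)}f(z)=\int_0^{\psi(z)}f(w)g'(w)\,dw,\qquad M_{(\psi,\alpha)}(|g|^s)(w)=\int_{\mathbb C}\frac{|k_{(w,\alpha)}(\psi(z))\,g'(\psi(z))\,\psi'(z)|^s}{\big((1+|z|)e^{\frac{\alpha}{2}|z|^2}\big)^s}\,dm(z)\in[0,\infty],$$ where $k_{(w,\alpha)}(z)=e^{\alpha z\overline w-\alpha|w|^2/2}$. An operator between these spaces is compact if it maps bounded sequences to sequences with a convergent subsequence, and $\|C_{(\psi,g)}\|\in[0,\infty]$ is the supremum of the norms of the images of the elements of the unit ball. Then for all entire $\psi$ and $g$: 1. $C_{(\psi,g)}:\mathcal F^p_\alpha\to\mathcal F^q_\alpha$ is bounded if and only if $M_{(\psi,\alpha)}(|g|^q)\in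 L^\infty(\mathbb C,dm)$, with the norm estimate $$\|C_{(\psi,g)}\|^q\simeq\sup_{w\in\mathbb C}M_{(\psi,\alpha)}(|g|^q)(w).$$ 2. $C_{(\psi,g)}:\mathcal F^p_\alpha\to\mathcal F^q_\alpha$ is compact if and only if $\lim_{|z|\to\infty}M_{(\psi,\alpha)}(|g|^q)(z)=0$. 3. If $p\ne q$, then $C_{(\psi,g)}:\mathcal F^q_\alpha\to\mathcal F^p_\alpha$ is bounded if and only if $M_{(\psi,\alpha)}(|g|^p)\in L^{q/(q-p)}(\mathbb C,dm)$, and it is compact if and only if the same condition holds, with the norm estimate $$\|C_{(\psi,g)}\|^{\frac{pq}{q-p}}\simeq\int_{\mathbb C}M_{(\psi,\alpha)}(|g|^p)(w)^{\frac{q}{q-p}}\,dm(w).$$ Here $U\simeq V$ means $U\lesssim V$ and $U\gtrsim V$, where $U\lesssim V$ (equivalently $V\gtrsim U$) means $U\le cV$ with a finite constant $c>0$; values $\infty$ are allowed on both sides. In the norm estimates in 1 and 3 the bound "$\gtrsim$" holds for all entire $\psi,g$ with a constant depending only on $\alpha,p,q$. The bound "$\lesssim$" holds for all entire $g$ and all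 entire $\psi$ with $\psi(0)=0$ with a constant depending only on $\alpha,p,q$, and for all entire $g$ and every nonconstant entire $\psi$ with a constant depending only on $\alpha,p,q,\psi$. -/

import Mathlib

open MeasureTheory Filter Topology
open scoped ENNReal NNReal

noncomputable section

namespace Fock

/-- The Fock (quasi-)norm `‖f‖_(p,α)`, with value `∞` when the integral diverges. -/
def fockNorm (α p : ℝ) (f : ℂ → ℂ) : ℝ≥0∞ :=
  (ENNReal.ofReal (α * p / (2 * Real.pi)) *
    ∫⁻ z : ℂ, ENNReal.ofReal (‖f z‖ ^ p * Real.exp (-(α * p / 2) * ‖z‖ ^ 2))) ^ (1 / p)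

/-- The Fock space `F^p_α`: entire functions of finite Fock norm. -/
def FockSpace (α p : ℝ) : Set (ℂ → ℂ) :=
  {f | Differentiable ℂ f ∧ fockNorm α p f < ⊤}

/-- The Volterra type operator `V_g f (z) = ∫_0^z f(w) g'(w) dw`, the integral being taken along
the segment from `0` to `z`. -/
def volterra (g f : ℂ → ℂ) (z : ℂ) : ℂ :=
  ∫ t in (0 : ℝ)..1, f ((t : ℂ) * z) * deriv g ((t : ℂ) * z) * z

/-- The operator `C_(ψ,g) = C_ψ ∘ V_g`, that is, `f ↦ (z ↦ ∫_0^{ψ(z)} f(w) g'(w) dw)`. -/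
def compVolterra (ψ g f : ℂ → ℂ) : ℂ → ℂ :=
  fun z => volterra g f (ψ z)

/-- `T` is a bounded operator from `F^p_α` to `F^q_α`. -/
def IsBoundedOp (α p q : ℝ) (T : (ℂ → ℂ) → (ℂ → ℂ)) : Prop :=
  (∀ f ∈ FockSpace α p, T f ∈ FockSpace α q) ∧
    ∃ K : ℝ≥0, ∀ f ∈ FockSpace α p, fockNorm α q (T f) ≤ K * fockNorm α p f

/-- `T` is a compact operator from `F^p_α` to `F^q_α`: it maps `F^p_α` into `F^q_α`, and the image
of every bounded sequence has a subsequence that converges in `F^q_α`. -/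
def IsCompactOp (α p q : ℝ) (T : (ℂ → ℂ) → (ℂ → ℂ)) : Prop :=
  (∀ f ∈ FockSpace α p, T f ∈ FockSpace α q) ∧
    ∀ (f : ℕ → ℂ → ℂ) (K : ℝ≥0),
      (∀ n, f n ∈ FockSpace α p ∧ fockNorm α p (f n) ≤ K) →
      ∃ h ∈ FockSpace α q, ∃ φ : ℕ → ℕ, StrictMono φ ∧
        Tendsto (fun n => fockNorm α q (T (f (φ n)) - h)) atTop (𝓝 0)

/-- The operator (quasi-)norm of `T : F^p_α → F^q_α`: the supremum of `‖T f‖` over the closed unit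
ball of `F^p_α` (it is `∞` when `T` is unbounded). -/
def opNorm (α p q : ℝ) (T : (ℂ → ℂ) → (ℂ → ℂ)) : ℝ≥0∞ :=
  ⨆ f ∈ {f | f ∈ FockSpace α p ∧ fockNorm α p f ≤ 1}, fockNorm α q (T f)

/-- The normalized reproducing kernel `k_(w,α)` of `F^2_α`. -/
def normKernel (α : ℝ) (w z : ℂ) : ℂ :=
  Complex.exp ((α : ℂ) * (z * (starRingEnd ℂ) w) - (α : ℂ) * (‖w‖ : ℂ) ^ 2 / 2)

/-- The Berezin type integral transform `M_(ψ,α)(|g|^p)(w)`, with values in `[0, ∞]`. -/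
def berezinM (α p : ℝ) (ψ g : ℂ → ℂ) (w : ℂ) : ℝ≥0∞ :=
  ∫⁻ z : ℂ, ENNReal.ofReal
    (‖normKernel α w (ψ z) * deriv g (ψ z) * deriv ψ z‖ ^ p /
      ((1 + ‖z‖) * Real.exp (α / 2 * ‖z‖ ^ 2)) ^ p)

end Fock

end

noncomputable section

namespace Fock

open Metric Set

/-! ### Local estimates for entire functions -/

/-! The operator is studied through its derivative. A Littlewood–Paley formula (`exists_lpInt_le`,
`exists_fockInt_le`), valid for every exponent s > 0, says that ‖F‖^s is comparable with |F(0)|^s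
plus the integral of |F'(z)|^s (1+|z|)^{-s} e^{-αs|z|²/2}. Since (C f)' = f(ψ) g'(ψ) ψ', pushing
this integral forward by ψ turns it into ∫ |f|^s e^{-αs|ζ|²/2} dλ, where λ depends on ψ and g but
not on f (`lpInt_compVolterra`). The problem becomes a Carleson embedding problem for λ, and the
transform M is the average of λ against translated Gaussians, which is also the Littlewood–Paley
integral of C k_w (`berezinM_eq_lintegral`, `lpInt_compVolterra_normKernel`).

From exponent p to q ≥ p: by the sub-mean value property for |f|^p with Gaussian weight, λ may be
replaced by the function w ↦ λ(B(w,1)), which M dominates; the surplus power q - p is paid by the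
pointwise bound on f. Conversely, kernels have norm one, so testing on them bounds M by the operator
norm.

From exponent q to p < q: sufficiency is Hölder's inequality with exponents q/p and q/(q-p).
Necessity (`exists_lintegral_berezinM_le_opNorm`) is Luecking's argument: test on sums of kernels
over the Gaussian integers with arbitrary signs, average over the signs to isolate single terms, and
choose the coefficients so that Σ λ(Q_j)^{q/(q-p)} over unit squares appears on both sides. That sum
dominates the integral of M^{q/(q-p)}.

Compactness: a bounded sequence has a pointwise convergent subsequence (normal families), so it is
enough that Littlewood–Paley integrals vanish along bounded sequences tending to 0 pointwise. This
follows from dominated convergence on discs together with a uniform tail estimate. Necessity when p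
≤ q tests on k_w as w escapes to infinity; in the other case compactness already forces a finite
operator norm.

The term |C f(0)| is harmless for qualitative statements, since f ↦ C f(0) is a bounded functional,
but its bound depends on g. It vanishes if ψ(0) = 0, and for nonconstant ψ it is controlled by the
Littlewood–Paley integral itself (`exists_norm_le_deriv_comp`). For constant ψ the transform M is 0
while the operator need not be, so the upper estimates need one of these two hypotheses. -/

theorem lintegral_eq_lintegral_polar {F : ℂ → ℝ≥0∞} (hF : Measurable F) :
    ∫⁻ z, F z = ∫⁻ ρ in Ioi (0 : ℝ), ENNReal.ofReal ρ *
      ∫⁻ θ in Ioo (-Real.pi) Real.pi, F (ρ * Complex.exp (θ * Complex.I)) := by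
  rw [← Complex.lintegral_comp_polarCoord_symm]
  have hE : Measurable fun p : ℝ × ℝ => F (p.1 * Complex.exp (p.2 * Complex.I)) :=
    hF.comp (by fun_prop)
  have : ∀ p : ℝ × ℝ, ENNReal.ofReal p.1 • F (Complex.polarCoord.symm p) =
      ENNReal.ofReal p.1 * F (p.1 * Complex.exp (p.2 * Complex.I)) := by
    intro p
    rw [Complex.polarCoord_symm_apply, Complex.exp_mul_I]
    simp
  simp_rw [this]
  rw [polarCoord_target, Measure.volume_eq_prod, ← Measure.prod_restrict, lintegral_prod]
  · refine lintegral_congr fun ρ => ?_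
    simp only
    rw [lintegral_const_mul]
    exact hE.comp (measurable_const.prodMk measurable_id)
  · exact (Measurable.mul (by fun_prop) hE).aemeasurable

theorem enorm_le_lintegral_circle {f : ℂ → ℂ} (hf : Differentiable ℂ f) (u : ℂ) (ρ : ℝ) :
    ENNReal.ofReal (2 * Real.pi) * ‖f u‖ₑ ≤
      ∫⁻ θ in Ioo (-Real.pi) Real.pi, ‖f (u + ρ * Complex.exp (θ * Complex.I))‖ₑ := by
  have h1 : Real.circleAverage f u ρ = f u := DiffContOnCl.circleAverage hf.diffContOnCl
  have h2 : ∫ θ in (-Real.pi)..Real.pi, f (circleMap u ρ θ) = (2 * Real.pi : ℝ) • f u := by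
    have hper : Function.Periodic (fun θ => f (circleMap u ρ θ)) (2 * Real.pi) := fun θ => by
      simp [periodic_circleMap u ρ θ]
    have := hper.intervalIntegral_add_eq (-Real.pi) 0
    rw [show -Real.pi + 2 * Real.pi = Real.pi by ring, zero_add] at this
    rw [this, ← h1, Real.circleAverage, smul_smul, mul_inv_cancel₀ (by positivity), one_smul]
  rw [intervalIntegral.integral_of_le (by linarith [Real.pi_pos]), integral_Ioc_eq_integral_Ioo] at h2
  calc ENNReal.ofReal (2 * Real.pi) * ‖f u‖ₑ = ‖(2 * Real.pi : ℝ) • f u‖ₑ := by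
        rw [enorm_smul, Real.enorm_of_nonneg (by positivity)]
    _ ≤ _ := by
        rw [← h2]
        exact enorm_integral_le_lintegral_enorm _

/-- Integrate the circle inequality against ρ dρ over (0, r). -/
theorem enorm_mul_le_lintegral_ball {f : ℂ → ℂ} (hf : Differentiable ℂ f) (u : ℂ) {r : ℝ}
    (hr : 0 < r) :
    ENNReal.ofReal (Real.pi * r ^ 2) * ‖f u‖ₑ ≤ ∫⁻ w in ball u r, ‖f w‖ₑ := by
  have hm : Measurable fun w : ℂ => (ball (0 : ℂ) r).indicator (fun w => ‖f (u + w)‖ₑ) w :=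
    Measurable.indicator (hf.continuous.comp (continuous_const.add continuous_id)).enorm.measurable
      measurableSet_ball
  have h1 : ∫⁻ w in ball u r, ‖f w‖ₑ =
      ∫⁻ w, (ball (0 : ℂ) r).indicator (fun w => ‖f (u + w)‖ₑ) w := by
    rw [← lintegral_indicator measurableSet_ball,
      ← lintegral_add_left_eq_self (μ := volume) _ u]
    refine lintegral_congr fun w => ?_
    simp [Set.indicator]
  rw [h1, lintegral_eq_lintegral_polar hm]
  have h2 : ∀ ρ ∈ Ioi (0 : ℝ), (Ioo 0 r).indicator (fun ρ => ENNReal.ofReal ρ *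
      (ENNReal.ofReal (2 * Real.pi) * ‖f u‖ₑ)) ρ ≤ ENNReal.ofReal ρ *
      ∫⁻ θ in Ioo (-Real.pi) Real.pi, (ball (0 : ℂ) r).indicator (fun w => ‖f (u + w)‖ₑ)
        (ρ * Complex.exp (θ * Complex.I)) := by
    intro ρ hρ
    by_cases h : ρ < r
    · rw [indicator_of_mem (show ρ ∈ Ioo 0 r from ⟨hρ, h⟩)]
      gcongr
      refine (enorm_le_lintegral_circle hf u ρ).trans (le_of_eq ?_)
      refine lintegral_congr fun θ => ?_
      rw [indicator_of_mem]
      simpa [Complex.norm_exp_ofReal_mul_I, abs_of_pos (mem_Ioi.1 hρ)] using h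
    · rw [indicator_of_notMem (fun h' => h h'.2)]
      exact zero_le
  refine le_trans ?_ (setLIntegral_mono' measurableSet_Ioi h2)
  rw [lintegral_indicator measurableSet_Ioo, Measure.restrict_restrict measurableSet_Ioo,
    show Ioo 0 r ∩ Ioi 0 = Ioo 0 r from inter_eq_left.2 Ioo_subset_Ioi_self,
    lintegral_mul_const _ (by fun_prop), ← ofReal_integral_eq_lintegral_ofReal, 
    ← integral_Ioc_eq_integral_Ioo, ← intervalIntegral.integral_of_le hr.le, integral_id,
    ← mul_assoc, ← ENNReal.ofReal_mul' (by positivity)]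
  · apply le_of_eq
    congr 2
    ring
  · exact (continuous_id.integrableOn_Icc).mono_set Ioo_subset_Icc_self
  · exact (ae_restrict_mem measurableSet_Ioo).mono fun x hx => hx.1.le

theorem integrableOn_ball_of_continuous {f : ℂ → ℝ} (hf : Continuous f) (u : ℂ) (r : ℝ) :
    IntegrableOn f (ball u r) :=
  (hf.continuousOn.integrableOn_compact (isCompact_closedBall u r)).mono_set ball_subset_closedBall

theorem norm_mul_le_integral_ball {f : ℂ → ℂ} (hf : Differentiable ℂ f) (u : ℂ) {r : ℝ}
    (hr : 0 < r) : Real.pi * r ^ 2 * ‖f u‖ ≤ ∫ w in ball u r, ‖f w‖ := by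
  have h := enorm_mul_le_lintegral_ball hf u hr
  have h2 : ∫⁻ w in ball u r, ‖f w‖ₑ = ENNReal.ofReal (∫ w in ball u r, ‖f w‖) := by
    rw [ofReal_integral_eq_lintegral_ofReal
      (integrableOn_ball_of_continuous hf.continuous.norm u r) (ae_of_all _ fun _ => norm_nonneg _)]
    simp
  rwa [h2, ← ofReal_norm, ← ENNReal.ofReal_mul (by positivity), ENNReal.ofReal_le_ofReal_iff] at h
  exact integral_nonneg fun _ => norm_nonneg _

/-- Cut at the height t = |f(u)|/2: everywhere |f| ≤ t + t^{1-p}|f|^p. In the mean value inequality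
for |f| the term t uses up only half of the left side, and the other half is bounded by the integral
of |f|^p. -/
theorem norm_rpow_le_integral_ball_of_one_le {p : ℝ} (hp : 1 ≤ p) {f : ℂ → ℂ}
    (hf : Differentiable ℂ f) (u : ℂ) {r : ℝ} (hr : 0 < r) :
    r ^ 2 * ‖f u‖ ^ p ≤ 2 ^ p / Real.pi * ∫ w in ball u r, ‖f w‖ ^ p := by
  have hc : Continuous fun w => ‖f w‖ ^ p :=
    hf.continuous.norm.rpow_const fun _ => Or.inr (by linarith)
  have hI : 0 ≤ ∫ w in ball u r, ‖f w‖ ^ p := integral_nonneg fun _ => by positivity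
  rcases (norm_nonneg (f u)).eq_or_lt with h0 | h0
  · rw [← h0, Real.zero_rpow (by linarith)]
    simp only [mul_zero]
    positivity
  set t := ‖f u‖ / 2 with ht
  have htp : 0 < t := by positivity
  have h1 : ∀ w, ‖f w‖ ≤ t + t ^ (1 - p) * ‖f w‖ ^ p := by
    intro w
    rcases le_total ‖f w‖ t with h | h
    · exact h.trans (le_add_of_nonneg_right (by positivity))
    · have hw : 0 < ‖f w‖ := htp.trans_le h
      have : t ^ (1 - p) * ‖f w‖ ^ p = ‖f w‖ * (‖f w‖ / t) ^ (p - 1) := by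
        rw [Real.div_rpow hw.le htp.le, Real.rpow_sub_one hw.ne', show (1 - p) = -(p - 1) by ring,
          Real.rpow_neg htp.le]
        field_simp
      rw [this]
      have : 1 ≤ (‖f w‖ / t) ^ (p - 1) :=
        Real.one_le_rpow ((one_le_div htp).2 h) (by linarith)
      nlinarith
  have h2 : ∫ w in ball u r, ‖f w‖ ≤ Real.pi * r ^ 2 * t +
      t ^ (1 - p) * ∫ w in ball u r, ‖f w‖ ^ p := by
    calc ∫ w in ball u r, ‖f w‖ ≤ ∫ w in ball u r, (t + t ^ (1 - p) * ‖f w‖ ^ p) :=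
          integral_mono (integrableOn_ball_of_continuous hf.continuous.norm u r)
            (integrableOn_ball_of_continuous (by fun_prop) u r) h1
      _ = _ := by
          rw [integral_add (integrableOn_ball_of_continuous (by fun_prop) u r)
            (integrableOn_ball_of_continuous (by fun_prop) u r), integral_const_mul]
          simp [Measure.real, hr.le, mul_comm]
  have h3 := (norm_mul_le_integral_ball hf u hr).trans h2
  have h4 : Real.pi * r ^ 2 * t ≤ t ^ (1 - p) * ∫ w in ball u r, ‖f w‖ ^ p := by
    have : ‖f u‖ = 2 * t := by rw [ht]; ring
    rw [this] at h3
    linarith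
  have h5 : ‖f u‖ ^ p = 2 ^ p * t ^ p := by
    rw [← Real.mul_rpow (by norm_num) htp.le, ht]
    congr 1
    ring
  rw [h5]
  have h6 : t ^ (1 - p) = t / t ^ p := by rw [Real.rpow_sub htp, Real.rpow_one]
  rw [h6, div_mul_eq_mul_div, le_div_iff₀ (by positivity)] at h4
  have h7 : Real.pi * r ^ 2 * t ^ p ≤ ∫ w in ball u r, ‖f w‖ ^ p := by
    nlinarith
  rw [div_mul_eq_mul_div, le_div_iff₀ Real.pi_pos]
  nlinarith [Real.rpow_pos_of_pos (show (0 : ℝ) < 2 by norm_num) p]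

/-- The Hardy–Littlewood device for small exponents. Maximize |f(w)|(r - |w-u|)^{2/p}; on a disc
about the maximum point, of radius half its distance to the boundary, |f| is at most 2^{2/p} times
its value at the centre. There |f| is at most a constant times |f|^p, so the mean value inequality
for |f| becomes one for |f|^p. -/
theorem norm_rpow_le_integral_ball_of_le_one {p : ℝ} (hp0 : 0 < p) (hp : p ≤ 1) {f : ℂ → ℂ}
    (hf : Differentiable ℂ f) (u : ℂ) {r : ℝ} (hr : 0 < r) :
    r ^ 2 * ‖f u‖ ^ p ≤
      4 * 2 ^ (2 / p * (1 - p)) / Real.pi * ∫ w in ball u r, ‖f w‖ ^ p := by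
  have hc : Continuous fun w => ‖f w‖ ^ p :=
    hf.continuous.norm.rpow_const fun _ => Or.inr hp0.le
  have hI : 0 ≤ ∫ w in ball u r, ‖f w‖ ^ p := integral_nonneg fun _ => by positivity
  have hφ : Continuous fun w => ‖f w‖ * (r - ‖w - u‖) ^ (2 / p) := by
    refine hf.continuous.norm.mul (Continuous.rpow_const (by fun_prop) fun _ => Or.inr ?_)
    positivity
  -- The exponent 2/p is chosen so that the p-th power of the weight is an area: comparing the
  -- values at u and w₀ yields r²|f(u)|^p ≤ (2δ)²|f(w₀)|^p.
  obtain ⟨w₀, hw₀, hmax⟩ := (isCompact_closedBall u r).exists_isMaxOn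
    ⟨u, mem_closedBall_self hr.le⟩ hφ.continuousOn
  have hmax' : ∀ w, ‖w - u‖ ≤ r →
      ‖f w‖ * (r - ‖w - u‖) ^ (2 / p) ≤ ‖f w₀‖ * (r - ‖w₀ - u‖) ^ (2 / p) := fun w hw =>
    hmax (mem_closedBall_iff_norm.2 hw)
  have hw₀' : ‖w₀ - u‖ ≤ r := mem_closedBall_iff_norm.1 hw₀
  rcases (norm_nonneg (f u)).eq_or_lt with h0 | h0
  · rw [← h0, Real.zero_rpow hp0.ne']
    simp only [mul_zero]
    positivity
  have hu := hmax' u (by simpa using hr.le)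
  simp only [sub_self, norm_zero, sub_zero] at hu
  set δ := (r - ‖w₀ - u‖) / 2 with hδ
  have h2δ : r - ‖w₀ - u‖ = 2 * δ := by rw [hδ]; ring
  rw [h2δ] at hu hmax'
  have hδ0 : 0 < δ := by
    have : 0 ≤ δ := by rw [hδ]; linarith
    refine this.lt_of_ne fun h => ?_
    rw [← h, mul_zero, Real.zero_rpow (by positivity), mul_zero] at hu
    have : 0 < ‖f u‖ * r ^ (2 / p) := by positivity
    linarith
  have hS : ∀ w ∈ ball w₀ δ, ‖f w‖ ≤ ‖f w₀‖ * 2 ^ (2 / p) := by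
    intro w hw
    rw [mem_ball_iff_norm] at hw
    have h1 : ‖w - u‖ ≤ ‖w - w₀‖ + ‖w₀ - u‖ := norm_sub_le_norm_sub_add_norm_sub w w₀ u
    have h2 := hmax' w (by linarith)
    have h3 : δ ^ (2 / p) ≤ (r - ‖w - u‖) ^ (2 / p) :=
      Real.rpow_le_rpow hδ0.le (by linarith) (by positivity)
    rw [Real.mul_rpow (by norm_num) hδ0.le] at h2
    have h4 : ‖f w‖ * δ ^ (2 / p) ≤ ‖f w₀‖ * 2 ^ (2 / p) * δ ^ (2 / p) := by
      calc _ ≤ ‖f w‖ * (r - ‖w - u‖) ^ (2 / p) := by gcongr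
        _ ≤ _ := by linarith
    exact le_of_mul_le_mul_right h4 (by positivity)
  have hw0 : 0 < ‖f w₀‖ := by
    refine (norm_nonneg _).lt_of_ne fun h => ?_
    rw [← h, zero_mul] at hu
    have : 0 < ‖f u‖ * r ^ (2 / p) := by positivity
    linarith
  have hsub : ball w₀ δ ⊆ ball u r := by
    refine ball_subset_ball' ?_
    rw [dist_eq_norm]
    linarith
  have h1 : ∫ w in ball w₀ δ, ‖f w‖ ≤
      (‖f w₀‖ * 2 ^ (2 / p)) ^ (1 - p) * ∫ w in ball u r, ‖f w‖ ^ p := by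
    calc ∫ w in ball w₀ δ, ‖f w‖
        ≤ ∫ w in ball w₀ δ, (‖f w₀‖ * 2 ^ (2 / p)) ^ (1 - p) * ‖f w‖ ^ p := by
          refine setIntegral_mono_on (integrableOn_ball_of_continuous hf.continuous.norm _ _)
            (integrableOn_ball_of_continuous (by fun_prop) _ _) measurableSet_ball fun w hw => ?_
          calc ‖f w‖ = ‖f w‖ ^ (1 - p) * ‖f w‖ ^ p := by
                rw [← Real.rpow_add' (norm_nonneg _) (by simp)]
                simp
            _ ≤ _ := by
                exact mul_le_mul_of_nonneg_right
                  (Real.rpow_le_rpow (norm_nonneg _) (hS w hw) (by linarith)) (by positivity)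
      _ = (‖f w₀‖ * 2 ^ (2 / p)) ^ (1 - p) * ∫ w in ball w₀ δ, ‖f w‖ ^ p := integral_const_mul _ _
      _ ≤ _ := by
          gcongr
          · exact ae_of_all _ fun _ => by positivity
          · exact integrableOn_ball_of_continuous hc _ _
  have h2 := (norm_mul_le_integral_ball hf w₀ hδ0).trans h1
  rw [Real.mul_rpow hw0.le (by positivity), ← Real.rpow_mul (by norm_num),
    Real.rpow_sub hw0, Real.rpow_one, div_mul_eq_mul_div, div_mul_eq_mul_div,
    le_div_iff₀ (by positivity)] at h2
  have h3 : Real.pi * δ ^ 2 * ‖f w₀‖ ^ p ≤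
      2 ^ (2 / p * (1 - p)) * ∫ w in ball u r, ‖f w‖ ^ p := by
    nlinarith
  have hpow : ∀ a x : ℝ, 0 ≤ a → 0 ≤ x → (a * x ^ (2 / p)) ^ p = x ^ 2 * a ^ p := by
    intro a x ha hx
    rw [Real.mul_rpow ha (by positivity), ← Real.rpow_mul hx, div_mul_cancel₀ _ hp0.ne',
      mul_comm]
    norm_cast
  have h4 := Real.rpow_le_rpow (by positivity) hu hp0.le
  rw [hpow _ _ h0.le hr.le, hpow _ _ hw0.le (by positivity)] at h4
  refine h4.trans ?_
  rw [div_mul_eq_mul_div, le_div_iff₀ Real.pi_pos]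
  linarith

/-- Sub-mean value inequality for `|f|^p` on discs, up to a constant, for every `p > 0`. -/
theorem exists_enorm_rpow_le_lintegral_ball {p : ℝ} (hp : 0 < p) :
    ∃ C : ℝ, 0 < C ∧ ∀ f : ℂ → ℂ, Differentiable ℂ f → ∀ (u : ℂ) (r : ℝ), 0 < r →
      ‖f u‖ₑ ^ p ≤ ENNReal.ofReal (C / r ^ 2) * ∫⁻ w in ball u r, ‖f w‖ₑ ^ p := by
  obtain ⟨C, hC, h⟩ : ∃ C : ℝ, 0 < C ∧ ∀ f : ℂ → ℂ, Differentiable ℂ f → ∀ (u : ℂ) (r : ℝ), 0 < r →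
      r ^ 2 * ‖f u‖ ^ p ≤ C * ∫ w in ball u r, ‖f w‖ ^ p := by
    rcases le_total p 1 with h | h
    · exact ⟨_, by positivity, fun f hf u r hr => norm_rpow_le_integral_ball_of_le_one hp h hf u hr⟩
    · exact ⟨_, by positivity, fun f hf u r hr => norm_rpow_le_integral_ball_of_one_le h hf u hr⟩
  refine ⟨C, hC, fun f hf u r hr => ?_⟩
  have hc : Continuous fun w => ‖f w‖ ^ p :=
    hf.continuous.norm.rpow_const fun _ => Or.inr hp.le
  have he : ∀ w, ‖f w‖ₑ ^ p = ENNReal.ofReal (‖f w‖ ^ p) := fun w => by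
    rw [← ofReal_norm, ENNReal.ofReal_rpow_of_nonneg (norm_nonneg _) hp.le]
  simp_rw [he]
  rw [← ofReal_integral_eq_lintegral_ofReal (integrableOn_ball_of_continuous hc u r)
    (ae_of_all _ fun _ => by positivity), ← ENNReal.ofReal_mul (by positivity)]
  refine ENNReal.ofReal_le_ofReal ?_
  rw [div_mul_eq_mul_div, le_div_iff₀ (by positivity), mul_comm]
  exact h f hf u r hr

/-! ### Powers in [0, ∞], and local estimates for derivatives and increments -/

theorem add_rpow_le_two_rpow_mul {p : ℝ} (hp : 0 ≤ p) (a b : ℝ≥0∞) :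
    (a + b) ^ p ≤ 2 ^ p * (a ^ p + b ^ p) := by
  have : a + b ≤ 2 * max a b := by
    rw [two_mul]
    gcongr
    · exact le_max_left a b
    · exact le_max_right a b
  calc (a + b) ^ p ≤ (2 * max a b) ^ p := by gcongr
    _ = 2 ^ p * max a b ^ p := ENNReal.mul_rpow_of_nonneg _ _ hp
    _ ≤ _ := by
        gcongr
        rcases le_total a b with h | h
        · rw [max_eq_right h]
          exact le_add_self
        · rw [max_eq_left h]
          exact le_self_add

theorem enorm_add_rpow_le {p : ℝ} (hp : 0 ≤ p) (a b : ℂ) :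
    ‖a + b‖ₑ ^ p ≤ 2 ^ p * (‖a‖ₑ ^ p + ‖b‖ₑ ^ p) :=
  (ENNReal.rpow_le_rpow (enorm_add_le a b) hp).trans (add_rpow_le_two_rpow_mul hp _ _)

/-- Moves an estimate with a real bound S to [0, ∞]: an infinite X needs no proof, and a finite one
is S^p for some S ≥ 0. -/
theorem enorm_rpow_le_of_forall_norm_le {p : ℝ} (hp : 0 < p) {X : ℝ≥0∞} {z : ℂ} {a : ℝ}
    (ha : 0 ≤ a) (h : ∀ S : ℝ, 0 ≤ S → X = ENNReal.ofReal (S ^ p) → a * ‖z‖ ≤ S) :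
    ENNReal.ofReal (a ^ p) * ‖z‖ₑ ^ p ≤ X := by
  by_cases hX : X = ⊤
  · simp [hX]
  have h1 : X = ENNReal.ofReal ((X.toReal ^ (1 / p)) ^ p) := by
    rw [← Real.rpow_mul ENNReal.toReal_nonneg, one_div_mul_cancel hp.ne', Real.rpow_one,
      ENNReal.ofReal_toReal hX]
  have h2 := h _ (by positivity) h1
  rw [h1, ← ofReal_norm, ENNReal.ofReal_rpow_of_nonneg (norm_nonneg _) hp.le,
    ← ENNReal.ofReal_mul (by positivity), ← Real.mul_rpow ha (norm_nonneg _)]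
  exact ENNReal.ofReal_le_ofReal (Real.rpow_le_rpow (by positivity) h2 hp.le)

theorem norm_le_of_enorm_rpow_le {p : ℝ} (hp : 0 < p) {z : ℂ} {S : ℝ} (hS : 0 ≤ S)
    (h : ‖z‖ₑ ^ p ≤ ENNReal.ofReal (S ^ p)) : ‖z‖ ≤ S := by
  rw [← ofReal_norm, ENNReal.ofReal_rpow_of_nonneg (norm_nonneg _) hp.le,
    ENNReal.ofReal_le_ofReal_iff (by positivity)] at h
  exact (Real.rpow_le_rpow_iff (norm_nonneg _) hS hp).1 h

/-- Bound for the derivative of an entire function by a local `p`-th mean. -/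
theorem exists_enorm_deriv_rpow_le {p : ℝ} (hp : 0 < p) :
    ∃ C : ℝ, 0 < C ∧ ∀ f : ℂ → ℂ, Differentiable ℂ f → ∀ (u : ℂ) (r : ℝ), 0 < r →
      ENNReal.ofReal (r ^ p) * ‖deriv f u‖ₑ ^ p ≤
        ENNReal.ofReal (C / r ^ 2) * ∫⁻ w in ball u (2 * r), ‖f w‖ₑ ^ p := by
  obtain ⟨C, hC, h⟩ := exists_enorm_rpow_le_lintegral_ball hp
  refine ⟨C, hC, fun f hf u r hr => enorm_rpow_le_of_forall_norm_le hp hr.le fun S hS hX => ?_⟩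
  -- Discs of radius r about points of the circle lie in the disc of radius 2r about u, so one local
  -- mean bounds f on the whole circle and Cauchy's estimate applies.
  have hb : ∀ w ∈ sphere u r, ‖f w‖ ≤ S := by
    intro w hw
    refine norm_le_of_enorm_rpow_le hp hS ?_
    rw [← hX]
    refine (h f hf w r hr).trans ?_
    gcongr
    refine ball_subset_ball' ?_
    rw [mem_sphere.1 hw]
    linarith
  have := Complex.norm_deriv_le_of_forall_mem_sphere_norm_le hr hf.diffContOnCl hb
  rw [le_div_iff₀ hr] at this
  linarith

/-- Bound for an increment of an entire function by a local `p`-th mean of the derivative. -/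
theorem exists_enorm_sub_rpow_le {p : ℝ} (hp : 0 < p) :
    ∃ C : ℝ, 0 < C ∧ ∀ f : ℂ → ℂ, Differentiable ℂ f → ∀ (u v : ℂ) (s r : ℝ), 0 < s → 0 < r →
      ‖u - v‖ ≤ s → ‖f u - f v‖ₑ ^ p ≤
        ENNReal.ofReal (s ^ p * (C / r ^ 2)) * ∫⁻ w in ball u (s + r), ‖deriv f w‖ₑ ^ p := by
  obtain ⟨C, hC, h⟩ := exists_enorm_rpow_le_lintegral_ball hp
  refine ⟨C, hC, fun f hf u v s r hs hr huv => ?_⟩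
  have key : ENNReal.ofReal (s⁻¹ ^ p) * ‖f u - f v‖ₑ ^ p ≤
      ENNReal.ofReal (C / r ^ 2) * ∫⁻ w in ball u (s + r), ‖deriv f w‖ₑ ^ p := by
    refine enorm_rpow_le_of_forall_norm_le hp (by positivity) fun S hS hX => ?_
    -- The whole segment lies within s of u, so the mean over the disc of radius s + r bounds the
    -- derivative along it, and the mean value inequality gives the increment.
    have hb : ∀ w ∈ segment ℝ v u, ‖deriv f w‖ ≤ S := by
      intro w hw
      refine norm_le_of_enorm_rpow_le hp hS ?_
      rw [← hX]
      refine (h _ hf.deriv w r hr).trans ?_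
      gcongr
      refine ball_subset_ball' ?_
      have : dist w u ≤ s := by
        have hcv := (convex_closedBall u s).segment_subset (x := v) (y := u)
          (by rw [mem_closedBall, dist_comm, dist_eq_norm]; exact huv)
          (mem_closedBall_self hs.le)
        exact hcv hw
      linarith
    have := (convex_segment (𝕜 := ℝ) v u).norm_image_sub_le_of_norm_deriv_le (𝕜 := ℂ) (f := f)
      (fun x _ => hf x) hb (left_mem_segment ℝ v u) (right_mem_segment ℝ v u)
    rw [inv_mul_le_iff₀ hs]
    calc _ ≤ _ := this
      _ ≤ _ := by
        rw [mul_comm]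
        gcongr
  calc ‖f u - f v‖ₑ ^ p = ENNReal.ofReal (s ^ p) *
        (ENNReal.ofReal (s⁻¹ ^ p) * ‖f u - f v‖ₑ ^ p) := by
        rw [← mul_assoc, ← ENNReal.ofReal_mul (by positivity),
          ← Real.mul_rpow hs.le (by positivity), mul_inv_cancel₀ hs.ne']
        simp
    _ ≤ _ := by
        rw [ENNReal.ofReal_mul (by positivity), mul_assoc]
        gcongr

/-! ### Gaussian weights -/

/-- The Gaussian weight `e^{-c|z|^2}`. -/
def gaussWeight (c : ℝ) (z : ℂ) : ℝ≥0∞ := ENNReal.ofReal (Real.exp (-c * ‖z‖ ^ 2))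

/-- The integral of `|f|^p` against a Gaussian weight. -/
def fockInt (p c : ℝ) (f : ℂ → ℂ) : ℝ≥0∞ := ∫⁻ z, ‖f z‖ₑ ^ p * gaussWeight c z

/-- The Littlewood-Paley integral `∫ |F'(z)|^p (1+|z|)^{-p} e^{-c|z|^2}`. -/
def lpInt (p c : ℝ) (F : ℂ → ℂ) : ℝ≥0∞ :=
  ∫⁻ z, ‖deriv F z‖ₑ ^ p * ENNReal.ofReal ((1 + ‖z‖) ^ (-p)) * gaussWeight c z

theorem continuous_gaussWeight (c : ℝ) : Continuous (gaussWeight c) :=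
  ENNReal.continuous_ofReal.comp (by fun_prop)

@[fun_prop]
theorem measurable_gaussWeight (c : ℝ) : Measurable (gaussWeight c) :=
  (continuous_gaussWeight c).measurable

theorem gaussWeight_ne_top (c : ℝ) (z : ℂ) : gaussWeight c z ≠ ⊤ := ENNReal.ofReal_ne_top

theorem gaussWeight_le_one {c : ℝ} (hc : 0 ≤ c) (z : ℂ) : gaussWeight c z ≤ 1 := by
  rw [gaussWeight, ENNReal.ofReal_le_one, Real.exp_le_one_iff]
  have : 0 ≤ c * ‖z‖ ^ 2 := by positivity
  linarith

theorem gaussWeight_rpow (c s : ℝ) (z : ℂ) : gaussWeight c z ^ s = gaussWeight (c * s) z := by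
  rw [gaussWeight, gaussWeight, ENNReal.ofReal_rpow_of_pos (Real.exp_pos _), ← Real.exp_mul]
  congr 2
  ring

theorem lintegral_gaussWeight {c : ℝ} (hc : 0 < c) :
    ∫⁻ z, gaussWeight c z = ENNReal.ofReal (Real.pi / c) := by
  have h := GaussianFourier.integral_rexp_neg_mul_sq_norm (V := ℂ) hc
  have hi : Integrable (fun z : ℂ => Real.exp (-c * ‖z‖ ^ 2)) := by
    by_contra hn
    rw [integral_undef hn] at h
    have : 0 < (Real.pi / c) ^ ((Module.finrank ℝ ℂ : ℝ) / 2) := by positivity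
    linarith
  unfold gaussWeight
  rw [← ofReal_integral_eq_lintegral_ofReal hi (ae_of_all _ fun _ => (Real.exp_pos _).le), h]
  simp [Complex.finrank_real_complex]

theorem measurable_enorm_rpow {f : ℂ → ℂ} (hf : Continuous f) (p : ℝ) :
    Measurable fun z => ‖f z‖ₑ ^ p :=
  (hf.enorm.measurable).pow_const p

/-- At distance B/(1+|z|) the quantity |z|² can grow by at most 2B + B². This makes 1/(1+|z|) the
natural scale on which the weight is essentially constant. -/
theorem exists_gaussWeight_le {c : ℝ} (hc : 0 ≤ c) {B : ℝ} (hB : 0 ≤ B) :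
    ∃ C : ℝ, 0 < C ∧ ∀ z w : ℂ, ‖w - z‖ ≤ B / (1 + ‖z‖) →
      gaussWeight c z ≤ ENNReal.ofReal C * gaussWeight c w := by
  refine ⟨Real.exp (c * (2 * B + B ^ 2)), Real.exp_pos _, fun z w h => ?_⟩
  rw [gaussWeight, gaussWeight, ← ENNReal.ofReal_mul (Real.exp_pos _).le, ← Real.exp_add]
  refine ENNReal.ofReal_le_ofReal (Real.exp_le_exp.2 ?_)
  have hz := norm_nonneg z
  set δ := B / (1 + ‖z‖) with hδ
  have h1 : δ * (1 + ‖z‖) = B := div_mul_cancel₀ _ (by positivity)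
  have hδ0 : 0 ≤ δ := by positivity
  have h2 : ‖w‖ ≤ ‖z‖ + δ := by
    have := norm_le_norm_add_norm_sub' w z
    linarith
  have h3 : ‖w‖ ^ 2 ≤ ‖z‖ ^ 2 + (2 * B + B ^ 2) := by
    have : ‖w‖ ^ 2 ≤ (‖z‖ + δ) ^ 2 := by gcongr
    have h5 : δ ≤ B := by nlinarith
    have h6 : δ * ‖z‖ ≤ B := by nlinarith
    nlinarith
  nlinarith

theorem one_add_norm_le {B : ℝ} (hB : 0 ≤ B) {z w : ℂ} (h : ‖w - z‖ ≤ B / (1 + ‖z‖)) :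
    1 + ‖w‖ ≤ (1 + B) * (1 + ‖z‖) ∧ 1 + ‖z‖ ≤ (1 + B) * (1 + ‖w‖) := by
  have h1 : B / (1 + ‖z‖) ≤ B := div_le_self hB (by linarith [norm_nonneg z])
  have h2 := norm_le_norm_add_norm_sub' w z
  have h3 := norm_le_norm_add_norm_sub w z
  constructor
  · nlinarith [norm_nonneg z]
  · nlinarith [norm_nonneg w]

/-- Tonelli: (1+|z|)² is, up to a constant, the inverse area of the disc about z, and the points z
whose disc contains a given w lie in a disc about w of comparable radius. -/
theorem lintegral_lintegral_ball_le {B : ℝ} (hB : 0 ≤ B) :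
    ∃ C : ℝ, 0 < C ∧ ∀ G : ℂ → ℝ≥0∞, Measurable G →
      ∫⁻ z : ℂ, ENNReal.ofReal ((1 + ‖z‖) ^ 2) * ∫⁻ w in ball z (B / (1 + ‖z‖)), G w ≤
        ENNReal.ofReal C * ∫⁻ w, G w := by
  refine ⟨(1 + B) ^ 2 * ((B + 1) * (1 + B)) ^ 2 * Real.pi, by positivity, fun G hG => ?_⟩
  have hS : MeasurableSet {x : ℂ × ℂ | dist x.2 x.1 < B / (1 + ‖x.1‖)} := by
    refine measurableSet_lt (by fun_prop) ?_
    exact Measurable.div (by fun_prop) (by fun_prop)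
  have hK : Measurable (fun x : ℂ × ℂ => ENNReal.ofReal ((1 + ‖x.1‖) ^ 2) *
      ({x : ℂ × ℂ | dist x.2 x.1 < B / (1 + ‖x.1‖)}.indicator (fun x => G x.2) x)) :=
    Measurable.mul (by fun_prop) ((hG.comp measurable_snd).indicator hS)
  have h1 : ∀ z : ℂ, ENNReal.ofReal ((1 + ‖z‖) ^ 2) * ∫⁻ w in ball z (B / (1 + ‖z‖)), G w =
      ∫⁻ w, ENNReal.ofReal ((1 + ‖z‖) ^ 2) *
        ({x : ℂ × ℂ | dist x.2 x.1 < B / (1 + ‖x.1‖)}.indicator (fun x => G x.2) (z, w)) := by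
    intro z
    rw [lintegral_const_mul' _ _ ENNReal.ofReal_ne_top, ← lintegral_indicator measurableSet_ball]
    rfl
  simp_rw [h1]
  rw [lintegral_lintegral_swap hK.aemeasurable]
  have h2 : ∀ w : ℂ, ∫⁻ z, ENNReal.ofReal ((1 + ‖z‖) ^ 2) *
        ({x : ℂ × ℂ | dist x.2 x.1 < B / (1 + ‖x.1‖)}.indicator (fun x => G x.2) (z, w)) ≤
      ENNReal.ofReal ((1 + B) ^ 2 * ((B + 1) * (1 + B)) ^ 2 * Real.pi) * G w := by
    intro w
    have hw := norm_nonneg w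
    set R := (B + 1) * (1 + B) / (1 + ‖w‖) with hR
    have hR0 : 0 < R := by positivity
    have h3 : ∀ z : ℂ, ENNReal.ofReal ((1 + ‖z‖) ^ 2) *
        ({x : ℂ × ℂ | dist x.2 x.1 < B / (1 + ‖x.1‖)}.indicator (fun x => G x.2) (z, w)) ≤
        (ball w R).indicator (fun _ => ENNReal.ofReal (((1 + B) * (1 + ‖w‖)) ^ 2) * G w) z := by
      intro z
      by_cases h : dist w z < B / (1 + ‖z‖)
      · have h' := one_add_norm_le hB (z := z) (w := w) (by rw [← dist_eq_norm]; exact h.le)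
        have hz := norm_nonneg z
        rw [indicator_of_mem (show (z, w) ∈ _ from h), indicator_of_mem]
        · gcongr
          exact h'.2
        · rw [mem_ball, dist_comm]
          refine h.trans_le ?_
          rw [hR, div_le_div_iff₀ (by positivity) (by positivity)]
          nlinarith
      · rw [indicator_of_notMem (show (z, w) ∉ _ from h)]
        simp
    refine (lintegral_mono h3).trans (le_of_eq ?_)
    rw [lintegral_indicator measurableSet_ball, setLIntegral_const, Complex.volume_ball]
    rw [← ENNReal.ofReal_pow hR0.le, mul_right_comm]
    have : (NNReal.pi : ℝ≥0∞) = ENNReal.ofReal Real.pi := by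
      rw [← NNReal.coe_real_pi, ENNReal.ofReal_coe_nnreal]
    rw [this, ← ENNReal.ofReal_mul (by positivity), ← ENNReal.ofReal_mul (by positivity)]
    congr 2
    rw [hR]
    field_simp
  refine (lintegral_mono h2).trans (le_of_eq ?_)
  rw [lintegral_const_mul' _ _ ENNReal.ofReal_ne_top]

/-- Half of the Littlewood-Paley formula: the derivative is controlled by the function. -/
theorem exists_lpInt_le {p c : ℝ} (hp : 0 < p) (hc : 0 < c) :
    ∃ C : ℝ, 0 < C ∧ ∀ F : ℂ → ℂ, Differentiable ℂ F →
      lpInt p c F ≤ ENNReal.ofReal C * fockInt p c F := by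
  obtain ⟨C₁, hC₁, h₁⟩ := exists_enorm_deriv_rpow_le hp
  obtain ⟨C₂, hC₂, h₂⟩ := exists_gaussWeight_le hc.le (B := 2) (by norm_num)
  obtain ⟨C₃, hC₃, h₃⟩ := lintegral_lintegral_ball_le (B := 2) (by norm_num)
  refine ⟨C₁ * C₂ * C₃, by positivity, fun F hF => ?_⟩
  have hm : Measurable fun w => ‖F w‖ₑ ^ p * gaussWeight c w :=
    (measurable_enorm_rpow hF.continuous p).mul (measurable_gaussWeight c)
  have key : ∀ z, ‖deriv F z‖ₑ ^ p * ENNReal.ofReal ((1 + ‖z‖) ^ (-p)) * gaussWeight c z ≤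
      ENNReal.ofReal (C₁ * C₂) * (ENNReal.ofReal ((1 + ‖z‖) ^ 2) *
        ∫⁻ w in ball z (2 / (1 + ‖z‖)), ‖F w‖ₑ ^ p * gaussWeight c w) := by
    intro z
    have hz : 0 < 1 + ‖z‖ := by positivity
    -- The radius 1/(1+|z|) produces the Littlewood–Paley factor (1+|z|)^{-p}; the mean is over
    -- twice this radius, hence B = 2 above.
    have e := h₁ F hF z (1 / (1 + ‖z‖)) (by positivity)
    have e1 : (1 / (1 + ‖z‖)) ^ p = (1 + ‖z‖) ^ (-p) := by
      rw [one_div, Real.inv_rpow hz.le, Real.rpow_neg hz.le]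
    have e2 : C₁ / (1 / (1 + ‖z‖)) ^ 2 = C₁ * (1 + ‖z‖) ^ 2 := by field_simp
    rw [e1, e2, mul_one_div] at e
    calc _ = (ENNReal.ofReal ((1 + ‖z‖) ^ (-p)) * ‖deriv F z‖ₑ ^ p) * gaussWeight c z := by ring
      _ ≤ ENNReal.ofReal (C₁ * (1 + ‖z‖) ^ 2) * (∫⁻ w in ball z (2 / (1 + ‖z‖)), ‖F w‖ₑ ^ p) *
          gaussWeight c z := by gcongr
      _ = ENNReal.ofReal (C₁ * (1 + ‖z‖) ^ 2) * ∫⁻ w in ball z (2 / (1 + ‖z‖)),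
          ‖F w‖ₑ ^ p * gaussWeight c z := by
          rw [lintegral_mul_const' _ _ (gaussWeight_ne_top c z), mul_assoc]
      _ ≤ ENNReal.ofReal (C₁ * (1 + ‖z‖) ^ 2) * ∫⁻ w in ball z (2 / (1 + ‖z‖)),
          ENNReal.ofReal C₂ * (‖F w‖ₑ ^ p * gaussWeight c w) := by
          refine mul_le_mul' le_rfl (setLIntegral_mono' measurableSet_ball fun w hw => ?_)
          rw [mul_left_comm]
          gcongr
          exact h₂ z w (by rw [← dist_eq_norm]; exact (mem_ball.1 hw).le)
      _ = _ := by
          rw [lintegral_const_mul' _ _ ENNReal.ofReal_ne_top, ENNReal.ofReal_mul hC₁.le,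
            ENNReal.ofReal_mul hC₁.le]
          ring
  calc lpInt p c F ≤ _ := lintegral_mono key
    _ = ENNReal.ofReal (C₁ * C₂) * ∫⁻ z, (ENNReal.ofReal ((1 + ‖z‖) ^ 2) *
        ∫⁻ w in ball z (2 / (1 + ‖z‖)), ‖F w‖ₑ ^ p * gaussWeight c w) :=
        lintegral_const_mul' _ _ ENNReal.ofReal_ne_top
    _ ≤ ENNReal.ofReal (C₁ * C₂) * (ENNReal.ofReal C₃ * fockInt p c F) := by
        gcongr
        exact h₃ _ hm
    _ = _ := by
        rw [← mul_assoc, ← ENNReal.ofReal_mul (by positivity)]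

/-! ### The radial contraction `|z|² ↦ |z|² - K` -/

/-- The radial map that lowers `|z|^2` by `K`, and sends the disc `|z|^2 ≤ K` to `0`. -/
def radialShift (K : ℝ) (z : ℂ) : ℂ := (Real.sqrt (1 - K / ‖z‖ ^ 2) : ℝ) * z

theorem measurable_radialShift (K : ℝ) : Measurable (radialShift K) := by
  unfold radialShift
  refine Measurable.mul ?_ measurable_id
  exact Complex.measurable_ofReal.comp
    (Real.continuous_sqrt.measurable.comp (measurable_const.sub
      (measurable_const.div (by fun_prop))))

theorem norm_sq_radialShift {K : ℝ} {z : ℂ} (hK : 0 ≤ K) (hz : K < ‖z‖ ^ 2) :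
    ‖radialShift K z‖ ^ 2 = ‖z‖ ^ 2 - K := by
  have h0 : 0 < ‖z‖ ^ 2 := by linarith
  have h1 : 0 ≤ 1 - K / ‖z‖ ^ 2 := by
    rw [sub_nonneg, div_le_one h0]
    exact hz.le
  rw [radialShift, norm_mul, mul_pow, Complex.norm_real, Real.norm_of_nonneg (Real.sqrt_nonneg _),
    Real.sq_sqrt h1, sub_mul, div_mul_cancel₀ _ h0.ne', one_mul]

/-- Default values are used here: `Real.sqrt` vanishes at nonpositive arguments, and at the origin
the factor z is already 0. -/
theorem radialShift_of_le {K : ℝ} {z : ℂ} (hz : ‖z‖ ^ 2 ≤ K) : radialShift K z = 0 := by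
  rcases eq_or_ne z 0 with rfl | h
  · simp [radialShift]
  have h0 : 0 < ‖z‖ ^ 2 := by positivity
  have : 1 - K / ‖z‖ ^ 2 ≤ 0 := by
    rw [sub_nonpos, one_le_div h0]
    exact hz
  simp [radialShift, Real.sqrt_eq_zero_of_nonpos this]

/-- Lowering |z|² by K moves z by at most about K/|z|, so the shift stays within the scale
1/(1+|z|); inside the disc |z|² ≤ K the displacement is |z| itself. -/
theorem norm_radialShift_sub_le {K : ℝ} (hK : 1 ≤ K) (z : ℂ) :
    ‖z - radialShift K z‖ ≤ 2 * K / (1 + ‖z‖) := by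
  have hz := norm_nonneg z
  rw [le_div_iff₀ (by positivity)]
  rcases le_or_gt (‖z‖ ^ 2) K with h | h
  · rw [radialShift_of_le h, sub_zero]
    nlinarith [sq_nonneg (‖z‖ - 1)]
  · have h0 : 0 < ‖z‖ ^ 2 := by linarith
    have h1 : 0 ≤ 1 - K / ‖z‖ ^ 2 := by
      rw [sub_nonneg, div_le_one h0]
      exact h.le
    set t := Real.sqrt (1 - K / ‖z‖ ^ 2) with ht
    have ht0 : 0 ≤ t := Real.sqrt_nonneg _
    have ht2 : t ^ 2 * ‖z‖ ^ 2 = ‖z‖ ^ 2 - K := by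
      rw [ht, Real.sq_sqrt h1, sub_mul, div_mul_cancel₀ _ h0.ne', one_mul]
    have ht1 : t ≤ 1 := by
      have : 0 ≤ K / ‖z‖ ^ 2 := by positivity
      exact Real.sqrt_le_one.2 (by linarith)
    have e : z - radialShift K z = ((1 - t : ℝ) : ℂ) * z := by
      rw [radialShift, ← ht]
      push_cast
      ring
    rw [e, norm_mul, Complex.norm_real, Real.norm_of_nonneg (by linarith)]
    have hz1 : 1 ≤ ‖z‖ := by nlinarith
    have h5 : (1 - t) * ‖z‖ ^ 2 ≤ K := by nlinarith [mul_nonneg ht0 (mul_nonneg (sub_nonneg.2 ht1) h0.le)]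
    nlinarith [mul_nonneg (sub_nonneg.2 ht1) hz, mul_nonneg (mul_nonneg (sub_nonneg.2 ht1) hz) (sub_nonneg.2 hz1)]

/-- The substitution ρ² = s² + K, under which ρ dρ = s ds. -/
theorem lintegral_Ioi_sqrt_sub {K : ℝ} (hK : 0 ≤ K) (h : ℝ → ℝ≥0∞) :
    ∫⁻ ρ in Ioi (Real.sqrt K), ENNReal.ofReal ρ * h (Real.sqrt (ρ ^ 2 - K)) =
      ∫⁻ s in Ioi (0 : ℝ), ENNReal.ofReal s * h s := by
  have himg : (fun s : ℝ => Real.sqrt (s ^ 2 + K)) '' Ioi 0 = Ioi (Real.sqrt K) := by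
    ext ρ
    constructor
    · rintro ⟨s, hs, rfl⟩
      have : 0 < s ^ 2 := pow_pos hs 2
      exact Real.sqrt_lt_sqrt hK (by linarith)
    · intro hρ
      have hρ0 : 0 < ρ := (Real.sqrt_nonneg K).trans_lt hρ
      have h1 : K < ρ ^ 2 := (Real.sqrt_lt' hρ0).1 hρ
      refine ⟨Real.sqrt (ρ ^ 2 - K), Real.sqrt_pos.2 (by linarith), ?_⟩
      simp only
      rw [Real.sq_sqrt (by linarith), sub_add_cancel, Real.sqrt_sq hρ0.le]
  have hinj : InjOn (fun s : ℝ => Real.sqrt (s ^ 2 + K)) (Ioi 0) := by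
    intro s hs t ht hst
    simp only at hst
    rw [Real.sqrt_inj (by positivity) (by positivity), add_left_inj] at hst
    exact (pow_left_inj₀ (le_of_lt hs) (le_of_lt ht) two_ne_zero).1 hst
  have hder : ∀ s ∈ Ioi (0 : ℝ), HasDerivWithinAt (fun s : ℝ => Real.sqrt (s ^ 2 + K))
      (s / Real.sqrt (s ^ 2 + K)) (Ioi 0) s := by
    intro s hs
    have : 0 < s ^ 2 := pow_pos hs 2
    have h1 : HasDerivAt (fun s : ℝ => s ^ 2 + K) (2 * s) s := by
      simpa using (hasDerivAt_pow 2 s).add_const K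
    refine ((h1.sqrt (by positivity)).congr_deriv ?_).hasDerivWithinAt
    field_simp
  rw [← himg, lintegral_image_eq_lintegral_abs_deriv_mul measurableSet_Ioi hder hinj]
  refine setLIntegral_congr_fun measurableSet_Ioi fun s hs => ?_
  have hs0 : 0 < s := hs
  have : 0 < Real.sqrt (s ^ 2 + K) := Real.sqrt_pos.2 (by positivity)
  rw [Real.sq_sqrt (by positivity), add_sub_cancel_right, Real.sqrt_sq hs0.le, ← mul_assoc,
    ← ENNReal.ofReal_mul (by positivity), abs_of_pos (by positivity), div_mul_cancel₀ _ this.ne']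

/-- Since ρ dρ = s ds, the shift preserves area outside the disc |z|² ≤ K. The only change under it
is the Gaussian weight, by the factor e^{-cK}. -/
theorem lintegral_comp_radialShift {K : ℝ} (hK : 0 ≤ K) {H : ℂ → ℝ≥0∞} (hH : Measurable H) :
    ∫⁻ z in {z : ℂ | K < ‖z‖ ^ 2}, H (radialShift K z) = ∫⁻ z, H z := by
  have hS : MeasurableSet {z : ℂ | K < ‖z‖ ^ 2} := measurableSet_lt (by fun_prop) (by fun_prop)
  rw [← lintegral_indicator hS]
  change ∫⁻ z, {z : ℂ | K < ‖z‖ ^ 2}.indicator (H ∘ radialShift K) z = _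
  rw [lintegral_eq_lintegral_polar ((hH.comp (measurable_radialShift K)).indicator hS),
    lintegral_eq_lintegral_polar hH]
  rw [← lintegral_Ioi_sqrt_sub hK fun s => ∫⁻ θ in Ioo (-Real.pi) Real.pi,
    H (s * Complex.exp (θ * Complex.I)), ← lintegral_indicator measurableSet_Ioi,
    ← lintegral_indicator measurableSet_Ioi]
  refine lintegral_congr fun ρ => ?_
  by_cases hρ : 0 < ρ
  · rw [indicator_of_mem (show ρ ∈ Ioi 0 from hρ)]
    by_cases h : Real.sqrt K < ρ
    · rw [indicator_of_mem (show ρ ∈ Ioi (Real.sqrt K) from h)]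
      congr 1
      refine lintegral_congr fun θ => ?_
      have hn : ‖(ρ : ℂ) * Complex.exp (θ * Complex.I)‖ = ρ := by
        simp [Complex.norm_exp_ofReal_mul_I, abs_of_pos hρ]
      have hK2 : K < ρ ^ 2 := (Real.sqrt_lt' hρ).1 h
      rw [indicator_of_mem (by rw [mem_ofPred_eq, hn]; exact hK2), Function.comp_apply,
        radialShift, hn]
      congr 1
      rw [← mul_assoc, ← Complex.ofReal_mul]
      congr 2
      rw [← Real.sqrt_sq hρ.le, ← Real.sqrt_mul' _ (by positivity), Real.sqrt_sq hρ.le]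
      congr 1
      field_simp
    · rw [indicator_of_notMem (show ρ ∉ Ioi (Real.sqrt K) from h)]
      have : ∀ θ : ℝ, {z : ℂ | K < ‖z‖ ^ 2}.indicator (H ∘ radialShift K)
          (ρ * Complex.exp (θ * Complex.I)) = 0 := by
        intro θ
        refine indicator_of_notMem ?_ _
        have hn : ‖(ρ : ℂ) * Complex.exp (θ * Complex.I)‖ = ρ := by
          simp [Complex.norm_exp_ofReal_mul_I, abs_of_pos hρ]
        rw [mem_ofPred_eq, hn, ← Real.sqrt_lt' hρ]
        exact h
      simp [this]
  · rw [indicator_of_notMem (show ρ ∉ Ioi 0 from hρ), indicator_of_notMem]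
    exact fun h => hρ ((Real.sqrt_nonneg K).trans_lt h)

/-- The choice of K that beats the constant 2^p of the quasi-triangle inequality and so permits
absorption. -/
theorem exists_rpow_mul_exp_le (p : ℝ) {c : ℝ} (hc : 0 < c) :
    ∃ K : ℝ, 1 ≤ K ∧ (2 : ℝ≥0∞) ^ p * ENNReal.ofReal (Real.exp (-c * K)) ≤ 2⁻¹ := by
  have h : Tendsto (fun K : ℝ => (2 : ℝ) ^ p * Real.exp (-c * K)) atTop (𝓝 0) := by
    have h1 : Tendsto (fun K : ℝ => c * K) atTop atTop := tendsto_id.const_mul_atTop hc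
    have := (Real.tendsto_exp_neg_atTop_nhds_zero.comp h1).const_mul ((2 : ℝ) ^ p)
    simpa [Function.comp_def] using this
  obtain ⟨K, hK1, hK⟩ := ((eventually_ge_atTop 1).and
    (h.eventually_lt_const (show (0 : ℝ) < 1 / 2 by norm_num))).exists
  refine ⟨K, hK1, ?_⟩
  have e : (2 : ℝ≥0∞) ^ p = ENNReal.ofReal ((2 : ℝ) ^ p) := by
    rw [← ENNReal.ofReal_rpow_of_pos two_pos]
    simp
  rw [e, ← ENNReal.ofReal_mul (by positivity)]
  refine (ENNReal.ofReal_le_ofReal hK.le).trans (le_of_eq ?_)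
  rw [one_div, ENNReal.ofReal_inv_of_pos two_pos]
  simp

/-- The increment is bounded by a local mean of the derivative, and the weights are essentially
constant on the discs involved. The radius 2K + 1, in units of 1/(1+|z|), is the displacement 2K
plus 1 for the sub-mean value discs. -/
theorem exists_lintegral_sub_radialShift_le {p c K : ℝ} (hp : 0 < p) (hc : 0 < c) (hK : 1 ≤ K) :
    ∃ C : ℝ, 0 < C ∧ ∀ F : ℂ → ℂ, Differentiable ℂ F →
      ∫⁻ z, ‖F z - F (radialShift K z)‖ₑ ^ p * gaussWeight c z ≤
        ENNReal.ofReal C * lpInt p c F := by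
  obtain ⟨C₁, hC₁, h₁⟩ := exists_enorm_sub_rpow_le hp
  obtain ⟨C₂, hC₂, h₂⟩ := exists_gaussWeight_le hc.le (B := 2 * K + 1) (by linarith)
  obtain ⟨C₃, hC₃, h₃⟩ := lintegral_lintegral_ball_le (B := 2 * K + 1) (by linarith)
  have hK0 : 0 < K := by linarith
  set E : ℝ := (2 * K) ^ p * C₁ * C₂ * (1 + (2 * K + 1)) ^ p with hE
  have hE0 : 0 < E := by positivity
  refine ⟨E * C₃, by positivity, fun F hF => ?_⟩
  have hd : Differentiable ℂ (deriv F) := hF.deriv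
  have hm : Measurable fun w => ‖deriv F w‖ₑ ^ p * ENNReal.ofReal ((1 + ‖w‖) ^ (-p)) *
      gaussWeight c w :=
    ((measurable_enorm_rpow hd.continuous p).mul (by fun_prop)).mul (measurable_gaussWeight c)
  have key : ∀ z, ‖F z - F (radialShift K z)‖ₑ ^ p * gaussWeight c z ≤
      ENNReal.ofReal E * (ENNReal.ofReal ((1 + ‖z‖) ^ 2) *
        ∫⁻ w in ball z ((2 * K + 1) / (1 + ‖z‖)),
          ‖deriv F w‖ₑ ^ p * ENNReal.ofReal ((1 + ‖w‖) ^ (-p)) * gaussWeight c w) := by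
    intro z
    have hz : 0 < 1 + ‖z‖ := by positivity
    have e := h₁ F hF z (radialShift K z) (2 * K / (1 + ‖z‖)) (1 / (1 + ‖z‖)) (by positivity)
      (by positivity) (norm_radialShift_sub_le hK z)
    rw [← add_div] at e
    have e1 : (2 * K / (1 + ‖z‖)) ^ p * (C₁ / (1 / (1 + ‖z‖)) ^ 2) =
        (2 * K) ^ p * C₁ * (1 + ‖z‖) ^ 2 * (1 + ‖z‖) ^ (-p) := by
      rw [Real.div_rpow (by positivity) hz.le, Real.rpow_neg hz.le]
      field_simp
    rw [e1] at e
    have hA : 0 ≤ (2 * K) ^ p * C₁ * (1 + ‖z‖) ^ 2 := by positivity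
    calc _ ≤ ENNReal.ofReal ((2 * K) ^ p * C₁ * (1 + ‖z‖) ^ 2 * (1 + ‖z‖) ^ (-p)) *
          (∫⁻ w in ball z ((2 * K + 1) / (1 + ‖z‖)), ‖deriv F w‖ₑ ^ p) * gaussWeight c z := by gcongr
      _ = ENNReal.ofReal ((2 * K) ^ p * C₁ * (1 + ‖z‖) ^ 2) *
          ∫⁻ w in ball z ((2 * K + 1) / (1 + ‖z‖)),
            ENNReal.ofReal ((1 + ‖z‖) ^ (-p)) * ‖deriv F w‖ₑ ^ p * gaussWeight c z := by
          rw [lintegral_mul_const' _ _ (gaussWeight_ne_top c z),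
            lintegral_const_mul' _ _ ENNReal.ofReal_ne_top, ENNReal.ofReal_mul hA]
          ring
      _ ≤ ENNReal.ofReal ((2 * K) ^ p * C₁ * (1 + ‖z‖) ^ 2) *
          ∫⁻ w in ball z ((2 * K + 1) / (1 + ‖z‖)), ENNReal.ofReal (C₂ * (1 + (2 * K + 1)) ^ p) *
            (‖deriv F w‖ₑ ^ p * ENNReal.ofReal ((1 + ‖w‖) ^ (-p)) * gaussWeight c w) := by
          refine mul_le_mul' le_rfl (setLIntegral_mono' measurableSet_ball fun w hw => ?_)
          have hw' : ‖w - z‖ ≤ (2 * K + 1) / (1 + ‖z‖) := by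
            rw [← dist_eq_norm]
            exact (mem_ball.1 hw).le
          have e3 := h₂ z w hw'
          have e4 : ENNReal.ofReal ((1 + ‖z‖) ^ (-p)) ≤
              ENNReal.ofReal ((1 + (2 * K + 1)) ^ p) * ENNReal.ofReal ((1 + ‖w‖) ^ (-p)) := by
            rw [← ENNReal.ofReal_mul (by positivity)]
            refine ENNReal.ofReal_le_ofReal ?_
            have hw0 : 0 < 1 + ‖w‖ := by positivity
            have e5 := (one_add_norm_le (by linarith) hw').1
            rw [Real.rpow_neg hz.le, Real.rpow_neg hw0.le, ← div_eq_mul_inv,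
              inv_le_iff_one_le_mul₀ (by positivity), div_mul_eq_mul_div,
              one_le_div (by positivity), ← Real.mul_rpow (by positivity) hz.le]
            exact Real.rpow_le_rpow hw0.le e5 hp.le
          calc _ ≤ (ENNReal.ofReal ((1 + (2 * K + 1)) ^ p) * ENNReal.ofReal ((1 + ‖w‖) ^ (-p))) *
                ‖deriv F w‖ₑ ^ p * (ENNReal.ofReal C₂ * gaussWeight c w) := by gcongr
            _ = _ := by
                rw [ENNReal.ofReal_mul hC₂.le]
                ring
      _ = _ := by
          rw [lintegral_const_mul' _ _ ENNReal.ofReal_ne_top, ← mul_assoc, ← mul_assoc,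
            ← ENNReal.ofReal_mul hA, ← ENNReal.ofReal_mul hE0.le]
          congr 2
          rw [hE]
          ring
  calc _ ≤ _ := lintegral_mono key
    _ = ENNReal.ofReal E * ∫⁻ z, (ENNReal.ofReal ((1 + ‖z‖) ^ 2) *
        ∫⁻ w in ball z ((2 * K + 1) / (1 + ‖z‖)),
          ‖deriv F w‖ₑ ^ p * ENNReal.ofReal ((1 + ‖w‖) ^ (-p)) * gaussWeight c w) :=
        lintegral_const_mul' _ _ ENNReal.ofReal_ne_top
    _ ≤ ENNReal.ofReal E * (ENNReal.ofReal C₃ * lpInt p c F) := by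
        gcongr
        exact h₃ _ hm
    _ = _ := by
        rw [← mul_assoc, ← ENNReal.ofReal_mul (by positivity)]

/-- Half of the Littlewood-Paley formula: the function is controlled by its derivative. -/
theorem exists_fockInt_le {p c : ℝ} (hp : 0 < p) (hc : 0 < c) :
    ∃ C : ℝ, 0 < C ∧ ∀ F : ℂ → ℂ, Differentiable ℂ F →
      fockInt p c F ≤ ENNReal.ofReal C * (‖F 0‖ₑ ^ p + lpInt p c F) := by
  obtain ⟨K, hK, hKe⟩ := exists_rpow_mul_exp_le p hc
  obtain ⟨C₁, hC₁, h₁⟩ := exists_lintegral_sub_radialShift_le hp hc hK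
  set C₂ := max (Real.pi / c) C₁ with hC₂
  have hC₂0 : 0 < C₂ := hC₁.trans_le (le_max_right _ _)
  refine ⟨2 * 2 ^ p * C₂, by positivity, fun F hF => ?_⟩
  set S : Set ℂ := {z : ℂ | K < ‖z‖ ^ 2} with hSdef
  have hS : MeasurableSet S := measurableSet_lt (by fun_prop) (by fun_prop)
  have hg : Measurable fun z => ‖F z‖ₑ ^ p * gaussWeight c z :=
    (measurable_enorm_rpow hF.continuous p).mul (measurable_gaussWeight c)
  have hd : Measurable fun z => ‖F z - F (radialShift K z)‖ₑ ^ p * gaussWeight c z := by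
    refine Measurable.mul (Measurable.pow_const (Measurable.enorm ?_) p) (measurable_gaussWeight c)
    exact hF.continuous.measurable.sub (hF.continuous.measurable.comp (measurable_radialShift K))
  -- The integral is truncated to a disc so that it is finite and can be absorbed. The shift maps
  -- each such disc into itself, so truncation is compatible with it, and the constant does not
  -- depend on N.
  have hN : ∀ N : ℕ, ∫⁻ z in ball (0 : ℂ) N, ‖F z‖ₑ ^ p * gaussWeight c z ≤
      ENNReal.ofReal (2 * 2 ^ p * C₂) * (‖F 0‖ₑ ^ p + lpInt p c F) := by
    intro N
    set H : ℂ → ℝ≥0∞ := (ball (0 : ℂ) N).indicator fun z => ‖F z‖ₑ ^ p * gaussWeight c z with hH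
    have hHm : Measurable H := hg.indicator measurableSet_ball
    have hfin : ∫⁻ z, H z ≠ ⊤ := by
      rw [hH, lintegral_indicator measurableSet_ball]
      obtain ⟨M, hM⟩ := (isCompact_closedBall (0 : ℂ) N).exists_bound_of_continuousOn
        hF.continuous.continuousOn
      refine ne_top_of_le_ne_top ?_ (setLIntegral_mono' (g := fun _ => ENNReal.ofReal M ^ p)
        measurableSet_ball fun z hz => ?_)
      · rw [setLIntegral_const]
        exact ENNReal.mul_ne_top (ENNReal.rpow_ne_top_of_nonneg hp.le ENNReal.ofReal_ne_top)
          measure_ball_lt_top.ne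
      · calc ‖F z‖ₑ ^ p * gaussWeight c z ≤ ‖F z‖ₑ ^ p * 1 := by
              gcongr
              exact gaussWeight_le_one hc.le z
          _ ≤ _ := by
              rw [mul_one, ← ofReal_norm]
              gcongr
              exact hM z (ball_subset_closedBall hz)
    -- Write F(z) as its increment plus F at the shifted point. The latter is F(0) inside |z|² ≤ K;
    -- outside, moving the weight to the shifted point gains e^{-cK}.
    have hpt : ∀ z, H z ≤ 2 ^ p * (‖F z - F (radialShift K z)‖ₑ ^ p * gaussWeight c z +
        (‖F 0‖ₑ ^ p * gaussWeight c z +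
          ENNReal.ofReal (Real.exp (-c * K)) * S.indicator (H ∘ radialShift K) z)) := by
      intro z
      by_cases hz : z ∈ ball (0 : ℂ) N
      · have e1 : H z = ‖F z‖ₑ ^ p * gaussWeight c z := indicator_of_mem hz _
        have e2 : ‖F z‖ₑ ^ p ≤ 2 ^ p * (‖F z - F (radialShift K z)‖ₑ ^ p +
            ‖F (radialShift K z)‖ₑ ^ p) := by
          have := enorm_add_rpow_le hp.le (F z - F (radialShift K z)) (F (radialShift K z))
          rwa [sub_add_cancel] at this
        have e3 : ‖F (radialShift K z)‖ₑ ^ p * gaussWeight c z ≤ ‖F 0‖ₑ ^ p * gaussWeight c z +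
          ENNReal.ofReal (Real.exp (-c * K)) * S.indicator (H ∘ radialShift K) z := by
          rcases le_or_gt (‖z‖ ^ 2) K with h | h
          · rw [radialShift_of_le h]
            exact le_self_add
          · have hn := norm_sq_radialShift (by linarith) h
            rw [indicator_of_mem (show z ∈ S from h), Function.comp_apply]
            have : radialShift K z ∈ ball (0 : ℂ) N := by
              rw [mem_ball_zero_iff] at hz ⊢
              have hN0 : 0 < (N : ℝ) := (norm_nonneg _).trans_lt hz
              refine lt_of_pow_lt_pow_left₀ 2 hN0.le ?_
              rw [hn]
              nlinarith [norm_nonneg z]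
            rw [hH, indicator_of_mem this]
            refine le_trans (le_of_eq ?_) le_add_self
            have : gaussWeight c z = ENNReal.ofReal (Real.exp (-c * K)) *
                gaussWeight c (radialShift K z) := by
              rw [gaussWeight, gaussWeight, ← ENNReal.ofReal_mul (Real.exp_pos _).le,
                ← Real.exp_add, hn]
              congr 2
              ring
            rw [this]
            ring
        calc H z ≤ 2 ^ p * (‖F z - F (radialShift K z)‖ₑ ^ p +
            ‖F (radialShift K z)‖ₑ ^ p) * gaussWeight c z := by
              rw [e1]
              gcongr
          _ = 2 ^ p * (‖F z - F (radialShift K z)‖ₑ ^ p * gaussWeight c z +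
            ‖F (radialShift K z)‖ₑ ^ p * gaussWeight c z) := by ring
          _ ≤ _ := by gcongr
      · rw [hH, indicator_of_notMem hz]
        exact zero_le
    have hint : ∫⁻ z, H z ≤ 2 ^ p * (ENNReal.ofReal C₁ * lpInt p c F +
        (‖F 0‖ₑ ^ p * ENNReal.ofReal (Real.pi / c) +
          ENNReal.ofReal (Real.exp (-c * K)) * ∫⁻ z, H z)) := by
      refine (lintegral_mono hpt).trans ?_
      rw [lintegral_const_mul' _ _ (by simp), lintegral_add_left hd,
        lintegral_add_left ((measurable_gaussWeight c).const_mul _),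
        lintegral_const_mul _ (measurable_gaussWeight c), lintegral_gaussWeight hc,
        lintegral_const_mul' _ _ ENNReal.ofReal_ne_top, lintegral_indicator hS]
      simp only [Function.comp_apply]
      rw [lintegral_comp_radialShift (by linarith) hHm]
      gcongr
      exact h₁ F hF
    -- By the choice of K the integral of H returns with coefficient at most 1/2.
    have hhalf : ∫⁻ z, H z ≤ 2 ^ p * (ENNReal.ofReal C₂ * (‖F 0‖ₑ ^ p + lpInt p c F)) +
        2⁻¹ * ∫⁻ z, H z := by
      refine hint.trans ?_
      calc _ = 2 ^ p * (ENNReal.ofReal C₁ * lpInt p c F +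
            ‖F 0‖ₑ ^ p * ENNReal.ofReal (Real.pi / c)) +
            (2 ^ p * ENNReal.ofReal (Real.exp (-c * K))) * ∫⁻ z, H z := by ring
        _ ≤ 2 ^ p * (ENNReal.ofReal C₂ * lpInt p c F + ‖F 0‖ₑ ^ p * ENNReal.ofReal C₂) +
            2⁻¹ * ∫⁻ z, H z := by
            gcongr
            · exact le_max_right _ _
            · exact le_max_left _ _
        _ = _ := by ring
    rw [hH, lintegral_indicator measurableSet_ball] at hhalf hfin
    set I := ∫⁻ z in ball (0 : ℂ) N, ‖F z‖ₑ ^ p * gaussWeight c z with hI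
    set X := 2 ^ p * (ENNReal.ofReal C₂ * (‖F 0‖ₑ ^ p + lpInt p c F)) with hX
    have h2 : 2⁻¹ * I ≤ X := by
      have hI2 : I = 2⁻¹ * I + 2⁻¹ * I := by
        rw [← add_mul, ENNReal.inv_two_add_inv_two, one_mul]
      have hne : 2⁻¹ * I ≠ ⊤ := ENNReal.mul_ne_top (by simp) hfin
      nth_rewrite 1 [hI2] at hhalf
      exact (ENNReal.add_le_add_iff_right hne).1 hhalf
    calc I = 2 * (2⁻¹ * I) := by
          rw [← mul_assoc, ENNReal.mul_inv_cancel two_ne_zero ENNReal.ofNat_ne_top, one_mul]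
      _ ≤ 2 * X := by gcongr
      _ = _ := by
          rw [hX, ENNReal.ofReal_mul (by positivity), ENNReal.ofReal_mul (by positivity),
            ← ENNReal.ofReal_rpow_of_pos two_pos]
          simp only [ENNReal.ofReal_ofNat]
          ring
  have hU : ⋃ N : ℕ, ball (0 : ℂ) N = univ := iUnion_ball_nat 0
  have hdir : Directed (· ⊆ ·) fun N : ℕ => ball (0 : ℂ) N :=
    Monotone.directed_le fun m n hmn => ball_subset_ball (by exact_mod_cast hmn)
  calc fockInt p c F = ∫⁻ z in ⋃ N : ℕ, ball (0 : ℂ) N, ‖F z‖ₑ ^ p * gaussWeight c z := by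
        rw [hU, setLIntegral_univ, fockInt]
    _ = ⨆ N : ℕ, ∫⁻ z in ball (0 : ℂ) N, ‖F z‖ₑ ^ p * gaussWeight c z :=
        setLIntegral_iUnion_of_directed _ hdir
    _ ≤ _ := iSup_le hN

/-! ### Control of the value at a point by the derivative of a composition -/

theorem exists_primitive {f : ℂ → ℂ} (hf : Differentiable ℂ f) :
    ∃ P : ℂ → ℂ, ∀ z, HasDerivAt P (f z) z := by
  obtain ⟨P, hP⟩ := hf.isExactOn_univ
  exact ⟨P, fun z => hP z (mem_univ z)⟩

/-- If the range missed a disc about c, then 1/(h - c) would be bounded and entire, hence constant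
by Liouville. -/
theorem dense_range_of_not_const {h : ℂ → ℂ} (hh : Differentiable ℂ h)
    (hne : ¬ ∃ c, ∀ z, h z = c) : DenseRange h := by
  intro c
  by_contra hc
  rw [Metric.mem_closure_iff] at hc
  push Not at hc
  obtain ⟨ε, hε, hc⟩ := hc
  have hc' : ∀ z, ε ≤ ‖h z - c‖ := fun z => by
    rw [← dist_eq_norm, dist_comm]
    exact hc _ (mem_range_self z)
  have hnz : ∀ z, h z - c ≠ 0 := fun z hz => by
    have := hc' z
    rw [hz, norm_zero] at this
    linarith
  have hd : Differentiable ℂ fun z => (h z - c)⁻¹ := (hh.sub_const c).inv hnz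
  have hb : Bornology.IsBounded (range fun z => (h z - c)⁻¹) := by
    refine (isBounded_iff_forall_norm_le).2 ⟨ε⁻¹, ?_⟩
    rintro _ ⟨z, rfl⟩
    simp only [norm_inv]
    exact inv_anti₀ hε (hc' z)
  refine hne ⟨h 0, fun z => ?_⟩
  have := hd.apply_eq_apply_of_bounded hb z 0
  simpa using this

/-- Integrate ψ'/ψ and normalize at 0; then ψ e^{-h} has zero derivative. -/
theorem exists_exp_eq {ψ : ℂ → ℂ} (hψ : Differentiable ℂ ψ) (h0 : ∀ z, ψ z ≠ 0) :
    ∃ h : ℂ → ℂ, (∀ z, HasDerivAt h (deriv ψ z / ψ z) z) ∧ ∀ z, ψ z = Complex.exp (h z) := by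
  have hd : Differentiable ℂ fun z => deriv ψ z / ψ z := hψ.deriv.div hψ h0
  obtain ⟨P, hP⟩ := exists_primitive hd
  refine ⟨fun z => P z - P 0 + Complex.log (ψ 0), fun z => ?_, fun z => ?_⟩
  · exact ((hP z).sub_const _).add_const _
  · have hder : ∀ z, HasDerivAt (fun z => ψ z * Complex.exp (-(P z - P 0 + Complex.log (ψ 0)))) 0 z := by
      intro z
      have h1 := (hψ z).hasDerivAt.mul (((hP z).sub_const (P 0)).add_const (Complex.log (ψ 0))).neg.cexp
      refine h1.congr_deriv ?_
      have := h0 z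
      field_simp
      ring
    have hc := is_const_of_deriv_eq_zero (fun z => (hder z).differentiableAt)
      (fun z => (hder z).deriv) z 0
    simp only [sub_self, zero_add] at hc
    rw [Complex.exp_neg (Complex.log _), Complex.exp_log (h0 0), mul_inv_cancel₀ (h0 0),
      Complex.exp_neg, mul_inv_eq_one₀ (Complex.exp_ne_zero _)] at hc
    exact hc

/-- The range is open and dense, so it meets its own translate by a. This suffices in place of
Picard's theorem. -/
theorem exists_eq_add_of_not_const {h : ℂ → ℂ} (hh : Differentiable ℂ h)
    (hne : ¬ ∃ c, ∀ z, h z = c) (a : ℂ) : ∃ z₁ z₂, h z₁ = h z₂ + a := by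
  have hopen : IsOpen (range h) := by
    rcases (hh.differentiableOn.analyticOnNhd isOpen_univ).is_constant_or_isOpen
      isPreconnected_univ with ⟨w, hw⟩ | h'
    · exact absurd ⟨w, fun z => hw z (mem_univ z)⟩ hne
    · rw [← image_univ]
      exact h' univ Subset.rfl isOpen_univ
  have hdense := dense_range_of_not_const hh hne
  have hop2 : IsOpen ((fun w => w + a) '' range h) := (isOpenMap_add_right a) _ hopen
  obtain ⟨_, ⟨_, ⟨z₂, rfl⟩, rfl⟩, ⟨z₁, h1⟩⟩ := hdense.inter_open_nonempty _ hop2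
    ((range_nonempty h).image _)
  exact ⟨z₁, z₂, h1⟩

theorem norm_sub_le_of_forall_closedBall {F : ℂ → ℂ} (hF : Differentiable ℂ F) {R S : ℝ}
    (hS : ∀ z, ‖z‖ ≤ R → ‖deriv F z‖ ≤ S) {u v : ℂ} (hu : ‖u‖ ≤ R) (hv : ‖v‖ ≤ R) :
    ‖F u - F v‖ ≤ S * ‖u - v‖ :=
  (convex_closedBall (0 : ℂ) R).norm_image_sub_le_of_norm_deriv_le (𝕜 := ℂ) (fun x _ => hF x)
    (fun x hx => hS x (mem_closedBall_zero_iff.1 hx)) (mem_closedBall_zero_iff.2 hv)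
    (mem_closedBall_zero_iff.2 hu)

/-- If `ψ` is entire and not constant, then for entire `F` with `F 0 = 0` the value `F (ψ 0)` is
controlled by the derivative of `F ∘ ψ` on a fixed disc (even if `ψ` omits the value `0`). -/
theorem exists_norm_le_deriv_comp {ψ : ℂ → ℂ} (hψ : Differentiable ℂ ψ)
    (hne : ¬ ∃ c, ∀ z, ψ z = c) :
    ∃ R C : ℝ, 0 < R ∧ 0 ≤ C ∧ ∀ F : ℂ → ℂ, Differentiable ℂ F → F 0 = 0 → ∀ S : ℝ,
      (∀ z, ‖z‖ ≤ R → ‖deriv (F ∘ ψ) z‖ ≤ S) → ‖F (ψ 0)‖ ≤ C * S := by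
  by_cases hz : ∃ z₀, ψ z₀ = 0
  -- At a zero z₀ of ψ the composition vanishes, so F(ψ(0)) is an increment of F ∘ ψ between z₀ and
  -- 0.
  · obtain ⟨z₀, hz₀⟩ := hz
    refine ⟨‖z₀‖ + 1, ‖z₀‖, by positivity, norm_nonneg _, fun F hF hF0 S hS => ?_⟩
    have := norm_sub_le_of_forall_closedBall (hF.comp hψ) hS (u := 0) (v := z₀)
      (by simp; positivity) (by linarith)
    simpa [hz₀, hF0, mul_comm] using this
  -- If ψ = e^h has no zero, points with h(z₁) = h(z₂) + 2πi have the same image under ψ: a path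
  -- between them is carried to a loop that winds around the omitted value 0.
  · push Not at hz
    obtain ⟨h, hh, hexp⟩ := exists_exp_eq hψ hz
    have hhd : Differentiable ℂ h := fun z => (hh z).differentiableAt
    have hne' : ¬ ∃ c, ∀ z, h z = c := fun ⟨c, hc⟩ =>
      hne ⟨Complex.exp c, fun z => by rw [hexp, hc]⟩
    obtain ⟨z₁, z₂, h12⟩ := exists_eq_add_of_not_const hhd hne' (2 * Real.pi * Complex.I)
    have hψ12 : ψ z₁ = ψ z₂ := by
      rw [hexp, hexp, h12, Complex.exp_add, Complex.exp_two_pi_mul_I, mul_one]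
    set R := ‖z₁‖ + ‖z₂‖ + 1 with hR
    have hR0 : 0 < R := by positivity
    have hcont : Continuous (deriv h) := hhd.deriv.continuous
    obtain ⟨L, hL⟩ := (isCompact_closedBall (0 : ℂ) R).exists_bound_of_continuousOn
      hcont.continuousOn
    have hL0 : 0 ≤ L := (norm_nonneg _).trans (hL 0 (mem_closedBall_self hR0.le))
    refine ⟨R, R * L * ‖z₁ - z₂‖ / (2 * Real.pi), hR0, by positivity, fun F hF hF0 S hS => ?_⟩
    -- As F(0) = 0, F(ζ)/ζ is entire with a primitive Q. The function Q(ψ) - F(ψ(0)) h has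
    -- derivative (F(ψ) - F(ψ(0))) h', which is small with S, while its increment between z₂ and z₁
    -- is -2πi F(ψ(0)) because Q(ψ) takes equal values there.
    have hds : Differentiable ℂ (dslope F 0) := by
      rw [← differentiableOn_univ, Complex.differentiableOn_dslope univ_mem]
      exact hF.differentiableOn
    obtain ⟨Q, hQ⟩ := exists_primitive hds
    have hS0 : 0 ≤ S := (norm_nonneg _).trans (hS 0 (by simpa using hR0.le))
    have hΦ : ∀ z, HasDerivAt (fun z => Q (ψ z) - F (ψ 0) * h z)
        ((F (ψ z) - F (ψ 0)) * deriv h z) z := by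
      intro z
      have h1 := ((hQ (ψ z)).comp z (hψ z).hasDerivAt).sub ((hh z).const_mul (F (ψ 0)))
      refine h1.congr_deriv ?_
      rw [dslope_of_ne _ (hz z), slope_def_field, hF0, (hh z).deriv]
      have := hz z
      field_simp
      ring
    have hb : ∀ z, ‖z‖ ≤ R →
        ‖deriv (fun z => Q (ψ z) - F (ψ 0) * h z) z‖ ≤ S * R * L := by
      intro z hzR
      rw [(hΦ z).deriv, norm_mul]
      have h1 := norm_sub_le_of_forall_closedBall (hF.comp hψ) hS (u := z) (v := 0) hzR
        (by simpa using hR0.le)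
      have h2 := hL z (mem_closedBall_zero_iff.2 hzR)
      simp only [Function.comp_apply, sub_zero] at h1
      gcongr
      exact h1.trans (by gcongr)
    have := norm_sub_le_of_forall_closedBall (fun z => (hΦ z).differentiableAt) hb (u := z₁)
      (v := z₂) (by rw [hR]; linarith [norm_nonneg z₂]) (by rw [hR]; linarith [norm_nonneg z₁])
    have e : Q (ψ z₁) - F (ψ 0) * h z₁ - (Q (ψ z₂) - F (ψ 0) * h z₂) =
        -(F (ψ 0) * (2 * Real.pi * Complex.I)) := by
      rw [hψ12, h12]
      ring
    rw [e, norm_neg, norm_mul] at this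
    have e2 : ‖(2 * Real.pi * Complex.I : ℂ)‖ = 2 * Real.pi := by
      simp [abs_of_pos Real.pi_pos]
    rw [e2] at this
    rw [div_mul_eq_mul_div, le_div_iff₀ (by positivity)]
    linarith

theorem exists_lintegral_ball_le_lpInt {p c : ℝ} (hp : 0 < p) (hc : 0 < c) {R : ℝ} (hR : 0 < R) :
    ∃ C : ℝ, 0 < C ∧ ∀ F : ℂ → ℂ,
      ∫⁻ z in ball (0 : ℂ) R, ‖deriv F z‖ₑ ^ p ≤ ENNReal.ofReal C * lpInt p c F := by
  refine ⟨(1 + R) ^ p * Real.exp (c * R ^ 2), by positivity, fun F => ?_⟩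
  rw [lpInt, ← lintegral_const_mul' _ _ ENNReal.ofReal_ne_top]
  refine (setLIntegral_mono' measurableSet_ball fun z hz => ?_).trans (setLIntegral_le_lintegral _ _)
  rw [mem_ball_zero_iff] at hz
  have hz0 := norm_nonneg z
  have h1 : 1 ≤ ENNReal.ofReal ((1 + R) ^ p * Real.exp (c * R ^ 2)) *
      (ENNReal.ofReal ((1 + ‖z‖) ^ (-p)) * gaussWeight c z) := by
    rw [gaussWeight, ← ENNReal.ofReal_mul (by positivity), ← ENNReal.ofReal_mul (by positivity),
      ENNReal.one_le_ofReal]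
    have e1 : 1 ≤ (1 + R) ^ p * (1 + ‖z‖) ^ (-p) := by
      rw [Real.rpow_neg (by positivity), ← div_eq_mul_inv, one_le_div (by positivity)]
      gcongr
    have e2 : 1 ≤ Real.exp (c * R ^ 2) * Real.exp (-c * ‖z‖ ^ 2) := by
      rw [← Real.exp_add, Real.one_le_exp_iff]
      have : ‖z‖ ^ 2 ≤ R ^ 2 := by gcongr
      nlinarith
    calc (1 : ℝ) ≤ ((1 + R) ^ p * (1 + ‖z‖) ^ (-p)) *
          (Real.exp (c * R ^ 2) * Real.exp (-c * ‖z‖ ^ 2)) := one_le_mul_of_one_le_of_one_le e1 e2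
      _ = _ := by ring
  calc ‖deriv F z‖ₑ ^ p = ‖deriv F z‖ₑ ^ p * 1 := (mul_one _).symm
    _ ≤ ‖deriv F z‖ₑ ^ p * (ENNReal.ofReal ((1 + R) ^ p * Real.exp (c * R ^ 2)) *
      (ENNReal.ofReal ((1 + ‖z‖) ^ (-p)) * gaussWeight c z)) := by gcongr
    _ = _ := by ring

/-- Removes the value at the origin from the Littlewood–Paley formula for F ∘ ψ; B does not depend
on F, hence not on g when F is a Volterra image. -/
theorem exists_enorm_apply_le_lpInt_comp {p c : ℝ} (hp : 0 < p) (hc : 0 < c) {ψ : ℂ → ℂ}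
    (hψ : Differentiable ℂ ψ) (hne : ¬ ∃ c, ∀ z, ψ z = c) :
    ∃ B : ℝ, 0 < B ∧ ∀ F : ℂ → ℂ, Differentiable ℂ F → F 0 = 0 →
      ‖F (ψ 0)‖ₑ ^ p ≤ ENNReal.ofReal B * lpInt p c (F ∘ ψ) := by
  obtain ⟨R, C, hR, hC, h⟩ := exists_norm_le_deriv_comp hψ hne
  obtain ⟨C₁, hC₁, h₁⟩ := exists_enorm_rpow_le_lintegral_ball hp
  obtain ⟨C₂, hC₂, h₂⟩ := exists_lintegral_ball_le_lpInt hp hc (R := R + 1) (by linarith)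
  set D := C + 1 with hD
  have hD0 : 0 < D := by positivity
  refine ⟨D ^ p * (C₁ * C₂), by positivity, fun F hF hF0 => ?_⟩
  have hd : Differentiable ℂ (deriv (F ∘ ψ)) := (hF.comp hψ).deriv
  have key : ENNReal.ofReal (D⁻¹ ^ p) * ‖F (ψ 0)‖ₑ ^ p ≤
      ENNReal.ofReal (C₁ * C₂) * lpInt p c (F ∘ ψ) := by
    refine enorm_rpow_le_of_forall_norm_le hp (by positivity) fun S hS hX => ?_
    rw [inv_mul_le_iff₀ hD0]
    have hb : ‖F (ψ 0)‖ ≤ C * S := by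
      refine h F hF hF0 S fun z hz => norm_le_of_enorm_rpow_le hp hS ?_
      rw [← hX]
      have h3 := h₁ _ hd z 1 one_pos
      rw [one_pow, div_one] at h3
      calc _ ≤ _ := h3
        _ ≤ ENNReal.ofReal C₁ * ∫⁻ w in ball 0 (R + 1), ‖deriv (F ∘ ψ) w‖ₑ ^ p := by
          gcongr
          refine ball_subset_ball' ?_
          rw [dist_zero_right]
          linarith
        _ ≤ ENNReal.ofReal C₁ * (ENNReal.ofReal C₂ * lpInt p c (F ∘ ψ)) := by
          gcongr
          exact h₂ _
        _ = _ := by rw [ENNReal.ofReal_mul hC₁.le, mul_assoc]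
    refine hb.trans ?_
    gcongr
    linarith
  calc ‖F (ψ 0)‖ₑ ^ p = ENNReal.ofReal (D ^ p) * (ENNReal.ofReal (D⁻¹ ^ p) * ‖F (ψ 0)‖ₑ ^ p) := by
        rw [← mul_assoc, ← ENNReal.ofReal_mul (by positivity),
          ← Real.mul_rpow hD0.le (by positivity), mul_inv_cancel₀ hD0.ne']
        simp
    _ ≤ _ := by
        rw [ENNReal.ofReal_mul (by positivity), mul_assoc]
        gcongr

/-! ### The Volterra type operator -/

section Volterra

variable {ψ g f f₁ f₂ : ℂ → ℂ}

theorem exists_volterra_eq (hg : Differentiable ℂ g) (hf : Differentiable ℂ f) :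
    ∃ P : ℂ → ℂ, (∀ z, HasDerivAt P (f z * deriv g z) z) ∧ ∀ z, volterra g f z = P z - P 0 := by
  have hd : Differentiable ℂ fun z => f z * deriv g z := hf.mul hg.deriv
  obtain ⟨P, hP⟩ := exists_primitive hd
  refine ⟨P, hP, fun z => ?_⟩
  have hder : ∀ t : ℝ, HasDerivAt (fun t : ℝ => P (t * z))
      (f (t * z) * deriv g (t * z) * z) t := by
    intro t
    have h1 : HasDerivAt (fun s : ℂ => P (s * z)) (f (t * z) * deriv g (t * z) * z) (t : ℂ) := by
      have h2 : HasDerivAt (fun s : ℂ => s * z) (1 * z) (t : ℂ) := (hasDerivAt_id _).mul_const z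
      have := (hP (t * z)).comp (t : ℂ) h2
      rw [one_mul] at this
      exact this
    exact h1.comp_ofReal
  rw [volterra, intervalIntegral.integral_eq_sub_of_hasDerivAt (fun t _ => hder t)]
  · simp
  · refine Continuous.intervalIntegrable ?_ _ _
    have h1 := hd.continuous
    exact (h1.comp (f := fun t : ℝ => (t : ℂ) * z) (by fun_prop)).mul continuous_const

theorem hasDerivAt_volterra (hg : Differentiable ℂ g) (hf : Differentiable ℂ f) (z : ℂ) :
    HasDerivAt (volterra g f) (f z * deriv g z) z := by
  obtain ⟨P, hP, h⟩ := exists_volterra_eq hg hf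
  rw [show volterra g f = fun z => P z - P 0 from funext h]
  exact (hP z).sub_const _

theorem differentiable_volterra (hg : Differentiable ℂ g) (hf : Differentiable ℂ f) :
    Differentiable ℂ (volterra g f) := fun z => (hasDerivAt_volterra hg hf z).differentiableAt

theorem volterra_zero (g f : ℂ → ℂ) : volterra g f 0 = 0 := by simp [volterra]

theorem hasDerivAt_compVolterra (hψ : Differentiable ℂ ψ) (hg : Differentiable ℂ g)
    (hf : Differentiable ℂ f) (z : ℂ) :
    HasDerivAt (compVolterra ψ g f) (f (ψ z) * deriv g (ψ z) * deriv ψ z) z :=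
  (hasDerivAt_volterra hg hf (ψ z)).comp z (hψ z).hasDerivAt

theorem differentiable_compVolterra (hψ : Differentiable ℂ ψ) (hg : Differentiable ℂ g)
    (hf : Differentiable ℂ f) : Differentiable ℂ (compVolterra ψ g f) :=
  fun z => (hasDerivAt_compVolterra hψ hg hf z).differentiableAt

theorem volterra_sub (hg : Differentiable ℂ g) (h₁ : Differentiable ℂ f₁)
    (h₂ : Differentiable ℂ f₂) (z : ℂ) :
    volterra g (f₁ - f₂) z = volterra g f₁ z - volterra g f₂ z := by
  have c₁ := h₁.continuous
  have c₂ := h₂.continuous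
  have c₃ := hg.deriv.continuous
  rw [volterra, volterra, volterra, ← intervalIntegral.integral_sub]
  · simp [sub_mul]
  · exact Continuous.intervalIntegrable (by fun_prop) _ _
  · exact Continuous.intervalIntegrable (by fun_prop) _ _

theorem compVolterra_sub (ψ : ℂ → ℂ) (hg : Differentiable ℂ g) (h₁ : Differentiable ℂ f₁)
    (h₂ : Differentiable ℂ f₂) :
    compVolterra ψ g (f₁ - f₂) = compVolterra ψ g f₁ - compVolterra ψ g f₂ :=
  funext fun z => volterra_sub hg h₁ h₂ (ψ z)

theorem compVolterra_smul (ψ g f : ℂ → ℂ) (a : ℂ) :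
    compVolterra ψ g (a • f) = a • compVolterra ψ g f := by
  funext z
  simp only [compVolterra, volterra, Pi.smul_apply, smul_eq_mul]
  rw [← intervalIntegral.integral_const_mul]
  congr 1
  funext t
  ring

end Volterra

/-! ### Fock norms and normalized kernels -/

theorem fockNorm_rpow {α p : ℝ} (hp : 0 < p) (f : ℂ → ℂ) :
    fockNorm α p f ^ p = ENNReal.ofReal (α * p / (2 * Real.pi)) * fockInt p (α * p / 2) f := by
  rw [fockNorm, ← ENNReal.rpow_mul, one_div_mul_cancel hp.ne', ENNReal.rpow_one, fockInt]
  congr 1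
  refine lintegral_congr fun z => ?_
  rw [ENNReal.ofReal_mul (by positivity), gaussWeight, ← ofReal_norm,
    ENNReal.ofReal_rpow_of_nonneg (norm_nonneg _) hp.le]

theorem fockInt_eq {α p : ℝ} (hα : 0 < α) (hp : 0 < p) (f : ℂ → ℂ) :
    fockInt p (α * p / 2) f = ENNReal.ofReal (2 * Real.pi / (α * p)) * fockNorm α p f ^ p := by
  rw [fockNorm_rpow hp, ← mul_assoc, ← ENNReal.ofReal_mul (by positivity)]
  have : 2 * Real.pi / (α * p) * (α * p / (2 * Real.pi)) = 1 := by
    have := Real.pi_pos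
    field_simp
  rw [this]
  simp

theorem differentiable_normKernel (α : ℝ) (w : ℂ) : Differentiable ℂ (normKernel α w) := by
  unfold normKernel
  fun_prop

/-- Completing the square in |z|² - 2 Re(z w̄) + |w|². -/
theorem enorm_normKernel_rpow_mul (α : ℝ) {p : ℝ} (hp : 0 ≤ p) (w z : ℂ) :
    ‖normKernel α w z‖ₑ ^ p * gaussWeight (α * p / 2) z = gaussWeight (α * p / 2) (z - w) := by
  rw [← ofReal_norm, ENNReal.ofReal_rpow_of_nonneg (norm_nonneg _) hp, gaussWeight, gaussWeight,
    ← ENNReal.ofReal_mul (by positivity), normKernel, Complex.norm_exp, ← Real.exp_mul,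
    ← Real.exp_add]
  congr 2
  have e1 : ((α : ℂ) * (z * (starRingEnd ℂ) w) - (α : ℂ) * (‖w‖ : ℂ) ^ 2 / 2).re =
      α * (z.re * w.re + z.im * w.im) - α * ‖w‖ ^ 2 / 2 := by
    rw [show (α : ℂ) * (z * (starRingEnd ℂ) w) - (α : ℂ) * (‖w‖ : ℂ) ^ 2 / 2 =
      (α : ℂ) * (z * (starRingEnd ℂ) w) - ((α * ‖w‖ ^ 2 / 2 : ℝ) : ℂ) by push_cast; ring,
      Complex.sub_re, Complex.ofReal_re, Complex.re_ofReal_mul]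
    simp [Complex.mul_re]
  rw [e1]
  simp only [Complex.sq_norm, Complex.normSq_apply, Complex.sub_re, Complex.sub_im]
  ring

theorem lintegral_gaussWeight_sub {c : ℝ} (hc : 0 < c) (w : ℂ) :
    ∫⁻ z, gaussWeight c (z - w) = ENNReal.ofReal (Real.pi / c) := by
  rw [lintegral_sub_right_eq_self (μ := volume) (gaussWeight c) w, lintegral_gaussWeight hc]

theorem fockNorm_normKernel {α p : ℝ} (hα : 0 < α) (hp : 0 < p) (w : ℂ) :
    fockNorm α p (normKernel α w) = 1 := by
  have h : fockNorm α p (normKernel α w) ^ p = 1 := by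
    rw [fockNorm_rpow hp, fockInt]
    simp_rw [enorm_normKernel_rpow_mul α hp.le]
    rw [lintegral_gaussWeight_sub (by positivity), ← ENNReal.ofReal_mul (by positivity)]
    have : α * p / (2 * Real.pi) * (Real.pi / (α * p / 2)) = 1 := by
      have := Real.pi_pos
      field_simp
    rw [this, ENNReal.ofReal_one]
  have h2 := congrArg (· ^ (1 / p)) h
  rwa [← ENNReal.rpow_mul, mul_one_div_cancel hp.ne', ENNReal.rpow_one, ENNReal.one_rpow] at h2

theorem normKernel_mem {α p : ℝ} (hα : 0 < α) (hp : 0 < p) (w : ℂ) :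
    normKernel α w ∈ FockSpace α p :=
  ⟨differentiable_normKernel α w, by rw [fockNorm_normKernel hα hp]; exact ENNReal.one_lt_top⟩

/-! ### Weighted sub-mean value property and Carleson type estimates -/

/-- On a disc of fixed radius the weight is not nearly constant, but multiplying f by exp(-(2c/p)(w
- ζ)ζ̄) compensates its linear variation, leaving only e^{c|w-ζ|²} ≤ e^c. -/
theorem exists_enorm_mul_gaussWeight_le {p c : ℝ} (hp : 0 < p) (hc : 0 < c) :
    ∃ C : ℝ, 0 < C ∧ ∀ f : ℂ → ℂ, Differentiable ℂ f → ∀ ζ : ℂ,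
      ‖f ζ‖ₑ ^ p * gaussWeight c ζ ≤
        ENNReal.ofReal C * ∫⁻ w in ball ζ 1, ‖f w‖ₑ ^ p * gaussWeight c w := by
  obtain ⟨C₁, hC₁, h₁⟩ := exists_enorm_rpow_le_lintegral_ball hp
  refine ⟨C₁ * Real.exp c, by positivity, fun f hf ζ => ?_⟩
  set h : ℂ → ℂ := fun w => f w * Complex.exp (-(2 * c / p : ℝ) * ((w - ζ) * (starRingEnd ℂ) ζ))
    with hh
  have hd : Differentiable ℂ h := hf.mul (by fun_prop)
  have hζ : h ζ = f ζ := by simp [hh]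
  have key : ∀ w, ‖h w‖ₑ ^ p * gaussWeight c ζ =
      ENNReal.ofReal (Real.exp (c * ‖w - ζ‖ ^ 2)) * (‖f w‖ₑ ^ p * gaussWeight c w) := by
    intro w
    have e : ‖h w‖ₑ ^ p = ‖f w‖ₑ ^ p * ENNReal.ofReal
        (Real.exp (-2 * c * ((w - ζ).re * ζ.re + (w - ζ).im * ζ.im))) := by
      rw [hh]
      simp only
      rw [enorm_mul, ENNReal.mul_rpow_of_nonneg _ _ hp.le, ← ofReal_norm (Complex.exp _),
        ENNReal.ofReal_rpow_of_nonneg (norm_nonneg _) hp.le, Complex.norm_exp, ← Real.exp_mul]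
      congr 3
      rw [← Complex.ofReal_neg, Complex.re_ofReal_mul]
      simp only [Complex.mul_re, Complex.conj_re, Complex.conj_im]
      field_simp
      ring
    rw [e, mul_assoc, mul_left_comm (ENNReal.ofReal (Real.exp (c * ‖w - ζ‖ ^ 2)))]
    congr 1
    rw [gaussWeight, gaussWeight, ← ENNReal.ofReal_mul (by positivity),
      ← ENNReal.ofReal_mul (by positivity), ← Real.exp_add, ← Real.exp_add]
    congr 2
    simp only [Complex.sq_norm, Complex.normSq_apply, Complex.sub_re, Complex.sub_im]
    ring
  have e := h₁ h hd ζ 1 one_pos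
  rw [one_pow, div_one, hζ] at e
  calc ‖f ζ‖ₑ ^ p * gaussWeight c ζ
      ≤ ENNReal.ofReal C₁ * (∫⁻ w in ball ζ 1, ‖h w‖ₑ ^ p) * gaussWeight c ζ := by gcongr
    _ = ENNReal.ofReal C₁ * ∫⁻ w in ball ζ 1, ‖h w‖ₑ ^ p * gaussWeight c ζ := by
        rw [lintegral_mul_const' _ _ (gaussWeight_ne_top c ζ), mul_assoc]
    _ ≤ ENNReal.ofReal C₁ * ∫⁻ w in ball ζ 1,
          ENNReal.ofReal (Real.exp c) * (‖f w‖ₑ ^ p * gaussWeight c w) := by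
        refine mul_le_mul' le_rfl (setLIntegral_mono' measurableSet_ball fun w hw => ?_)
        rw [key]
        gcongr
        rw [mem_ball_iff_norm] at hw
        have : ‖w - ζ‖ ^ 2 ≤ 1 := by nlinarith [norm_nonneg (w - ζ)]
        nlinarith
    _ = _ := by
        rw [lintegral_const_mul' _ _ ENNReal.ofReal_ne_top, ← mul_assoc,
          ← ENNReal.ofReal_mul hC₁.le]

theorem exists_enorm_mul_gaussWeight_le_fockInt {p c : ℝ} (hp : 0 < p) (hc : 0 < c) :
    ∃ C : ℝ, 0 < C ∧ ∀ f : ℂ → ℂ, Differentiable ℂ f → ∀ ζ : ℂ,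
      ‖f ζ‖ₑ ^ p * gaussWeight c ζ ≤ ENNReal.ofReal C * fockInt p c f := by
  obtain ⟨C, hC, h⟩ := exists_enorm_mul_gaussWeight_le hp hc
  refine ⟨C, hC, fun f hf ζ => (h f hf ζ).trans ?_⟩
  gcongr
  exact setLIntegral_le_lintegral _ _

theorem measurable_measure_ball (μ : Measure ℂ) [SFinite μ] (r : ℝ) :
    Measurable fun w => μ (ball w r) := by
  have hS : MeasurableSet {x : ℂ × ℂ | dist x.2 x.1 < r} :=
    measurableSet_lt (by fun_prop) (by fun_prop)
  exact measurable_measure_prodMk_left hS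

/-- Integrate the weighted sub-mean value inequality in μ and exchange the integrals: the indicator
of |w - ζ| < 1 is symmetric. -/
theorem exists_lintegral_le_lintegral_measure_ball {p c : ℝ} (hp : 0 < p) (hc : 0 < c) :
    ∃ C : ℝ, 0 < C ∧ ∀ (μ : Measure ℂ) [SFinite μ] (f : ℂ → ℂ), Differentiable ℂ f →
      ∫⁻ ζ, ‖f ζ‖ₑ ^ p * gaussWeight c ζ ∂μ ≤
        ENNReal.ofReal C * ∫⁻ w, ‖f w‖ₑ ^ p * gaussWeight c w * μ (ball w 1) := by
  obtain ⟨C, hC, h⟩ := exists_enorm_mul_gaussWeight_le hp hc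
  refine ⟨C, hC, fun μ _ f hf => ?_⟩
  have hG : Measurable fun w => ‖f w‖ₑ ^ p * gaussWeight c w :=
    (measurable_enorm_rpow hf.continuous p).mul (measurable_gaussWeight c)
  have hS : MeasurableSet {x : ℂ × ℂ | dist x.2 x.1 < 1} :=
    measurableSet_lt (by fun_prop) (by fun_prop)
  set Φ : ℂ × ℂ → ℝ≥0∞ := {x : ℂ × ℂ | dist x.2 x.1 < 1}.indicator
    (fun x => ‖f x.2‖ₑ ^ p * gaussWeight c x.2) with hΦ
  have hΦm : Measurable Φ := (hG.comp measurable_snd).indicator hS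
  calc ∫⁻ ζ, ‖f ζ‖ₑ ^ p * gaussWeight c ζ ∂μ
      ≤ ∫⁻ ζ, (ENNReal.ofReal C * ∫⁻ w, Φ (ζ, w)) ∂μ := by
        refine lintegral_mono fun ζ => (h f hf ζ).trans (le_of_eq ?_)
        rw [← lintegral_indicator measurableSet_ball]
        rfl
    _ = ENNReal.ofReal C * ∫⁻ ζ, (∫⁻ w, Φ (ζ, w)) ∂μ := lintegral_const_mul' _ _ ENNReal.ofReal_ne_top
    _ = ENNReal.ofReal C * ∫⁻ w, (∫⁻ ζ, Φ (ζ, w) ∂μ) := by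
        rw [lintegral_lintegral_swap (f := fun ζ w => Φ (ζ, w)) hΦm.aemeasurable]
    _ = _ := by
        congr 1
        refine lintegral_congr fun w => ?_
        have : ∀ ζ, Φ (ζ, w) = (ball w 1).indicator (fun _ => ‖f w‖ₑ ^ p * gaussWeight c w) ζ := by
          intro ζ
          simp only [hΦ, indicator, mem_ofPred_eq, mem_ball, dist_comm]
        simp_rw [this]
        rw [lintegral_indicator measurableSet_ball, setLIntegral_const]

/-- Write |f|^q e^{-αq|ζ|²/2} as the (q/p)-th power of the weighted |f|^p. All but one factor is
bounded pointwise by ‖f‖^{q-p}, and the remaining one is integrated. -/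
theorem exists_lintegral_le_of_exponent_le {α p q : ℝ} (hα : 0 < α) (hp : 0 < p) (hpq : p ≤ q) :
    ∃ C : ℝ, 0 < C ∧ ∀ (μ : Measure ℂ) [SFinite μ] (f : ℂ → ℂ), Differentiable ℂ f →
      ∫⁻ ζ, ‖f ζ‖ₑ ^ q * gaussWeight (α * q / 2) ζ ∂μ ≤
        ENNReal.ofReal C * (fockNorm α p f ^ (q - p) *
          ∫⁻ w, ‖f w‖ₑ ^ p * gaussWeight (α * p / 2) w * μ (ball w 1)) := by
  obtain ⟨C₁, hC₁, h₁⟩ := exists_enorm_mul_gaussWeight_le_fockInt (c := α * p / 2) hp (by positivity)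
  obtain ⟨C₂, hC₂, h₂⟩ := exists_lintegral_le_lintegral_measure_ball (c := α * p / 2) hp
    (by positivity)
  have hqp : 0 ≤ q / p - 1 := by
    rw [sub_nonneg, one_le_div hp]
    exact hpq
  have hK : 0 < C₁ * (2 * Real.pi / (α * p)) := by positivity
  set K := (C₁ * (2 * Real.pi / (α * p))) ^ (q / p - 1) with hKdef
  have hK0 : 0 < K := by positivity
  refine ⟨K * C₂, by positivity, fun μ _ f hf => ?_⟩
  have hpt : ∀ ζ, ‖f ζ‖ₑ ^ q * gaussWeight (α * q / 2) ζ ≤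
      ENNReal.ofReal K * fockNorm α p f ^ (q - p) * (‖f ζ‖ₑ ^ p * gaussWeight (α * p / 2) ζ) := by
    intro ζ
    have e : ‖f ζ‖ₑ ^ q * gaussWeight (α * q / 2) ζ =
        (‖f ζ‖ₑ ^ p * gaussWeight (α * p / 2) ζ) ^ (q / p - 1 + 1) := by
      rw [ENNReal.mul_rpow_of_nonneg _ _ (by linarith), ← ENNReal.rpow_mul, gaussWeight_rpow,
        sub_add_cancel]
      congr 2
      · field_simp
      · field_simp
    rw [e, ENNReal.rpow_add_of_nonneg _ _ hqp zero_le_one, ENNReal.rpow_one]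
    gcongr
    calc _ ≤ (ENNReal.ofReal C₁ * fockInt p (α * p / 2) f) ^ (q / p - 1) :=
          ENNReal.rpow_le_rpow (h₁ f hf ζ) hqp
      _ = _ := by
          rw [fockInt_eq hα hp, ← mul_assoc, ← ENNReal.ofReal_mul hC₁.le,
            ENNReal.mul_rpow_of_nonneg _ _ hqp, ENNReal.ofReal_rpow_of_pos hK, ← ENNReal.rpow_mul]
          congr 2
          field_simp
  have hG : Measurable fun w => ‖f w‖ₑ ^ p * gaussWeight (α * p / 2) w :=
    (measurable_enorm_rpow hf.continuous p).mul (measurable_gaussWeight _)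
  calc _ ≤ _ := lintegral_mono hpt
    _ = ENNReal.ofReal K * fockNorm α p f ^ (q - p) *
        ∫⁻ ζ, ‖f ζ‖ₑ ^ p * gaussWeight (α * p / 2) ζ ∂μ := lintegral_const_mul _ hG
    _ ≤ ENNReal.ofReal K * fockNorm α p f ^ (q - p) * (ENNReal.ofReal C₂ *
        ∫⁻ w, ‖f w‖ₑ ^ p * gaussWeight (α * p / 2) w * μ (ball w 1)) := by
        gcongr
        exact h₂ μ f hf
    _ = _ := by
        rw [ENNReal.ofReal_mul hK0.le]
        ring

/-! ### The measure attached to the pair of symbols -/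

/-- The measure `λ` on `ℂ` for which `∫ |f|^p e^{-c|ζ|^2} dλ` is the Littlewood-Paley integral of
`C_(ψ,g) f`. -/
def symbolMeasure (p c : ℝ) (ψ g : ℂ → ℂ) : Measure ℂ :=
  (volume.withDensity fun z => ‖deriv g (ψ z) * deriv ψ z‖ₑ ^ p *
    ENNReal.ofReal ((1 + ‖z‖) ^ (-p)) * gaussWeight c z *
    ENNReal.ofReal (Real.exp (c * ‖ψ z‖ ^ 2))).map ψ

instance (p c : ℝ) (ψ g : ℂ → ℂ) : SFinite (symbolMeasure p c ψ g) := by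
  unfold symbolMeasure
  infer_instance

/-- The exponential of |ψ|² in the density cancels the Gaussian weight at ζ = ψ(z). -/
theorem lintegral_symbolMeasure (p c : ℝ) {ψ g : ℂ → ℂ} (hψ : Differentiable ℂ ψ)
    (hg : Differentiable ℂ g) {H : ℂ → ℝ≥0∞} (hH : Measurable H) :
    ∫⁻ ζ, H ζ * gaussWeight c ζ ∂symbolMeasure p c ψ g =
      ∫⁻ z, H (ψ z) * ‖deriv g (ψ z) * deriv ψ z‖ₑ ^ p *
        ENNReal.ofReal ((1 + ‖z‖) ^ (-p)) * gaussWeight c z := by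
  have hψm := hψ.continuous.measurable
  have hd : Continuous fun z => deriv g (ψ z) * deriv ψ z :=
    (hg.deriv.continuous.comp hψ.continuous).mul hψ.deriv.continuous
  have hm : Measurable fun z => ‖deriv g (ψ z) * deriv ψ z‖ₑ ^ p *
      ENNReal.ofReal ((1 + ‖z‖) ^ (-p)) * gaussWeight c z *
      ENNReal.ofReal (Real.exp (c * ‖ψ z‖ ^ 2)) := by
    refine Measurable.mul (Measurable.mul (Measurable.mul (measurable_enorm_rpow hd p)
      (by fun_prop)) (measurable_gaussWeight c)) ?_
    exact (ENNReal.continuous_ofReal.comp (Real.continuous_exp.comp (continuous_const.mul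
      (hψ.continuous.norm.pow 2)))).measurable
  rw [symbolMeasure, lintegral_map (f := fun ζ => H ζ * gaussWeight c ζ)
    (hH.mul (measurable_gaussWeight c)) hψm, lintegral_withDensity_eq_lintegral_mul _ hm
      (g := fun z => H (ψ z) * gaussWeight c (ψ z)) ((hH.comp hψm).mul ((measurable_gaussWeight c).comp hψm))]
  refine lintegral_congr fun z => ?_
  have e : gaussWeight c (ψ z) * ENNReal.ofReal (Real.exp (c * ‖ψ z‖ ^ 2)) = 1 := by
    rw [gaussWeight, ← ENNReal.ofReal_mul (Real.exp_pos _).le, ← Real.exp_add]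
    simp
  simp only [Pi.mul_apply]
  calc _ = H (ψ z) * ‖deriv g (ψ z) * deriv ψ z‖ₑ ^ p * ENNReal.ofReal ((1 + ‖z‖) ^ (-p)) *
        gaussWeight c z * (gaussWeight c (ψ z) * ENNReal.ofReal (Real.exp (c * ‖ψ z‖ ^ 2))) := by
        ring
    _ = _ := by rw [e, mul_one]

theorem lpInt_compVolterra {p : ℝ} (hp : 0 < p) (c : ℝ) {ψ g f : ℂ → ℂ}
    (hψ : Differentiable ℂ ψ) (hg : Differentiable ℂ g) (hf : Differentiable ℂ f) :
    lpInt p c (compVolterra ψ g f) =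
      ∫⁻ ζ, ‖f ζ‖ₑ ^ p * gaussWeight c ζ ∂symbolMeasure p c ψ g := by
  rw [lintegral_symbolMeasure p c hψ hg (measurable_enorm_rpow hf.continuous p), lpInt]
  refine lintegral_congr fun z => ?_
  rw [(hasDerivAt_compVolterra hψ hg hf z).deriv, mul_assoc (f (ψ z)), enorm_mul (f (ψ z)),
    ENNReal.mul_rpow_of_nonneg _ _ hp.le]

/-- The weighted kernel is a translated Gaussian, so the transform averages the symbol measure at
unit scale; after this the symbols enter the estimates only through that measure. -/
theorem berezinM_eq_lintegral {α p : ℝ} (hp : 0 < p) {ψ g : ℂ → ℂ}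
    (hψ : Differentiable ℂ ψ) (hg : Differentiable ℂ g) (w : ℂ) :
    berezinM α p ψ g w =
      ∫⁻ ζ, gaussWeight (α * p / 2) (ζ - w) ∂symbolMeasure p (α * p / 2) ψ g := by
  simp_rw [← enorm_normKernel_rpow_mul α hp.le]
  rw [lintegral_symbolMeasure p _ hψ hg
    (measurable_enorm_rpow (differentiable_normKernel α w).continuous p), berezinM]
  refine lintegral_congr fun z => ?_
  have hz : 0 < 1 + ‖z‖ := by positivity
  rw [mul_assoc (normKernel α w (ψ z)), ← ENNReal.mul_rpow_of_nonneg _ _ hp.le, ← enorm_mul,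
    ← ofReal_norm, ENNReal.ofReal_rpow_of_nonneg (norm_nonneg _) hp.le, mul_assoc, gaussWeight,
    ← ENNReal.ofReal_mul (by positivity), ← ENNReal.ofReal_mul (by positivity), div_eq_mul_inv,
    Real.mul_rpow hz.le (by positivity), ← Real.exp_mul, Real.rpow_neg hz.le, mul_inv,
    ← Real.exp_neg]
  congr 4
  ring

theorem lpInt_compVolterra_normKernel {α p : ℝ} (hp : 0 < p) {ψ g : ℂ → ℂ}
    (hψ : Differentiable ℂ ψ) (hg : Differentiable ℂ g) (w : ℂ) :
    lpInt p (α * p / 2) (compVolterra ψ g (normKernel α w)) = berezinM α p ψ g w := by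
  rw [lpInt_compVolterra hp _ hψ hg (differentiable_normKernel α w), berezinM_eq_lintegral hp hψ hg]
  simp_rw [enorm_normKernel_rpow_mul α hp.le]

theorem measurable_lintegral_gaussWeight_sub (c : ℝ) (μ : Measure ℂ) [SFinite μ] :
    Measurable fun w => ∫⁻ ζ, gaussWeight c (ζ - w) ∂μ :=
  Measurable.lintegral_prod_right'
    (f := fun x : ℂ × ℂ => gaussWeight c (x.2 - x.1)) (by fun_prop)

theorem measurable_berezinM {α p : ℝ} (hp : 0 < p) {ψ g : ℂ → ℂ}
    (hψ : Differentiable ℂ ψ) (hg : Differentiable ℂ g) : Measurable (berezinM α p ψ g) := by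
  rw [show berezinM α p ψ g = _ from funext (berezinM_eq_lintegral hp hψ hg)]
  exact measurable_lintegral_gaussWeight_sub _ _

theorem measure_ball_le {c r : ℝ} (hc : 0 < c) (μ : Measure ℂ) (w : ℂ) :
    μ (ball w r) ≤ ENNReal.ofReal (Real.exp (c * r ^ 2)) * ∫⁻ ζ, gaussWeight c (ζ - w) ∂μ := by
  rw [← lintegral_const_mul' _ _ ENNReal.ofReal_ne_top, ← setLIntegral_one]
  refine (setLIntegral_mono' measurableSet_ball fun ζ hζ => ?_).trans
    (setLIntegral_le_lintegral _ _)
  rw [gaussWeight, ← ENNReal.ofReal_mul (Real.exp_pos _).le, ← Real.exp_add, ENNReal.one_le_ofReal,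
    Real.one_le_exp_iff]
  rw [mem_ball_iff_norm] at hζ
  have : ‖ζ - w‖ ^ 2 ≤ r ^ 2 := by gcongr
  nlinarith

theorem exists_symbolMeasure_ball_le {α p : ℝ} (hα : 0 < α) (hp : 0 < p) (r : ℝ) :
    ∃ C : ℝ, 0 < C ∧ ∀ ψ g : ℂ → ℂ, Differentiable ℂ ψ → Differentiable ℂ g → ∀ w,
      symbolMeasure p (α * p / 2) ψ g (ball w r) ≤ ENNReal.ofReal C * berezinM α p ψ g w :=
  ⟨_, Real.exp_pos _, fun ψ g hψ hg w => by
    rw [berezinM_eq_lintegral hp hψ hg]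
    exact measure_ball_le (by positivity) _ w⟩

/-! ### Littlewood-Paley estimates for Fock norms -/

theorem exists_fockNorm_rpow_le {α p : ℝ} (hα : 0 < α) (hp : 0 < p) :
    ∃ A : ℝ, 0 < A ∧ ∀ F : ℂ → ℂ, Differentiable ℂ F →
      fockNorm α p F ^ p ≤ ENNReal.ofReal A * (‖F 0‖ₑ ^ p + lpInt p (α * p / 2) F) := by
  obtain ⟨C, hC, h⟩ := exists_fockInt_le (c := α * p / 2) hp (by positivity)
  refine ⟨α * p / (2 * Real.pi) * C, by positivity, fun F hF => ?_⟩
  rw [fockNorm_rpow hp, ENNReal.ofReal_mul (by positivity), mul_assoc]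
  gcongr
  exact h F hF

theorem exists_lpInt_le_fockNorm {α p : ℝ} (hα : 0 < α) (hp : 0 < p) :
    ∃ A : ℝ, 0 < A ∧ ∀ F : ℂ → ℂ, Differentiable ℂ F →
      lpInt p (α * p / 2) F ≤ ENNReal.ofReal A * fockNorm α p F ^ p := by
  obtain ⟨C, hC, h⟩ := exists_lpInt_le (c := α * p / 2) hp (by positivity)
  refine ⟨C * (2 * Real.pi / (α * p)), by positivity, fun F hF => (h F hF).trans (le_of_eq ?_)⟩
  rw [fockInt_eq hα hp, ENNReal.ofReal_mul hC.le, mul_assoc]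

theorem exists_fockNorm_compVolterra_le_of_zero {α p : ℝ} (hα : 0 < α) (hp : 0 < p) :
    ∃ A : ℝ, 0 < A ∧ ∀ ψ : ℂ → ℂ, Differentiable ℂ ψ → ψ 0 = 0 → ∀ g f : ℂ → ℂ,
      Differentiable ℂ g → Differentiable ℂ f →
      fockNorm α p (compVolterra ψ g f) ^ p ≤
        ENNReal.ofReal A * lpInt p (α * p / 2) (compVolterra ψ g f) := by
  obtain ⟨A, hA, h⟩ := exists_fockNorm_rpow_le hα hp
  refine ⟨A, hA, fun ψ hψ hψ0 g f hg hf => ?_⟩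
  refine (h _ (differentiable_compVolterra hψ hg hf)).trans (le_of_eq ?_)
  rw [compVolterra, hψ0, volterra_zero, enorm_zero, ENNReal.zero_rpow_of_pos hp, zero_add]

theorem exists_fockNorm_compVolterra_le_of_not_const {α p : ℝ} (hα : 0 < α) (hp : 0 < p)
    {ψ : ℂ → ℂ} (hψ : Differentiable ℂ ψ) (hne : ¬ ∃ c, ∀ z, ψ z = c) :
    ∃ A : ℝ, 0 < A ∧ ∀ g f : ℂ → ℂ, Differentiable ℂ g → Differentiable ℂ f →
      fockNorm α p (compVolterra ψ g f) ^ p ≤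
        ENNReal.ofReal A * lpInt p (α * p / 2) (compVolterra ψ g f) := by
  obtain ⟨A, hA, h⟩ := exists_fockNorm_rpow_le hα hp
  obtain ⟨B, hB, h'⟩ := exists_enorm_apply_le_lpInt_comp (c := α * p / 2) hp (by positivity) hψ hne
  refine ⟨A * (B + 1), by positivity, fun g f hg hf => ?_⟩
  refine (h _ (differentiable_compVolterra hψ hg hf)).trans ?_
  rw [ENNReal.ofReal_mul hA.le, ENNReal.ofReal_add hB.le zero_le_one, ENNReal.ofReal_one, mul_assoc,
    add_mul, one_mul]
  gcongr
  exact h' _ (differentiable_volterra hg hf) (volterra_zero g f)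

/-! ### Evaluation functionals -/

theorem exists_enorm_apply_le_fockNorm {α p : ℝ} (hα : 0 < α) (hp : 0 < p) (R : ℝ) :
    ∃ K : ℝ, 0 < K ∧ ∀ f : ℂ → ℂ, Differentiable ℂ f → ∀ z : ℂ, ‖z‖ ≤ R →
      ‖f z‖ₑ ≤ ENNReal.ofReal K * fockNorm α p f := by
  obtain ⟨C, hC, h⟩ := exists_enorm_mul_gaussWeight_le_fockInt (c := α * p / 2) hp (by positivity)
  set D := Real.exp (α * p / 2 * R ^ 2) * (C * (2 * Real.pi / (α * p))) with hD
  have hD0 : 0 < D := by positivity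
  refine ⟨D ^ (1 / p), by positivity, fun f hf z hz => ?_⟩
  have h1 : ‖f z‖ₑ ^ p ≤ ENNReal.ofReal D * fockNorm α p f ^ p := by
    have e := h f hf z
    rw [fockInt_eq hα hp] at e
    have e1 : 1 ≤ ENNReal.ofReal (Real.exp (α * p / 2 * R ^ 2)) * gaussWeight (α * p / 2) z := by
      rw [gaussWeight, ← ENNReal.ofReal_mul (Real.exp_pos _).le, ← Real.exp_add,
        ENNReal.one_le_ofReal, Real.one_le_exp_iff]
      have : ‖z‖ ^ 2 ≤ R ^ 2 := by gcongr
      have : 0 < α * p := by positivity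
      nlinarith
    calc ‖f z‖ₑ ^ p ≤ ‖f z‖ₑ ^ p *
          (ENNReal.ofReal (Real.exp (α * p / 2 * R ^ 2)) * gaussWeight (α * p / 2) z) :=
          le_mul_of_one_le_right' e1
      _ = ENNReal.ofReal (Real.exp (α * p / 2 * R ^ 2)) *
          (‖f z‖ₑ ^ p * gaussWeight (α * p / 2) z) := by ring
      _ ≤ ENNReal.ofReal (Real.exp (α * p / 2 * R ^ 2)) *
          (ENNReal.ofReal C * (ENNReal.ofReal (2 * Real.pi / (α * p)) * fockNorm α p f ^ p)) := by
          gcongr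
      _ = _ := by
          rw [hD, ENNReal.ofReal_mul (by positivity), ENNReal.ofReal_mul hC.le]
          ring
  rw [← ENNReal.rpow_le_rpow_iff hp]
  refine h1.trans (le_of_eq ?_)
  rw [ENNReal.mul_rpow_of_nonneg _ _ hp.le, ENNReal.ofReal_rpow_of_pos (by positivity),
    ← Real.rpow_mul hD0.le, one_div_mul_cancel hp.ne', Real.rpow_one]

/-- At z = ψ(0) this bounds the value of C f at the origin, also for constant ψ. The constant
depends on g, so it serves the qualitative statements only. -/
theorem exists_enorm_volterra_le_fockNorm {α p : ℝ} (hα : 0 < α) (hp : 0 < p) {g : ℂ → ℂ}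
    (hg : Differentiable ℂ g) (z : ℂ) :
    ∃ K : ℝ, 0 < K ∧ ∀ f : ℂ → ℂ, Differentiable ℂ f →
      ‖volterra g f z‖ₑ ≤ ENNReal.ofReal K * fockNorm α p f := by
  obtain ⟨K, hK, h⟩ := exists_enorm_apply_le_fockNorm hα hp ‖z‖
  obtain ⟨G, hG⟩ := (isCompact_closedBall (0 : ℂ) ‖z‖).exists_bound_of_continuousOn
    hg.deriv.continuous.continuousOn
  have hG0 : 0 ≤ G := (norm_nonneg _).trans (hG 0 (mem_closedBall_self (norm_nonneg _)))
  -- The added 1 keeps the constant positive, so that the case of infinite norm is trivial.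
  refine ⟨K * G * ‖z‖ + 1, by positivity, fun f hf => ?_⟩
  by_cases hN : fockNorm α p f = ⊤
  · rw [hN, ENNReal.mul_top]
    · exact le_top
    · rw [Ne, ENNReal.ofReal_eq_zero, not_le]
      positivity
  set N := (fockNorm α p f).toReal with hNdef
  have hNe : fockNorm α p f = ENNReal.ofReal N := (ENNReal.ofReal_toReal hN).symm
  have hN0 : 0 ≤ N := ENNReal.toReal_nonneg
  have hb : ∀ t ∈ uIoc (0 : ℝ) 1, ‖f (t * z) * deriv g (t * z) * z‖ ≤ K * N * G * ‖z‖ := by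
    intro t ht
    rw [uIoc_of_le zero_le_one] at ht
    have htz : ‖(t : ℂ) * z‖ ≤ ‖z‖ := by
      rw [norm_mul, Complex.norm_real, Real.norm_of_nonneg ht.1.le]
      exact mul_le_of_le_one_left (norm_nonneg z) ht.2
    have h1 := h f hf _ htz
    rw [hNe, ← ENNReal.ofReal_mul hK.le, ← ofReal_norm,
      ENNReal.ofReal_le_ofReal_iff (by positivity)] at h1
    rw [norm_mul, norm_mul]
    gcongr
    exact hG _ (mem_closedBall_zero_iff.2 htz)
  have := intervalIntegral.norm_integral_le_of_norm_le_const hb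
  rw [hNe, ← ENNReal.ofReal_mul (by positivity), ← ofReal_norm]
  refine ENNReal.ofReal_le_ofReal (this.trans ?_)
  simp only [sub_zero, abs_one, mul_one]
  nlinarith

/-! ### Estimates of the Littlewood-Paley integral by the Berezin type transform -/

theorem exists_lpInt_compVolterra_le_integral {α p q : ℝ} (hα : 0 < α) (hp : 0 < p) (hpq : p ≤ q) :
    ∃ C : ℝ, 0 < C ∧ ∀ ψ g f : ℂ → ℂ, Differentiable ℂ ψ → Differentiable ℂ g →
      Differentiable ℂ f → lpInt q (α * q / 2) (compVolterra ψ g f) ≤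
        ENNReal.ofReal C * (fockNorm α p f ^ (q - p) *
          ∫⁻ w, ‖f w‖ₑ ^ p * gaussWeight (α * p / 2) w *
            symbolMeasure q (α * q / 2) ψ g (ball w 1)) := by
  obtain ⟨C, hC, h⟩ := exists_lintegral_le_of_exponent_le hα hp hpq
  refine ⟨C, hC, fun ψ g f hψ hg hf => ?_⟩
  rw [lpInt_compVolterra (hp.trans_le hpq) _ hψ hg hf]
  exact h _ f hf

theorem exists_lpInt_compVolterra_le_sup {α p q : ℝ} (hα : 0 < α) (hp : 0 < p) (hpq : p ≤ q) :
    ∃ C : ℝ, 0 < C ∧ ∀ ψ g f : ℂ → ℂ, Differentiable ℂ ψ → Differentiable ℂ g →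
      Differentiable ℂ f → ∀ S : ℝ≥0∞,
        (∀ᵐ w, symbolMeasure q (α * q / 2) ψ g (ball w 1) ≤ S) →
        lpInt q (α * q / 2) (compVolterra ψ g f) ≤
          ENNReal.ofReal C * S * fockNorm α p f ^ q := by
  obtain ⟨C, hC, h⟩ := exists_lpInt_compVolterra_le_integral hα hp hpq
  refine ⟨C * (2 * Real.pi / (α * p)), by positivity, fun ψ g f hψ hg hf S hS => ?_⟩
  have hm : Measurable fun w => ‖f w‖ₑ ^ p * gaussWeight (α * p / 2) w :=
    (measurable_enorm_rpow hf.continuous p).mul (measurable_gaussWeight _)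
  calc _ ≤ _ := h ψ g f hψ hg hf
    _ ≤ ENNReal.ofReal C * (fockNorm α p f ^ (q - p) *
        ∫⁻ w, ‖f w‖ₑ ^ p * gaussWeight (α * p / 2) w * S) := by
        refine mul_le_mul' le_rfl (mul_le_mul' le_rfl (lintegral_mono_ae ?_))
        filter_upwards [hS] with w hw
        gcongr
    _ = ENNReal.ofReal C * (fockNorm α p f ^ (q - p) * (fockInt p (α * p / 2) f * S)) := by
        rw [lintegral_mul_const _ hm, fockInt]
    _ = ENNReal.ofReal (C * (2 * Real.pi / (α * p))) * S *
        (fockNorm α p f ^ (q - p) * fockNorm α p f ^ p) := by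
        rw [fockInt_eq hα hp, ENNReal.ofReal_mul hC.le]
        ring
    _ = _ := by
        rw [← ENNReal.rpow_add_of_nonneg _ _ (by linarith) hp.le, sub_add_cancel]

theorem exists_lpInt_compVolterra_le_sup_berezinM {α p q : ℝ} (hα : 0 < α) (hp : 0 < p)
    (hpq : p ≤ q) :
    ∃ C : ℝ, 0 < C ∧ ∀ ψ g f : ℂ → ℂ, Differentiable ℂ ψ → Differentiable ℂ g →
      Differentiable ℂ f → ∀ S : ℝ≥0∞, (∀ᵐ w, berezinM α q ψ g w ≤ S) →
        lpInt q (α * q / 2) (compVolterra ψ g f) ≤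
          ENNReal.ofReal C * S * fockNorm α p f ^ q := by
  obtain ⟨C₁, hC₁, h₁⟩ := exists_lpInt_compVolterra_le_sup hα hp hpq
  obtain ⟨C₂, hC₂, h₂⟩ := exists_symbolMeasure_ball_le hα (hp.trans_le hpq) 1
  refine ⟨C₁ * C₂, by positivity, fun ψ g f hψ hg hf S hS => ?_⟩
  rw [ENNReal.ofReal_mul hC₁.le, mul_assoc (ENNReal.ofReal C₁)]
  refine h₁ ψ g f hψ hg hf _ ?_
  filter_upwards [hS] with w hw
  refine (h₂ ψ g hψ hg w).trans ?_
  gcongr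

/-- Hölder's inequality with the conjugate exponents q/p and q/(q-p). -/
theorem lintegral_mul_le_fockNorm {α p q : ℝ} (hα : 0 < α) (hp : 0 < p) (hpq : p < q) {f : ℂ → ℂ}
    (hf : Continuous f) {W : ℂ → ℝ≥0∞} (hW : AEMeasurable W) :
    ∫⁻ w, ‖f w‖ₑ ^ p * gaussWeight (α * p / 2) w * W w ≤
      (ENNReal.ofReal (2 * Real.pi / (α * q)) * fockNorm α q f ^ q) ^ (p / q) *
        (∫⁻ w, W w ^ (q / (q - p))) ^ ((q - p) / q) := by
  have hq : 0 < q := hp.trans hpq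
  have hqp : 0 < q - p := by linarith
  have hconj : (q / p).HolderConjugate (q / (q - p)) := by
    rw [Real.holderConjugate_iff]
    refine ⟨(one_lt_div hp).2 hpq, ?_⟩
    field_simp
    ring
  have hm : Measurable fun w => ‖f w‖ₑ ^ p * gaussWeight (α * p / 2) w :=
    (measurable_enorm_rpow hf p).mul (measurable_gaussWeight _)
  have h := ENNReal.lintegral_mul_le_Lp_mul_Lq volume hconj hm.aemeasurable hW
  simp only [Pi.mul_apply, one_div_div] at h
  refine h.trans (le_of_eq ?_)
  congr 2
  rw [← fockInt_eq hα hq, fockInt]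
  refine lintegral_congr fun w => ?_
  rw [ENNReal.mul_rpow_of_nonneg _ _ (by positivity), ← ENNReal.rpow_mul, gaussWeight_rpow]
  congr 2
  · field_simp
  · field_simp

theorem exists_lpInt_compVolterra_le_Lp {α p q : ℝ} (hα : 0 < α) (hp : 0 < p) (hpq : p < q) :
    ∃ C : ℝ, 0 < C ∧ ∀ ψ g f : ℂ → ℂ, Differentiable ℂ ψ → Differentiable ℂ g →
      Differentiable ℂ f → lpInt p (α * p / 2) (compVolterra ψ g f) ≤
        ENNReal.ofReal C * (∫⁻ w, berezinM α p ψ g w ^ (q / (q - p))) ^ ((q - p) / q) *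
          fockNorm α q f ^ p := by
  have hq : 0 < q := hp.trans hpq
  obtain ⟨C, hC, h⟩ := exists_lpInt_compVolterra_le_integral hα hp le_rfl
  obtain ⟨C₂, hC₂, h₂⟩ := exists_symbolMeasure_ball_le hα hp 1
  have hE : 0 < 2 * Real.pi / (α * q) := by positivity
  refine ⟨C * C₂ * (2 * Real.pi / (α * q)) ^ (p / q), by positivity, fun ψ g f hψ hg hf => ?_⟩
  have h1 := h ψ g f hψ hg hf
  rw [sub_self, ENNReal.rpow_zero, one_mul] at h1
  calc _ ≤ _ := h1
    _ ≤ ENNReal.ofReal C * ∫⁻ w, ENNReal.ofReal C₂ *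
          (‖f w‖ₑ ^ p * gaussWeight (α * p / 2) w * berezinM α p ψ g w) := by
        refine mul_le_mul' le_rfl (lintegral_mono fun w => ?_)
        rw [mul_left_comm]
        gcongr
        exact h₂ ψ g hψ hg w
    _ ≤ ENNReal.ofReal C * (ENNReal.ofReal C₂ *
        ((ENNReal.ofReal (2 * Real.pi / (α * q)) * fockNorm α q f ^ q) ^ (p / q) *
        (∫⁻ w, berezinM α p ψ g w ^ (q / (q - p))) ^ ((q - p) / q))) := by
        rw [lintegral_const_mul' _ _ ENNReal.ofReal_ne_top]
        gcongr
        exact lintegral_mul_le_fockNorm hα hp hpq hf.continuous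
          (measurable_berezinM hp hψ hg).aemeasurable
    _ = _ := by
        rw [ENNReal.mul_rpow_of_nonneg _ _ (by positivity), ← ENNReal.rpow_mul,
          mul_div_cancel₀ _ hq.ne', ENNReal.ofReal_rpow_of_pos hE, ENNReal.ofReal_mul (by positivity),
          ENNReal.ofReal_mul hC.le]
        ring

/-! ### Operator norms -/

theorem opNorm_rpow_le {α p q s : ℝ} (hs : 0 < s) {T : (ℂ → ℂ) → ℂ → ℂ} {X : ℝ≥0∞}
    (h : ∀ f ∈ FockSpace α p, fockNorm α p f ≤ 1 → fockNorm α q (T f) ^ s ≤ X) :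
    opNorm α p q T ^ s ≤ X := by
  rw [← ENNReal.le_rpow_inv_iff hs]
  refine iSup₂_le fun f hf => ?_
  rw [ENNReal.le_rpow_inv_iff hs]
  exact h f hf.1 hf.2

theorem fockNorm_le_opNorm {α p q : ℝ} (T : (ℂ → ℂ) → ℂ → ℂ) {f : ℂ → ℂ}
    (hf : f ∈ FockSpace α p) (h1 : fockNorm α p f ≤ 1) : fockNorm α q (T f) ≤ opNorm α p q T :=
  le_iSup₂_of_le (f := fun f (_ : f ∈ {f | f ∈ FockSpace α p ∧ fockNorm α p f ≤ 1}) =>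
    fockNorm α q (T f)) f ⟨hf, h1⟩ le_rfl

theorem IsBoundedOp.opNorm_lt_top {α p q : ℝ} {T : (ℂ → ℂ) → ℂ → ℂ} (h : IsBoundedOp α p q T) :
    opNorm α p q T < ⊤ := by
  obtain ⟨K, hK⟩ := h.2
  refine (iSup₂_le fun f hf => ?_).trans_lt (ENNReal.coe_lt_top (r := K))
  calc _ ≤ K * fockNorm α p f := hK f hf.1
    _ ≤ K * 1 := by
        gcongr
        exact hf.2
    _ = K := mul_one _

theorem isBoundedOp_of_rpow_le {α p q s : ℝ} (hs : 0 < s) {T : (ℂ → ℂ) → ℂ → ℂ}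
    (hT : ∀ f, Differentiable ℂ f → Differentiable ℂ (T f)) {K : ℝ≥0∞} (hK : K ≠ ⊤)
    (h : ∀ f, Differentiable ℂ f → fockNorm α q (T f) ^ s ≤ K * fockNorm α p f ^ s) :
    IsBoundedOp α p q T := by
  have hK' : K ^ (1 / s) ≠ ⊤ := ENNReal.rpow_ne_top_of_nonneg (by positivity) hK
  have h' : ∀ f, Differentiable ℂ f → fockNorm α q (T f) ≤ K ^ (1 / s) * fockNorm α p f := by
    intro f hf
    rw [← ENNReal.rpow_le_rpow_iff hs, ENNReal.mul_rpow_of_nonneg _ _ hs.le, ← ENNReal.rpow_mul,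
      one_div_mul_cancel hs.ne', ENNReal.rpow_one]
    exact h f hf
  refine ⟨fun f hf => ⟨hT f hf.1, (h' f hf.1).trans_lt (ENNReal.mul_lt_top hK'.lt_top hf.2)⟩,
    (K ^ (1 / s)).toNNReal, fun f hf => ?_⟩
  rw [ENNReal.coe_toNNReal hK']
  exact h' f hf.1

/-- The value at the origin is a bounded functional of f, so only the Littlewood–Paley integral has
to be estimated. -/
theorem isBoundedOp_compVolterra {α p q : ℝ} (hα : 0 < α) (hp : 0 < p) (hq : 0 < q)
    {ψ g : ℂ → ℂ} (hψ : Differentiable ℂ ψ) (hg : Differentiable ℂ g) {K : ℝ≥0∞} (hK : K ≠ ⊤)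
    (h : ∀ f, Differentiable ℂ f →
      lpInt q (α * q / 2) (compVolterra ψ g f) ≤ K * fockNorm α p f ^ q) :
    IsBoundedOp α p q (compVolterra ψ g) := by
  obtain ⟨A, hA, hA'⟩ := exists_fockNorm_rpow_le hα hq
  obtain ⟨B, hB, hB'⟩ := exists_enorm_volterra_le_fockNorm hα hp hg (ψ 0)
  refine isBoundedOp_of_rpow_le hq (fun f hf => differentiable_compVolterra hψ hg hf)
    (K := ENNReal.ofReal A * (ENNReal.ofReal B ^ q + K)) ?_ fun f hf => ?_
  · exact ENNReal.mul_ne_top ENNReal.ofReal_ne_top (ENNReal.add_ne_top.2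
      ⟨ENNReal.rpow_ne_top_of_nonneg hq.le ENNReal.ofReal_ne_top, hK⟩)
  · refine (hA' _ (differentiable_compVolterra hψ hg hf)).trans ?_
    rw [mul_assoc, add_mul, ← ENNReal.mul_rpow_of_nonneg _ _ hq.le]
    gcongr
    · exact hB' f hf
    · exact h f hf

/-- Test on k_w, which has norm one and whose image has Littlewood–Paley integral equal to M(w). -/
theorem exists_berezinM_le_opNorm {α p q : ℝ} (hα : 0 < α) (hp : 0 < p) (hq : 0 < q) :
    ∃ A : ℝ, 0 < A ∧ ∀ ψ g : ℂ → ℂ, Differentiable ℂ ψ → Differentiable ℂ g → ∀ w,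
      berezinM α q ψ g w ≤ ENNReal.ofReal A * fockNorm α q (compVolterra ψ g (normKernel α w)) ^ q ∧
      berezinM α q ψ g w ≤ ENNReal.ofReal A * opNorm α p q (compVolterra ψ g) ^ q := by
  obtain ⟨A, hA, h⟩ := exists_lpInt_le_fockNorm hα hq
  refine ⟨A, hA, fun ψ g hψ hg w => ?_⟩
  have h1 : berezinM α q ψ g w ≤
      ENNReal.ofReal A * fockNorm α q (compVolterra ψ g (normKernel α w)) ^ q := by
    rw [← lpInt_compVolterra_normKernel hq hψ hg]
    exact h _ (differentiable_compVolterra hψ hg (differentiable_normKernel α w))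
  refine ⟨h1, h1.trans ?_⟩
  gcongr
  exact fockNorm_le_opNorm _ (normKernel_mem hα hp w) (fockNorm_normKernel hα hp w).le

theorem memLp_top_berezinM_iff {α q : ℝ} (hq : 0 < q) {ψ g : ℂ → ℂ}
    (hψ : Differentiable ℂ ψ) (hg : Differentiable ℂ g) :
    MemLp (berezinM α q ψ g) ⊤ volume ↔ ∃ S : ℝ≥0∞, S ≠ ⊤ ∧ ∀ᵐ w, berezinM α q ψ g w ≤ S := by
  rw [MemLp, and_iff_right (measurable_berezinM hq hψ hg).aestronglyMeasurable,
    eLpNorm_exponent_top, eLpNormEssSup]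
  simp only [enorm_eq_self]
  exact ⟨fun h => ⟨_, h.ne, ae_le_essSup⟩, fun ⟨S, hS, h⟩ => (essSup_le_of_ae_le S h).trans_lt
    hS.lt_top⟩

theorem isBoundedOp_compVolterra_iff_memLp_top {α p q : ℝ} (hα : 0 < α) (hp : 0 < p) (hpq : p ≤ q)
    {ψ g : ℂ → ℂ} (hψ : Differentiable ℂ ψ) (hg : Differentiable ℂ g) :
    IsBoundedOp α p q (compVolterra ψ g) ↔ MemLp (berezinM α q ψ g) ⊤ volume := by
  have hq : 0 < q := hp.trans_le hpq
  rw [memLp_top_berezinM_iff hq hψ hg]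
  constructor
  · intro h
    obtain ⟨A, -, hA⟩ := exists_berezinM_le_opNorm hα hp hq
    exact ⟨_, ENNReal.mul_ne_top ENNReal.ofReal_ne_top
      (ENNReal.rpow_ne_top_of_nonneg hq.le h.opNorm_lt_top.ne),
      ae_of_all _ fun w => (hA ψ g hψ hg w).2⟩
  · rintro ⟨S, hS, h⟩
    obtain ⟨C, -, hC⟩ := exists_lpInt_compVolterra_le_sup_berezinM hα hp hpq
    exact isBoundedOp_compVolterra hα hp hq hψ hg (ENNReal.mul_ne_top ENNReal.ofReal_ne_top hS)
      fun f hf => hC ψ g f hψ hg hf S h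

theorem memLp_berezinM_iff {α p q : ℝ} (hp : 0 < p) (hpq : p < q) {ψ g : ℂ → ℂ}
    (hψ : Differentiable ℂ ψ) (hg : Differentiable ℂ g) :
    MemLp (berezinM α p ψ g) (ENNReal.ofReal (q / (q - p))) volume ↔
      ∫⁻ w, berezinM α p ψ g w ^ (q / (q - p)) < ⊤ := by
  have h1 : 0 < q / (q - p) := div_pos (hp.trans hpq) (by linarith)
  rw [MemLp, and_iff_right (measurable_berezinM hp hψ hg).aestronglyMeasurable,
    eLpNorm_lt_top_iff_lintegral_rpow_enorm_lt_top (by simpa using h1) ENNReal.ofReal_ne_top,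
    ENNReal.toReal_ofReal h1.le]
  simp only [enorm_eq_self]

theorem isBoundedOp_compVolterra_of_lintegral_lt_top {α p q : ℝ} (hα : 0 < α) (hp : 0 < p)
    (hpq : p < q) {ψ g : ℂ → ℂ} (hψ : Differentiable ℂ ψ) (hg : Differentiable ℂ g)
    (h : ∫⁻ w, berezinM α p ψ g w ^ (q / (q - p)) < ⊤) :
    IsBoundedOp α q p (compVolterra ψ g) := by
  have hq : 0 < q := hp.trans hpq
  obtain ⟨C, -, hC⟩ := exists_lpInt_compVolterra_le_Lp hα hp hpq
  refine isBoundedOp_compVolterra hα hq hp hψ hg (ENNReal.mul_ne_top ENNReal.ofReal_ne_top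
    (ENNReal.rpow_ne_top_of_nonneg ?_ h.ne)) fun f hf => hC ψ g f hψ hg hf
  exact div_nonneg (by linarith) hq.le

/-! ### Normal families -/

/-- A locally uniformly bounded sequence of entire functions has a subsequence that converges
pointwise to an entire function. -/
theorem exists_subseq_tendsto_of_locally_bounded {f : ℕ → ℂ → ℂ}
    (hf : ∀ n, Differentiable ℂ (f n)) {M : ℝ → ℝ} (hM : ∀ R n z, ‖z‖ ≤ R → ‖f n z‖ ≤ M R) :
    ∃ φ : ℕ → ℕ, StrictMono φ ∧ ∃ h : ℂ → ℂ, Differentiable ℂ h ∧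
      ∀ z, Tendsto (fun n => f (φ n) z) atTop (𝓝 (h z)) := by
  set a : ℕ → ℕ → ℂ := fun n k => (k.factorial : ℂ)⁻¹ * iteratedDeriv k (f n) 0 with ha
  have hbound : ∀ n k (R : ℝ), 0 < R → ‖a n k‖ ≤ M R / R ^ k := by
    intro n k R hR
    have h1 := Complex.norm_iteratedDeriv_le_of_forall_mem_sphere_norm_le k hR
      (hf n).diffContOnCl (C := M R) (c := 0) fun z hz =>
        hM R n z (mem_sphere_zero_iff_norm.1 hz).le
    rw [ha]
    simp only [norm_mul, norm_inv, Complex.norm_natCast]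
    rw [inv_mul_le_iff₀ (by positivity)]
    rwa [mul_div_assoc] at h1
  have hsum : ∀ n z, HasSum (fun k => a n k * z ^ k) (f n z) := by
    intro n z
    have := Complex.hasSum_taylorSeries_of_entire (hf n) 0 z
    have e : (fun k => a n k * z ^ k) =
        fun k => (k.factorial : ℂ)⁻¹ • (z - 0) ^ k • iteratedDeriv k (f n) 0 := by
      funext k
      rw [ha, sub_zero, smul_eq_mul, smul_eq_mul]
      ring
    rw [e]
    exact this
  have hcpt : IsCompact (Set.pi univ fun _ : ℕ => closedBall (0 : ℂ) (M 1)) :=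
    isCompact_univ_pi fun _ => isCompact_closedBall _ _
  -- By Cauchy's estimate on the unit circle the Taylor coefficient sequences lie in a product of
  -- closed discs; its compactness replaces a diagonal argument.
  obtain ⟨b, -, φ, hφ, hlim⟩ := hcpt.tendsto_subseq (x := a) fun n k _ => by
    rw [mem_closedBall_zero_iff]
    simpa using hbound n k 1 one_pos
  rw [tendsto_pi_nhds] at hlim
  have hb : ∀ k (R : ℝ), 0 < R → ‖b k‖ ≤ M R / R ^ k := fun k R hR =>
    le_of_tendsto' (hlim k).norm fun n => hbound (φ n) k R hR
  -- Cauchy's estimate at radius 2R dominates the Taylor terms on |z| ≤ R by a geometric series,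
  -- which gives an entire limit and convergence of the sums.
  have hterm : ∀ (x : ℂ) k (R : ℝ), 0 < R → ∀ z : ℂ, ‖z‖ ≤ R →
      ‖x‖ ≤ M (2 * R) / (2 * R) ^ k → ‖x * z ^ k‖ ≤ M (2 * R) * (1 / 2) ^ k := by
    intro x k R hR z hz hx
    rw [norm_mul, norm_pow]
    calc ‖x‖ * ‖z‖ ^ k ≤ M (2 * R) / (2 * R) ^ k * R ^ k := by
          gcongr
          exact (norm_nonneg _).trans hx
      _ = _ := by
          rw [mul_pow, one_div, inv_pow]
          field_simp
  have hgeom : ∀ R, Summable fun k : ℕ => M (2 * R) * (1 / 2 : ℝ) ^ k := fun R =>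
    summable_geometric_two.mul_left _
  refine ⟨φ, hφ, fun z => ∑' k, b k * z ^ k, ?_, fun z => ?_⟩
  · intro z
    have hR : 0 < ‖z‖ + 1 := by positivity
    have hd : DifferentiableOn ℂ (fun z => ∑' k, b k * z ^ k) (ball 0 (‖z‖ + 1)) := by
      refine Complex.differentiableOn_tsum_of_summable_norm (hgeom (‖z‖ + 1)) (fun k => ?_) isOpen_ball
        fun k w hw => ?_
      · fun_prop
      · exact hterm _ _ _ hR _ (mem_ball_zero_iff.1 hw).le (hb k _ (by positivity))
    exact hd.differentiableAt (isOpen_ball.mem_nhds (by simp))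
  · have hR : 0 < ‖z‖ + 1 := by positivity
    have : Tendsto (fun n => ∑' k, a (φ n) k * z ^ k) atTop (𝓝 (∑' k, b k * z ^ k)) := by
      refine tendsto_tsum_of_dominated_convergence (hgeom (‖z‖ + 1)) (fun k => ?_)
        (Eventually.of_forall fun n k => ?_)
      · exact (hlim k).mul_const _
      · exact hterm _ _ _ hR _ (by linarith) (hbound _ k _ (by positivity))
    simpa only [(hsum _ z).tsum_eq] using this

theorem exists_norm_apply_le_of_fockNorm_le {α p : ℝ} (hα : 0 < α) (hp : 0 < p) {K : ℝ≥0∞}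
    (hK : K ≠ ⊤) :
    ∃ M : ℝ → ℝ, ∀ R, ∀ f : ℂ → ℂ, Differentiable ℂ f → fockNorm α p f ≤ K →
      ∀ z, ‖z‖ ≤ R → ‖f z‖ ≤ M R := by
  choose D hD h using fun R => exists_enorm_apply_le_fockNorm hα hp R
  refine ⟨fun R => D R * K.toReal, fun R f hf hfK z hz => ?_⟩
  have h1 : ‖f z‖ₑ ≤ ENNReal.ofReal (D R) * K := (h R f hf z hz).trans (by gcongr)
  rw [← ENNReal.ofReal_toReal hK, ← ENNReal.ofReal_mul (hD R).le, ← ofReal_norm,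
    ENNReal.ofReal_le_ofReal_iff (mul_nonneg (hD R).le ENNReal.toReal_nonneg)] at h1
  exact h1

/-- Fatou's lemma. -/
theorem fockNorm_le_of_tendsto {α p : ℝ} (hp : 0 < p) {f : ℕ → ℂ → ℂ}
    (hf : ∀ n, Differentiable ℂ (f n)) {h : ℂ → ℂ}
    (hlim : ∀ z, Tendsto (fun n => f n z) atTop (𝓝 (h z))) {K : ℝ≥0∞}
    (hK : ∀ n, fockNorm α p (f n) ≤ K) : fockNorm α p h ≤ K := by
  rw [← ENNReal.rpow_le_rpow_iff hp, fockNorm_rpow hp, fockInt, ← lintegral_const_mul' _ _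
    ENNReal.ofReal_ne_top]
  have hpt : ∀ z, ENNReal.ofReal (α * p / (2 * Real.pi)) *
      (‖h z‖ₑ ^ p * gaussWeight (α * p / 2) z) = liminf (fun n =>
        ENNReal.ofReal (α * p / (2 * Real.pi)) *
          (‖f n z‖ₑ ^ p * gaussWeight (α * p / 2) z)) atTop := by
    intro z
    refine (Tendsto.liminf_eq ?_).symm
    refine ENNReal.Tendsto.const_mul ?_ (Or.inr ENNReal.ofReal_ne_top)
    refine ENNReal.Tendsto.mul_const ?_ (Or.inr (gaussWeight_ne_top _ _))
    exact ((hlim z).enorm).ennrpow_const p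
  rw [lintegral_congr hpt]
  refine (lintegral_liminf_le fun n => ?_).trans ?_
  · exact ((measurable_enorm_rpow (hf n).continuous p).mul (measurable_gaussWeight _)).const_mul _
  · refine liminf_le_of_le (by isBoundedDefault) fun b hb => ?_
    obtain ⟨n, hn⟩ := hb.exists
    refine hn.trans ?_
    rw [lintegral_const_mul' _ _ ENNReal.ofReal_ne_top]
    change ENNReal.ofReal _ * fockInt p (α * p / 2) (f n) ≤ _
    rw [← fockNorm_rpow hp]
    exact ENNReal.rpow_le_rpow (hK n) hp.le

/-! ### Vector space operations and Fock norms -/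

theorem fockNorm_sub_rpow_le {α p : ℝ} (hp : 0 < p) {f h : ℂ → ℂ} (hf : Continuous f) :
    fockNorm α p (f - h) ^ p ≤ 2 ^ p * (fockNorm α p f ^ p + fockNorm α p h ^ p) := by
  simp only [fockNorm_rpow hp]
  rw [← mul_add, mul_left_comm]
  gcongr
  unfold fockInt
  have hm : Measurable fun z => ‖f z‖ₑ ^ p * gaussWeight (α * p / 2) z :=
    (measurable_enorm_rpow hf p).mul (measurable_gaussWeight _)
  rw [← lintegral_add_left hm, ← lintegral_const_mul' _ _ (by simp)]
  refine lintegral_mono fun z => ?_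
  rw [← add_mul, ← mul_assoc]
  gcongr
  have := enorm_add_rpow_le hp.le (f z) (-h z)
  rwa [enorm_neg, ← sub_eq_add_neg] at this

theorem fockNorm_smul {α p : ℝ} (hp : 0 < p) (a : ℂ) (f : ℂ → ℂ) :
    fockNorm α p (a • f) = ‖a‖ₑ * fockNorm α p f := by
  have h : fockNorm α p (a • f) ^ p = (‖a‖ₑ * fockNorm α p f) ^ p := by
    rw [ENNReal.mul_rpow_of_nonneg _ _ hp.le, fockNorm_rpow hp, fockNorm_rpow hp, mul_left_comm]
    congr 1
    unfold fockInt
    rw [← lintegral_const_mul' _ _ (ENNReal.rpow_ne_top_of_nonneg hp.le enorm_ne_top)]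
    refine lintegral_congr fun z => ?_
    simp only [Pi.smul_apply, smul_eq_mul]
    rw [enorm_mul, ENNReal.mul_rpow_of_nonneg _ _ hp.le, mul_assoc]
  exact ENNReal.rpow_left_injective hp.ne' h

theorem fockNorm_const_zero {α p : ℝ} (hp : 0 < p) : fockNorm α p 0 = 0 := by
  have := fockNorm_smul (α := α) hp 0 0
  simpa using this

theorem tendsto_rpow_zero_iff {ι : Type*} {l : Filter ι} {u : ι → ℝ≥0∞} {p : ℝ} (hp : 0 < p) :
    Tendsto (fun n => u n ^ p) l (𝓝 0) ↔ Tendsto u l (𝓝 0) := by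
  constructor
  · intro h
    have := h.ennrpow_const (1 / p)
    rw [ENNReal.zero_rpow_of_pos (by positivity)] at this
    refine this.congr fun n => ?_
    rw [← ENNReal.rpow_mul, mul_one_div_cancel hp.ne', ENNReal.rpow_one]
  · intro h
    have := h.ennrpow_const p
    rwa [ENNReal.zero_rpow_of_pos hp] at this

theorem tendsto_volterra {ι : Type*} {l : Filter ι} [l.IsCountablyGenerated] {g : ℂ → ℂ}
    (hg : Differentiable ℂ g) {u : ι → ℂ → ℂ} (hu : ∀ n, Differentiable ℂ (u n)) {M : ℝ → ℝ}
    (hM : ∀ R n z, ‖z‖ ≤ R → ‖u n z‖ ≤ M R) (hlim : ∀ z, Tendsto (fun n => u n z) l (𝓝 0)) (z : ℂ) :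
    Tendsto (fun n => volterra g (u n) z) l (𝓝 0) := by
  have hcg : Continuous fun t : ℝ => deriv g (t * z) :=
    hg.deriv.continuous.comp (by fun_prop)
  have h : Tendsto (fun n => volterra g (u n) z) l (𝓝 (∫ _ in (0 : ℝ)..1, (0 : ℂ))) := by
    refine intervalIntegral.tendsto_integral_filter_of_dominated_convergence
      (fun t : ℝ => M ‖z‖ * ‖deriv g (t * z)‖ * ‖z‖) (Eventually.of_forall fun n => ?_)
      (Eventually.of_forall fun n => ae_of_all _ fun t ht => ?_) ?_ (ae_of_all _ fun t ht => ?_)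
    · have hcu : Continuous fun t : ℝ => u n (t * z) := (hu n).continuous.comp (by fun_prop)
      exact ((hcu.mul hcg).mul continuous_const).aestronglyMeasurable
    · rw [uIoc_of_le zero_le_one] at ht
      rw [norm_mul, norm_mul]
      gcongr
      refine hM _ _ _ ?_
      rw [norm_mul, Complex.norm_real, Real.norm_of_nonneg ht.1.le]
      exact mul_le_of_le_one_left (norm_nonneg z) ht.2
    · exact Continuous.intervalIntegrable (by fun_prop) _ _
    · have := ((hlim (t * z)).mul_const (deriv g (t * z))).mul_const z
      simpa using this
  simpa using h

/-! ### Compactness -/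

/-- A criterion for compactness: the Littlewood-Paley integrals tend to zero along bounded sequences
that tend to zero pointwise. -/
theorem isCompactOp_compVolterra {α p q : ℝ} (hα : 0 < α) (hp : 0 < p) (hq : 0 < q)
    {ψ g : ℂ → ℂ} (hψ : Differentiable ℂ ψ) (hg : Differentiable ℂ g)
    (hbdd : IsBoundedOp α p q (compVolterra ψ g))
    (h : ∀ u : ℕ → ℂ → ℂ, (∀ n, Differentiable ℂ (u n)) → ∀ K : ℝ≥0∞, K ≠ ⊤ →
      (∀ n, fockNorm α p (u n) ≤ K) → (∀ z, Tendsto (fun n => u n z) atTop (𝓝 0)) →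
      Tendsto (fun n => lpInt q (α * q / 2) (compVolterra ψ g (u n))) atTop (𝓝 0)) :
    IsCompactOp α p q (compVolterra ψ g) := by
  refine ⟨hbdd.1, fun f K hf => ?_⟩
  obtain ⟨M, hM⟩ := exists_norm_apply_le_of_fockNorm_le hα hp (K := K) ENNReal.coe_ne_top
  obtain ⟨φ, hφ, h₀, hh₀, hlim⟩ := exists_subseq_tendsto_of_locally_bounded
    (fun n => (hf n).1.1) fun R n z hz => hM R (f n) (hf n).1.1 (hf n).2 z hz
  have hh₀K : fockNorm α p h₀ ≤ K :=
    fockNorm_le_of_tendsto hp (fun n => (hf (φ n)).1.1) hlim fun n => (hf (φ n)).2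
  have hh₀mem : h₀ ∈ FockSpace α p := ⟨hh₀, hh₀K.trans_lt ENNReal.coe_lt_top⟩
  refine ⟨compVolterra ψ g h₀, hbdd.1 _ hh₀mem, φ, hφ, ?_⟩
  -- The limit of the images is the image of h₀; by linearity it remains to treat differences, which
  -- are bounded and tend to 0 pointwise.
  set u : ℕ → ℂ → ℂ := fun n => f (φ n) - h₀ with hu
  have hud : ∀ n, Differentiable ℂ (u n) := fun n => (hf (φ n)).1.1.sub hh₀
  have hulim : ∀ z, Tendsto (fun n => u n z) atTop (𝓝 0) := fun z => by
    simpa [hu] using (hlim z).sub_const (h₀ z)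
  obtain ⟨K', hK', huK⟩ : ∃ K' : ℝ≥0∞, K' ≠ ⊤ ∧ ∀ n, fockNorm α p (u n) ≤ K' := by
    refine ⟨((2 : ℝ≥0∞) ^ p * ((K : ℝ≥0∞) ^ p + (K : ℝ≥0∞) ^ p)) ^ (1 / p), ?_, fun n => ?_⟩
    · refine ENNReal.rpow_ne_top_of_nonneg (by positivity) (ENNReal.mul_ne_top
        (ENNReal.rpow_ne_top_of_nonneg hp.le (by simp)) (ENNReal.add_ne_top.2 ⟨?_, ?_⟩)) <;>
      exact ENNReal.rpow_ne_top_of_nonneg hp.le ENNReal.coe_ne_top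
    · rw [← ENNReal.rpow_le_rpow_iff hp, ← ENNReal.rpow_mul, one_div_mul_cancel hp.ne',
        ENNReal.rpow_one]
      refine (fockNorm_sub_rpow_le hp (hf (φ n)).1.1.continuous).trans ?_
      gcongr
      exact (hf (φ n)).2
  obtain ⟨M', hM'⟩ := exists_norm_apply_le_of_fockNorm_le hα hp hK'
  have h0 : Tendsto (fun n => compVolterra ψ g (u n) 0) atTop (𝓝 0) :=
    tendsto_volterra hg hud (fun R n z hz => hM' R (u n) (hud n) (huK n) z hz) hulim (ψ 0)
  have h1 := h u hud K' hK' huK hulim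
  obtain ⟨A, hA, hA'⟩ := exists_fockNorm_rpow_le hα hq
  have h2 : Tendsto (fun n => ENNReal.ofReal A * (‖compVolterra ψ g (u n) 0‖ₑ ^ q +
      lpInt q (α * q / 2) (compVolterra ψ g (u n)))) atTop (𝓝 0) := by
    have h3 : Tendsto (fun n => ‖compVolterra ψ g (u n) 0‖ₑ ^ q) atTop (𝓝 0) := by
      rw [tendsto_rpow_zero_iff hq]
      simpa using h0.enorm
    have := ENNReal.Tendsto.const_mul (h3.add h1) (Or.inr (ENNReal.ofReal_ne_top (r := A)))
    simpa using this
  rw [← tendsto_rpow_zero_iff hq]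
  refine tendsto_of_tendsto_of_tendsto_of_le_of_le tendsto_const_nhds h2 (fun _ => zero_le)
    fun n => ?_
  rw [← compVolterra_sub ψ hg (hf (φ n)).1.1 hh₀]
  exact hA' _ (differentiable_compVolterra hψ hg (hud n))

/-- Split at a large circle: outside, the integrals are small uniformly in n; inside, u n is locally
bounded and W is integrable, so dominated convergence applies. -/
theorem tendsto_lintegral_mul_of_tail {p c : ℝ} (hp : 0 < p) (hc : 0 ≤ c) {u : ℕ → ℂ → ℂ}
    (hu : ∀ n, Differentiable ℂ (u n)) {M : ℝ → ℝ} (hM : ∀ R n z, ‖z‖ ≤ R → ‖u n z‖ ≤ M R)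
    (hlim : ∀ z, Tendsto (fun n => u n z) atTop (𝓝 0)) {W : ℂ → ℝ≥0∞} (hW : Measurable W)
    (hloc : ∀ R : ℝ, ∫⁻ w in ball (0 : ℂ) R, W w ≠ ⊤) (hfin : ∀ w, W w ≠ ⊤)
    (htail : ∀ ε : ℝ≥0∞, 0 < ε → ∃ R : ℝ, ∀ n,
      ∫⁻ w in (ball (0 : ℂ) R)ᶜ, ‖u n w‖ₑ ^ p * gaussWeight c w * W w ≤ ε) :
    Tendsto (fun n => ∫⁻ w, ‖u n w‖ₑ ^ p * gaussWeight c w * W w) atTop (𝓝 0) := by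
  rw [ENNReal.tendsto_nhds_zero]
  intro ε hε
  obtain ⟨R, hR⟩ := htail (ε / 2) (ENNReal.half_pos hε.ne')
  have hmeas : ∀ n, Measurable fun w => ‖u n w‖ₑ ^ p * gaussWeight c w * W w := fun n =>
    ((measurable_enorm_rpow (hu n).continuous p).mul (measurable_gaussWeight _)).mul hW
  have hball : Tendsto (fun n => ∫⁻ w in ball (0 : ℂ) R, ‖u n w‖ₑ ^ p * gaussWeight c w * W w)
      atTop (𝓝 (∫⁻ _ in ball (0 : ℂ) R, 0)) := by
    refine tendsto_lintegral_of_dominated_convergence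
      (fun w => ENNReal.ofReal (M R) ^ p * W w) hmeas (fun n => ?_) ?_ (ae_of_all _ fun w => ?_)
    · filter_upwards [ae_restrict_mem measurableSet_ball] with w hw
      gcongr
      calc ‖u n w‖ₑ ^ p * gaussWeight c w ≤ ‖u n w‖ₑ ^ p * 1 := by
            gcongr
            exact gaussWeight_le_one hc w
        _ ≤ _ := by
            rw [mul_one, ← ofReal_norm]
            gcongr
            exact hM R n w (mem_ball_zero_iff.1 hw).le
    · rw [lintegral_const_mul' _ _ (ENNReal.rpow_ne_top_of_nonneg hp.le ENNReal.ofReal_ne_top)]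
      exact ENNReal.mul_ne_top (ENNReal.rpow_ne_top_of_nonneg hp.le ENNReal.ofReal_ne_top) (hloc R)
    · have h1 : Tendsto (fun n => ‖u n w‖ₑ ^ p) atTop (𝓝 0) := by
        rw [tendsto_rpow_zero_iff hp]
        simpa using (hlim w).enorm
      have h2 := ENNReal.Tendsto.mul_const h1 (Or.inr (gaussWeight_ne_top c w))
      have h3 := ENNReal.Tendsto.mul_const h2 (b := W w) (Or.inr (hfin w))
      simpa using h3
  rw [lintegral_zero, ENNReal.tendsto_nhds_zero] at hball
  filter_upwards [hball (ε / 2) (ENNReal.half_pos hε.ne')] with n hn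
  rw [← lintegral_add_compl _ (measurableSet_ball (x := (0 : ℂ)) (ε := R))]
  calc _ ≤ ε / 2 + ε / 2 := add_le_add hn (hR n)
    _ = ε := ENNReal.add_halves ε

/-- Finiteness of the transform at one point makes the symbol measure finite on every disc about it,
and one such disc contains all B(w, 1) with |w| ≤ R. -/
theorem exists_symbolMeasure_ball_le_of_norm_le {α q : ℝ} (hα : 0 < α) (hq : 0 < q) {ψ g : ℂ → ℂ}
    (hψ : Differentiable ℂ ψ) (hg : Differentiable ℂ g) {w₀ : ℂ} (h : berezinM α q ψ g w₀ ≠ ⊤)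
    (R : ℝ) : ∃ S : ℝ≥0∞, S ≠ ⊤ ∧ ∀ w : ℂ, ‖w‖ ≤ R →
      symbolMeasure q (α * q / 2) ψ g (ball w 1) ≤ S := by
  obtain ⟨C, hC, hC'⟩ := exists_symbolMeasure_ball_le hα hq (R + ‖w₀‖ + 1)
  refine ⟨_, ENNReal.mul_ne_top ENNReal.ofReal_ne_top h, fun w hw =>
    (measure_mono (ball_subset_ball' ?_)).trans (hC' ψ g hψ hg w₀)⟩
  rw [dist_eq_norm]
  linarith [norm_sub_le w w₀]

theorem isCompactOp_compVolterra_of_tendsto {α p q : ℝ} (hα : 0 < α) (hp : 0 < p) (hpq : p ≤ q)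
    {ψ g : ℂ → ℂ} (hψ : Differentiable ℂ ψ) (hg : Differentiable ℂ g)
    (h : Tendsto (berezinM α q ψ g) (cocompact ℂ) (𝓝 0)) :
    IsCompactOp α p q (compVolterra ψ g) := by
  have hq : 0 < q := hp.trans_le hpq
  set W : ℂ → ℝ≥0∞ := fun w => symbolMeasure q (α * q / 2) ψ g (ball w 1) with hWdef
  have hWm : Measurable W := measurable_measure_ball _ 1
  obtain ⟨C, hC, hC'⟩ := exists_symbolMeasure_ball_le hα hq 1
  have hout : ∀ ε : ℝ≥0∞, 0 < ε → ∃ R : ℝ, ∀ w : ℂ, R ≤ ‖w‖ → berezinM α q ψ g w ≤ ε := by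
    intro ε hε
    have := (ENNReal.tendsto_nhds_zero.1 h) ε hε
    rw [← cobounded_eq_cocompact, ← comap_norm_atTop, eventually_comap] at this
    obtain ⟨R, hR⟩ := eventually_atTop.1 this
    exact ⟨R, fun w hw => hR _ hw w rfl⟩
  obtain ⟨R₁, hR₁⟩ := hout 1 one_pos
  -- The limit controls the transform only far out; a distant point where it is finite provides the
  -- bound on the remaining disc.
  have hw₀ : berezinM α q ψ g ((|R₁| : ℝ) : ℂ) ≠ ⊤ := by
    refine ne_top_of_le_ne_top ENNReal.one_ne_top (hR₁ _ ?_)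
    rw [Complex.norm_real, Real.norm_of_nonneg (abs_nonneg _)]
    exact le_abs_self _
  have hbddR := exists_symbolMeasure_ball_le_of_norm_le hα hq hψ hg hw₀
  obtain ⟨S₁, hS₁, hS₁'⟩ := hbddR R₁
  have hWS : ∀ w, W w ≤ max S₁ (ENNReal.ofReal C) := by
    intro w
    rcases le_total ‖w‖ R₁ with hw | hw
    · exact (hS₁' w hw).trans (le_max_left _ _)
    · refine ((hC' ψ g hψ hg w).trans ?_).trans (le_max_right _ _)
      calc _ ≤ ENNReal.ofReal C * 1 := by
            gcongr
            exact hR₁ w hw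
        _ = _ := mul_one _
  have hS : max S₁ (ENNReal.ofReal C) ≠ ⊤ := (max_lt hS₁.lt_top ENNReal.ofReal_lt_top).ne
  have hWfin : ∀ w, W w ≠ ⊤ := fun w => ne_top_of_le_ne_top hS (hWS w)
  have hbdd : IsBoundedOp α p q (compVolterra ψ g) := by
    obtain ⟨C₁, -, hC₁⟩ := exists_lpInt_compVolterra_le_sup hα hp hpq
    exact isBoundedOp_compVolterra hα hp hq hψ hg (ENNReal.mul_ne_top ENNReal.ofReal_ne_top hS)
      fun f hf => hC₁ ψ g f hψ hg hf _ (ae_of_all _ hWS)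
  refine isCompactOp_compVolterra hα hp hq hψ hg hbdd fun u hu K hK huK hulim => ?_
  obtain ⟨C₂, hC₂, hC₂'⟩ := exists_lpInt_compVolterra_le_integral hα hp hpq
  obtain ⟨M, hM⟩ := exists_norm_apply_le_of_fockNorm_le hα hp hK
  set J : ℝ≥0∞ := ENNReal.ofReal (2 * Real.pi / (α * p)) * K ^ p with hJ
  have hJtop : J ≠ ⊤ := ENNReal.mul_ne_top ENNReal.ofReal_ne_top
    (ENNReal.rpow_ne_top_of_nonneg hp.le hK)
  have huJ : ∀ n, fockInt p (α * p / 2) (u n) ≤ J := fun n => by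
    rw [fockInt_eq hα hp]
    exact mul_le_mul' le_rfl (ENNReal.rpow_le_rpow (huK n) hp.le)
  have hmain : Tendsto (fun n => ∫⁻ w, ‖u n w‖ₑ ^ p * gaussWeight (α * p / 2) w * W w)
      atTop (𝓝 0) := by
    refine tendsto_lintegral_mul_of_tail hp (by positivity) hu
      (fun R n z hz => hM R (u n) (hu n) (huK n) z hz) hulim hWm (fun R => ?_) hWfin ?_
    · refine ne_top_of_le_ne_top ?_ (lintegral_mono hWS)
      rw [setLIntegral_const]
      exact ENNReal.mul_ne_top hS measure_ball_lt_top.ne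
    · intro ε hε
      -- J + 1 in place of J keeps the divisor nonzero.
      have hCJ : ENNReal.ofReal C * (J + 1) ≠ 0 := by
        refine mul_ne_zero ?_ (by simp)
        simpa using hC
      have hCJ' : ENNReal.ofReal C * (J + 1) ≠ ⊤ :=
        ENNReal.mul_ne_top ENNReal.ofReal_ne_top (by simpa using hJtop)
      obtain ⟨R, hR⟩ := hout (ε / (ENNReal.ofReal C * (J + 1)))
        (ENNReal.div_pos hε.ne' hCJ')
      refine ⟨R, fun n => ?_⟩
      have hm : Measurable fun w => ‖u n w‖ₑ ^ p * gaussWeight (α * p / 2) w :=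
        (measurable_enorm_rpow (hu n).continuous p).mul (measurable_gaussWeight _)
      calc _ ≤ ∫⁻ w in (ball (0 : ℂ) R)ᶜ, ‖u n w‖ₑ ^ p * gaussWeight (α * p / 2) w *
            (ENNReal.ofReal C * (ε / (ENNReal.ofReal C * (J + 1)))) := by
            refine setLIntegral_mono' measurableSet_ball.compl fun w hw => ?_
            rw [mem_compl_iff, mem_ball_zero_iff, not_lt] at hw
            refine mul_le_mul' le_rfl ((hC' ψ g hψ hg w).trans (mul_le_mul' le_rfl (hR w hw)))
        _ ≤ ∫⁻ w, ‖u n w‖ₑ ^ p * gaussWeight (α * p / 2) w *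
            (ENNReal.ofReal C * (ε / (ENNReal.ofReal C * (J + 1)))) :=
            setLIntegral_le_lintegral _ _
        _ = fockInt p (α * p / 2) (u n) *
            (ENNReal.ofReal C * (ε / (ENNReal.ofReal C * (J + 1)))) := lintegral_mul_const _ hm
        _ ≤ (J + 1) * (ENNReal.ofReal C * (ε / (ENNReal.ofReal C * (J + 1)))) := by
            gcongr
            exact (huJ n).trans le_self_add
        _ = ENNReal.ofReal C * (J + 1) * (ε / (ENNReal.ofReal C * (J + 1))) := by ring
        _ = ε := ENNReal.mul_div_cancel hCJ hCJ'
        _ ≤ ε := le_rfl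
  have hfinal : Tendsto (fun n => ENNReal.ofReal C₂ * (K ^ (q - p) *
      ∫⁻ w, ‖u n w‖ₑ ^ p * gaussWeight (α * p / 2) w * W w)) atTop (𝓝 0) := by
    have h1 := ENNReal.Tendsto.const_mul hmain (a := K ^ (q - p))
      (Or.inr (ENNReal.rpow_ne_top_of_nonneg (by linarith) hK))
    have h2 := ENNReal.Tendsto.const_mul h1 (Or.inr (ENNReal.ofReal_ne_top (r := C₂)))
    simpa using h2
  refine tendsto_of_tendsto_of_tendsto_of_le_of_le tendsto_const_nhds hfinal (fun _ => zero_le)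
    fun n => (hC₂' ψ g (u n) hψ hg (hu n)).trans ?_
  refine mul_le_mul' le_rfl (mul_le_mul' ?_ le_rfl)
  exact ENNReal.rpow_le_rpow (huK n) (by linarith)

theorem tendsto_setLIntegral_compl_ball {W : ℂ → ℝ≥0∞} (hW : Measurable W)
    (h : ∫⁻ w, W w ≠ ⊤) :
    Tendsto (fun N : ℕ => ∫⁻ w in (ball (0 : ℂ) N)ᶜ, W w) atTop (𝓝 0) := by
  have h1 : Tendsto (fun N : ℕ => ∫⁻ w, ((ball (0 : ℂ) N)ᶜ).indicator W w) atTop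
      (𝓝 (∫⁻ _ : ℂ, 0)) := by
    refine tendsto_lintegral_of_dominated_convergence W
      (fun N => hW.indicator measurableSet_ball.compl)
      (fun N => ae_of_all _ fun w => indicator_le_self _ _ w) h (ae_of_all _ fun w => ?_)
    refine tendsto_const_nhds.congr' ?_
    obtain ⟨N₀, hN₀⟩ := exists_nat_gt ‖w‖
    filter_upwards [eventually_ge_atTop N₀] with N hN
    rw [indicator_of_notMem]
    rw [mem_compl_iff, not_not, mem_ball_zero_iff]
    exact hN₀.trans_le (by exact_mod_cast hN)
  simpa [lintegral_indicator measurableSet_ball.compl] using h1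

/-- The tails of the convergent integral of λ(B(w,1))^{q/(q-p)} tend to 0, and Hölder's inequality
outside a disc turns this into a tail bound uniform over bounded sequences. So compactness costs no
more than boundedness. -/
theorem isCompactOp_compVolterra_of_lintegral_lt_top {α p q : ℝ} (hα : 0 < α) (hp : 0 < p)
    (hpq : p < q) {ψ g : ℂ → ℂ} (hψ : Differentiable ℂ ψ) (hg : Differentiable ℂ g)
    (h : ∫⁻ w, berezinM α p ψ g w ^ (q / (q - p)) < ⊤) :
    IsCompactOp α q p (compVolterra ψ g) := by
  have hq : 0 < q := hp.trans hpq
  have hs : 1 ≤ q / (q - p) := by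
    rw [one_le_div (by linarith)]
    linarith
  set s := q / (q - p) with hsdef
  have hs0 : 0 < s := by linarith
  set W : ℂ → ℝ≥0∞ := fun w => symbolMeasure p (α * p / 2) ψ g (ball w 1) with hWdef
  have hWm : Measurable W := measurable_measure_ball _ 1
  obtain ⟨C, hC, hC'⟩ := exists_symbolMeasure_ball_le hα hp 1
  have hWs : ∫⁻ w, W w ^ s ≠ ⊤ := by
    refine ne_top_of_le_ne_top (b := ENNReal.ofReal C ^ s * ∫⁻ w, berezinM α p ψ g w ^ s) ?_ ?_
    · exact ENNReal.mul_ne_top (ENNReal.rpow_ne_top_of_nonneg hs0.le ENNReal.ofReal_ne_top) h.ne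
    · rw [← lintegral_const_mul' _ _ (ENNReal.rpow_ne_top_of_nonneg hs0.le ENNReal.ofReal_ne_top)]
      refine lintegral_mono fun w => ?_
      rw [← ENNReal.mul_rpow_of_nonneg _ _ hs0.le]
      exact ENNReal.rpow_le_rpow (hC' ψ g hψ hg w) hs0.le
  obtain ⟨w₀, hw₀⟩ : ∃ w₀, berezinM α p ψ g w₀ ≠ ⊤ := by
    by_contra hcon
    push Not at hcon
    simp [hcon, ENNReal.top_rpow_of_pos hs0] at h
  have hbddR := exists_symbolMeasure_ball_le_of_norm_le hα hp hψ hg hw₀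
  have hWfin : ∀ w, W w ≠ ⊤ := fun w => by
    obtain ⟨S, hS, hS'⟩ := hbddR ‖w‖
    exact ne_top_of_le_ne_top hS (hS' w le_rfl)
  refine isCompactOp_compVolterra hα hq hp hψ hg
    (isBoundedOp_compVolterra_of_lintegral_lt_top hα hp hpq hψ hg h) fun u hu K hK huK hulim => ?_
  obtain ⟨C₂, hC₂, hC₂'⟩ := exists_lpInt_compVolterra_le_integral hα hp le_rfl
  obtain ⟨M, hM⟩ := exists_norm_apply_le_of_fockNorm_le hα hq hK
  set J : ℝ≥0∞ := (ENNReal.ofReal (2 * Real.pi / (α * q)) * K ^ q) ^ (p / q) with hJ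
  have hJtop : J ≠ ⊤ := ENNReal.rpow_ne_top_of_nonneg (by positivity)
    (ENNReal.mul_ne_top ENNReal.ofReal_ne_top (ENNReal.rpow_ne_top_of_nonneg hq.le hK))
  have hmain : Tendsto (fun n => ∫⁻ w, ‖u n w‖ₑ ^ p * gaussWeight (α * p / 2) w * W w)
      atTop (𝓝 0) := by
    refine tendsto_lintegral_mul_of_tail hp (by positivity) hu
      (fun R n z hz => hM R (u n) (hu n) (huK n) z hz) hulim hWm (fun R => ?_) hWfin ?_
    · obtain ⟨S, hS, hS'⟩ := hbddR R
      refine ne_top_of_le_ne_top ?_ (setLIntegral_mono' (g := fun _ => S) measurableSet_ball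
        fun w hw => hS' w (mem_ball_zero_iff.1 hw).le)
      rw [setLIntegral_const]
      exact ENNReal.mul_ne_top hS measure_ball_lt_top.ne
    · intro ε hε
      have hqp : 0 < (q - p) / q := div_pos (by linarith) hq
      have h1 := tendsto_setLIntegral_compl_ball (hWm.pow_const s) hWs
      rw [← tendsto_rpow_zero_iff hqp] at h1
      have h2 := ENNReal.Tendsto.const_mul h1 (Or.inr hJtop)
      rw [mul_zero, ENNReal.tendsto_nhds_zero] at h2
      obtain ⟨N, hN⟩ := (h2 ε hε).exists
      refine ⟨N, fun n => le_trans ?_ hN⟩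
      set W' : ℂ → ℝ≥0∞ := ((ball (0 : ℂ) N)ᶜ).indicator W with hW'
      have e1 : ∫⁻ w in (ball (0 : ℂ) N)ᶜ, ‖u n w‖ₑ ^ p * gaussWeight (α * p / 2) w * W w =
          ∫⁻ w, ‖u n w‖ₑ ^ p * gaussWeight (α * p / 2) w * W' w := by
        rw [← lintegral_indicator measurableSet_ball.compl]
        refine lintegral_congr fun w => ?_
        by_cases hw : w ∈ (ball (0 : ℂ) N)ᶜ
        · rw [hW', indicator_of_mem hw, indicator_of_mem hw]
        · rw [hW', indicator_of_notMem hw, indicator_of_notMem hw, mul_zero]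
      have e2 : ∫⁻ w, W' w ^ s = ∫⁻ w in (ball (0 : ℂ) N)ᶜ, W w ^ s := by
        rw [← lintegral_indicator measurableSet_ball.compl]
        refine lintegral_congr fun w => ?_
        by_cases hw : w ∈ (ball (0 : ℂ) N)ᶜ
        · rw [hW', indicator_of_mem hw, indicator_of_mem hw]
        · rw [hW', indicator_of_notMem hw, indicator_of_notMem hw, ENNReal.zero_rpow_of_pos hs0]
      rw [e1]
      refine (lintegral_mul_le_fockNorm hα hp hpq (hu n).continuous
        (hWm.indicator measurableSet_ball.compl).aemeasurable).trans ?_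
      rw [← hsdef, ← hW', e2, hJ]
      gcongr
      exact huK n
  have hfinal : Tendsto (fun n => ENNReal.ofReal C₂ *
      ∫⁻ w, ‖u n w‖ₑ ^ p * gaussWeight (α * p / 2) w * W w) atTop (𝓝 0) := by
    have h2 := ENNReal.Tendsto.const_mul hmain (Or.inr (ENNReal.ofReal_ne_top (r := C₂)))
    simpa using h2
  refine tendsto_of_tendsto_of_tendsto_of_le_of_le tendsto_const_nhds hfinal (fun _ => zero_le)
    fun n => (hC₂' ψ g (u n) hψ hg (hu n)).trans ?_
  rw [sub_self, ENNReal.rpow_zero, one_mul]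

/-! ### Necessity of the compactness condition: kernels escaping to infinity -/

theorem norm_normKernel (α : ℝ) (w z : ℂ) :
    ‖normKernel α w z‖ = Real.exp (α / 2 * ‖z‖ ^ 2) * Real.exp (-(α / 2) * ‖z - w‖ ^ 2) := by
  have h := enorm_normKernel_rpow_mul α (p := 1) zero_le_one w z
  rw [ENNReal.rpow_one, gaussWeight, gaussWeight, ← ofReal_norm,
    ← ENNReal.ofReal_mul (norm_nonneg _), ENNReal.ofReal_eq_ofReal_iff (by positivity)
      (by positivity), mul_one] at h
  rw [← h, mul_left_comm, ← Real.exp_add]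
  simp

theorem tendsto_normKernel {α : ℝ} (hα : 0 < α) (z : ℂ) :
    Tendsto (fun w => normKernel α w z) (cocompact ℂ) (𝓝 0) := by
  rw [tendsto_zero_iff_norm_tendsto_zero]
  simp_rw [norm_normKernel]
  have h1 : Tendsto (fun w : ℂ => ‖z - w‖) (cocompact ℂ) atTop := by
    refine tendsto_atTop_mono (f := fun w : ℂ => ‖w‖ - ‖z‖) (fun w => ?_)
      (tendsto_atTop_add_const_right _ _ tendsto_norm_cocompact_atTop)
    rw [norm_sub_rev]
    exact norm_sub_norm_le w z
  have h2 : Tendsto (fun w : ℂ => α / 2 * ‖z - w‖ ^ 2) (cocompact ℂ) atTop :=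
    ((tendsto_pow_atTop two_ne_zero).comp h1).const_mul_atTop (by positivity)
  have h3 := (Real.tendsto_exp_neg_atTop_nhds_zero.comp h2).const_mul (Real.exp (α / 2 * ‖z‖ ^ 2))
  simpa [Function.comp_def] using h3

/-- Along w_n → ∞ the kernels tend to 0 pointwise with norm one, hence so do their images pointwise.
A norm limit of a subsequence of images must therefore be 0, and the norms of the images of kernels
dominate the transform. -/
theorem tendsto_berezinM_of_isCompactOp {α p q : ℝ} (hα : 0 < α) (hp : 0 < p) (hq : 0 < q)
    {ψ g : ℂ → ℂ} (hψ : Differentiable ℂ ψ) (hg : Differentiable ℂ g)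
    (h : IsCompactOp α p q (compVolterra ψ g)) :
    Tendsto (berezinM α q ψ g) (cocompact ℂ) (𝓝 0) := by
  have : (cocompact ℂ).IsCountablyGenerated := by
    rw [← cobounded_eq_cocompact, ← comap_norm_atTop]
    infer_instance
  refine tendsto_of_subseq_tendsto fun w hw => ?_
  obtain ⟨h₀, hh₀, φ, hφ, hlim⟩ := h.2 (fun n => normKernel α (w n)) 1 fun n =>
    ⟨normKernel_mem hα hp _, by rw [fockNorm_normKernel hα hp]; simp⟩
  refine ⟨φ, ?_⟩
  obtain ⟨M, hM⟩ := exists_norm_apply_le_of_fockNorm_le hα hp ENNReal.one_ne_top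
  have hkd : ∀ n, Differentiable ℂ (normKernel α (w (φ n))) := fun n => differentiable_normKernel _ _
  have hT : ∀ z, Tendsto (fun n => compVolterra ψ g (normKernel α (w (φ n))) z) atTop (𝓝 0) :=
    fun z => tendsto_volterra hg hkd
      (fun R n z hz => hM R _ (hkd n) (fockNorm_normKernel hα hp _).le z hz)
      (fun z => (tendsto_normKernel hα z).comp (hw.comp hφ.tendsto_atTop)) (ψ z)
  have hzero : h₀ = 0 := by
    funext z
    obtain ⟨K, hK, hK'⟩ := exists_enorm_apply_le_fockNorm hα hq ‖z‖
    have h1 : Tendsto (fun n => ‖(compVolterra ψ g (normKernel α (w (φ n))) - h₀) z‖ₑ) atTop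
        (𝓝 0) := by
      have h2 := ENNReal.Tendsto.const_mul hlim (Or.inr (ENNReal.ofReal_ne_top (r := K)))
      rw [mul_zero] at h2
      refine tendsto_of_tendsto_of_tendsto_of_le_of_le tendsto_const_nhds h2 (fun _ => zero_le)
        fun n => hK' _ ((differentiable_compVolterra hψ hg (hkd n)).sub hh₀.1) z le_rfl
    have h3 : Tendsto (fun n => ‖(compVolterra ψ g (normKernel α (w (φ n))) - h₀) z‖ₑ) atTop
        (𝓝 ‖0 - h₀ z‖ₑ) := ((hT z).sub_const (h₀ z)).enorm
    have h4 := tendsto_nhds_unique h1 h3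
    simpa using h4.symm
  rw [hzero] at hlim
  simp only [sub_zero] at hlim
  obtain ⟨A, hA, hA'⟩ := exists_berezinM_le_opNorm hα hp hq
  rw [← tendsto_rpow_zero_iff hq] at hlim
  have h5 := ENNReal.Tendsto.const_mul hlim (Or.inr (ENNReal.ofReal_ne_top (r := A)))
  rw [mul_zero] at h5
  exact tendsto_of_tendsto_of_tendsto_of_le_of_le tendsto_const_nhds h5 (fun _ => zero_le)
    fun n => (hA' ψ g hψ hg (w (φ n))).1

/-! ### Homogeneity of the operator norm, and its finiteness for compact operators -/

theorem eq_zero_of_fockNorm_eq_zero {α p : ℝ} (hα : 0 < α) (hp : 0 < p) {f : ℂ → ℂ}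
    (hf : Differentiable ℂ f) (h : fockNorm α p f = 0) : f = 0 := by
  funext z
  obtain ⟨K, -, hK⟩ := exists_enorm_apply_le_fockNorm hα hp ‖z‖
  have := hK f hf z le_rfl
  rw [h, mul_zero] at this
  simpa using this

theorem fockNorm_compVolterra_le_opNorm_mul {α p q : ℝ} (hα : 0 < α) (hp : 0 < p) (hq : 0 < q)
    {ψ g f : ℂ → ℂ} (hf : f ∈ FockSpace α p) :
    fockNorm α q (compVolterra ψ g f) ≤ opNorm α p q (compVolterra ψ g) * fockNorm α p f := by
  set N := fockNorm α p f with hN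
  rcases eq_or_ne N 0 with h0 | h0
  · have hf0 : f = 0 := eq_zero_of_fockNorm_eq_zero hα hp hf.1 h0
    have : compVolterra ψ g f = 0 := by
      have h1 := compVolterra_smul ψ g f 0
      rw [zero_smul, zero_smul] at h1
      rw [hf0, h1]
    rw [this, fockNorm_const_zero hq]
    exact zero_le
  · have hNt : N ≠ ⊤ := hf.2.ne
    have hN0 : 0 < N.toReal := ENNReal.toReal_pos h0 hNt
    set a : ℂ := ((N.toReal⁻¹ : ℝ) : ℂ) with ha
    have hae : ‖a‖ₑ = N⁻¹ := by
      rw [ha, ← ofReal_norm, Complex.norm_real, Real.norm_of_nonneg (by positivity),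
        ENNReal.ofReal_inv_of_pos hN0, ENNReal.ofReal_toReal hNt]
    have h1 : fockNorm α p (a • f) = 1 := by
      rw [fockNorm_smul hp, hae, ← hN, ENNReal.inv_mul_cancel h0 hNt]
    have hmem : a • f ∈ FockSpace α p := ⟨hf.1.const_smul a, by rw [h1]; exact ENNReal.one_lt_top⟩
    have h2 := fockNorm_le_opNorm (q := q) (compVolterra ψ g) hmem h1.le
    rw [compVolterra_smul, fockNorm_smul hq, hae] at h2
    calc fockNorm α q (compVolterra ψ g f)
        = N⁻¹ * fockNorm α q (compVolterra ψ g f) * N := by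
          rw [mul_right_comm, ENNReal.inv_mul_cancel h0 hNt, one_mul]
      _ ≤ _ := by gcongr

/-- Otherwise the unit ball contains a sequence whose n-th image has norm above n, and no
subsequence of these images converges. -/
theorem IsCompactOp.opNorm_lt_top {α p q : ℝ} (hq : 0 < q)
    {ψ g : ℂ → ℂ} (hψ : Differentiable ℂ ψ) (hg : Differentiable ℂ g)
    (h : IsCompactOp α p q (compVolterra ψ g)) : opNorm α p q (compVolterra ψ g) < ⊤ := by
  by_contra hcon
  rw [not_lt, top_le_iff] at hcon
  have hex : ∀ n : ℕ, ∃ f, (f ∈ FockSpace α p ∧ fockNorm α p f ≤ 1) ∧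
      (n : ℝ≥0∞) < fockNorm α q (compVolterra ψ g f) := by
    intro n
    have h1 : (n : ℝ≥0∞) < opNorm α p q (compVolterra ψ g) := by
      rw [hcon]
      exact ENNReal.natCast_lt_top n
    rw [opNorm, lt_iSup_iff] at h1
    obtain ⟨f, hf⟩ := h1
    rw [lt_iSup_iff] at hf
    obtain ⟨hf1, hf2⟩ := hf
    exact ⟨f, hf1, hf2⟩
  choose f hf hfn using hex
  obtain ⟨h₀, hh₀, φ, hφ, hlim⟩ := h.2 f 1 fun n => by simpa using hf n
  set X := (2 : ℝ≥0∞) ^ q * (1 ^ q + fockNorm α q h₀ ^ q) with hX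
  have hXt : X ≠ ⊤ := ENNReal.mul_ne_top (ENNReal.rpow_ne_top_of_nonneg hq.le (by simp))
    (ENNReal.add_ne_top.2 ⟨by simp, ENNReal.rpow_ne_top_of_nonneg hq.le hh₀.2.ne⟩)
  have hXt' : X ^ (1 / q) ≠ ⊤ := ENNReal.rpow_ne_top_of_nonneg (by positivity) hXt
  obtain ⟨n₀, hn₀⟩ := ENNReal.exists_nat_gt hXt'
  obtain ⟨n, hn1, hn2⟩ := ((ENNReal.tendsto_nhds_zero.1 hlim 1 one_pos).and
    (eventually_ge_atTop n₀)).exists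
  have hTd := differentiable_compVolterra hψ hg (hf (φ n)).1.1
  have h1 : fockNorm α q (compVolterra ψ g (f (φ n))) ^ q ≤ X := by
    -- T f is written as the difference (T f - h₀) - (-h₀) to fit the quasi-triangle inequality.
    have h2 := fockNorm_sub_rpow_le (α := α) hq
      (f := compVolterra ψ g (f (φ n)) - h₀) (h := (-1 : ℂ) • h₀) (hTd.sub hh₀.1).continuous
    rw [fockNorm_smul hq, enorm_neg, enorm_one, one_mul] at h2
    have e : compVolterra ψ g (f (φ n)) - h₀ - (-1 : ℂ) • h₀ = compVolterra ψ g (f (φ n)) := by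
      simp
    rw [e] at h2
    refine h2.trans ?_
    rw [hX]
    gcongr
  have h3 : (φ n : ℝ≥0∞) < X ^ (1 / q) := by
    refine (hfn (φ n)).trans_le ?_
    rw [← ENNReal.rpow_le_rpow_iff hq, ← ENNReal.rpow_mul, one_div_mul_cancel hq.ne',
      ENNReal.rpow_one]
    exact h1
  have h4 : (n₀ : ℝ≥0∞) ≤ φ n := by exact_mod_cast hn2.trans (hφ.id_le n)
  exact lt_irrefl _ (hn₀.trans_le (h4.trans h3.le))

/-! ### The Gaussian integer lattice -/

/-- The unit square with lower left corner `j`. -/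
def latticeCell (j : ℤ × ℤ) : Set ℂ := {z | ⌊z.re⌋ = j.1 ∧ ⌊z.im⌋ = j.2}

/-- The lattice point `j`. -/
def latticePoint (j : ℤ × ℤ) : ℂ := ⟨j.1, j.2⟩

theorem measurableSet_latticeCell (j : ℤ × ℤ) : MeasurableSet (latticeCell j) := by
  have h1 : Measurable fun z : ℂ => ⌊z.re⌋ := Int.measurable_floor.comp Complex.measurable_re
  have h2 : Measurable fun z : ℂ => ⌊z.im⌋ := Int.measurable_floor.comp Complex.measurable_im
  exact (h1 (measurableSet_singleton j.1)).inter (h2 (measurableSet_singleton j.2))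

theorem pairwise_disjoint_latticeCell : Pairwise (Function.onFun Disjoint latticeCell) := by
  intro i j hij
  refine disjoint_left.2 fun z hi hj => hij ?_
  exact Prod.ext (hi.1.symm.trans hj.1) (hi.2.symm.trans hj.2)

theorem iUnion_latticeCell : ⋃ j, latticeCell j = univ :=
  eq_univ_of_forall fun z => mem_iUnion.2 ⟨(⌊z.re⌋, ⌊z.im⌋), rfl, rfl⟩

theorem lintegral_eq_tsum_latticeCell (μ : Measure ℂ) (F : ℂ → ℝ≥0∞) :
    ∫⁻ z, F z ∂μ = ∑' j, ∫⁻ z in latticeCell j, F z ∂μ := by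
  rw [← lintegral_iUnion measurableSet_latticeCell pairwise_disjoint_latticeCell,
    iUnion_latticeCell, setLIntegral_univ]

theorem volume_latticeCell (j : ℤ × ℤ) : volume (latticeCell j) = 1 := by
  have h : latticeCell j = Complex.measurableEquivRealProd ⁻¹'
      (Ico (j.1 : ℝ) (j.1 + 1) ×ˢ Ico (j.2 : ℝ) (j.2 + 1)) := by
    ext z
    simp [latticeCell, Int.floor_eq_iff, Complex.measurableEquivRealProd_apply]
  rw [h, Complex.volume_preserving_equiv_real_prod.measure_preimage
    (measurableSet_Ico.prod measurableSet_Ico).nullMeasurableSet, Measure.volume_eq_prod,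
    Measure.prod_prod]
  simp

theorem norm_sub_latticePoint_sq_le {j : ℤ × ℤ} {z : ℂ} (hz : z ∈ latticeCell j) :
    ‖z - latticePoint j‖ ^ 2 ≤ 2 := by
  obtain ⟨h1, h2⟩ := hz
  rw [Int.floor_eq_iff] at h1 h2
  rw [Complex.sq_norm, Complex.normSq_apply]
  simp only [latticePoint, Complex.sub_re, Complex.sub_im]
  nlinarith

theorem norm_sub_sq_le {a b c : ℂ} (h : ‖a - b‖ ^ 2 ≤ 2) : ‖c - a‖ ^ 2 ≤ 2 * ‖c - b‖ ^ 2 + 4 := by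
  have h1 : ‖c - a‖ ≤ ‖c - b‖ + ‖b - a‖ := norm_sub_le_norm_sub_add_norm_sub c b a
  rw [norm_sub_rev b a] at h1
  have h2 : ‖c - a‖ ^ 2 ≤ (‖c - b‖ + ‖a - b‖) ^ 2 := by gcongr
  nlinarith [sq_nonneg (‖c - b‖ - ‖a - b‖)]

/-- Moving the centre by at most √2, the diameter of a cell, costs a constant and half of the
exponent, since |z-a|² ≤ 2|z-b|² + 4. -/
theorem gaussWeight_le_of_norm_sub_sq_le {c : ℝ} (hc : 0 ≤ c) {a b z : ℂ} (h : ‖a - b‖ ^ 2 ≤ 2) :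
    gaussWeight c (z - b) ≤ ENNReal.ofReal (Real.exp (2 * c)) * gaussWeight (c / 2) (z - a) := by
  rw [gaussWeight, gaussWeight, ← ENNReal.ofReal_mul (Real.exp_pos _).le, ← Real.exp_add]
  refine ENNReal.ofReal_le_ofReal (Real.exp_le_exp.2 ?_)
  have := norm_sub_sq_le (c := z) h
  nlinarith

theorem gaussWeight_neg_sub (c : ℝ) (a b : ℂ) : gaussWeight c (a - b) = gaussWeight c (b - a) := by
  rw [gaussWeight, gaussWeight, norm_sub_rev]

/-- Cells have area 1, so the sum is dominated by the integral of a wider Gaussian, whose value does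
not depend on z. -/
theorem exists_tsum_gaussWeight_le {c : ℝ} (hc : 0 < c) :
    ∃ K : ℝ, 0 < K ∧ ∀ z, ∑' j, gaussWeight c (z - latticePoint j) ≤ ENNReal.ofReal K := by
  refine ⟨Real.exp (2 * c) * (Real.pi / (c / 2)), by positivity, fun z => ?_⟩
  calc ∑' j, gaussWeight c (z - latticePoint j)
      ≤ ∑' j, ∫⁻ ζ in latticeCell j,
        ENNReal.ofReal (Real.exp (2 * c)) * gaussWeight (c / 2) (ζ - z) := by
        refine ENNReal.tsum_le_tsum fun j => ?_
        calc gaussWeight c (z - latticePoint j)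
            = ∫⁻ _ in latticeCell j, gaussWeight c (z - latticePoint j) := by
              rw [setLIntegral_const, volume_latticeCell, mul_one]
          _ ≤ _ := by
              refine setLIntegral_mono' (measurableSet_latticeCell j) fun ζ hζ => ?_
              rw [gaussWeight_neg_sub _ ζ z]
              exact gaussWeight_le_of_norm_sub_sq_le hc.le (norm_sub_latticePoint_sq_le hζ)
    _ = ∫⁻ ζ, ENNReal.ofReal (Real.exp (2 * c)) * gaussWeight (c / 2) (ζ - z) :=
        (lintegral_eq_tsum_latticeCell _ _).symm
    _ = _ := by
        rw [lintegral_const_mul' _ _ ENNReal.ofReal_ne_top, lintegral_gaussWeight_sub (by positivity),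
          ← ENNReal.ofReal_mul (by positivity)]

theorem rpow_sum_le_sum_rpow_of_le_one {ι : Type*} {s : ℝ} (hs : 0 < s) (hs1 : s ≤ 1)
    (J : Finset ι) (x : ι → ℝ≥0∞) : (∑ j ∈ J, x j) ^ s ≤ ∑ j ∈ J, x j ^ s := by
  classical
  induction J using Finset.induction_on with
  | empty => simp [ENNReal.zero_rpow_of_pos hs]
  | insert a J ha ih =>
    rw [Finset.sum_insert ha, Finset.sum_insert ha]
    exact (ENNReal.rpow_add_le_add_rpow _ _ hs.le hs1).trans (by gcongr)

/-- For s ≤ 1 the power is subadditive; for s ≥ 1 Hölder's inequality applies with the Gaussians as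
weights, their total mass being bounded uniformly in z. -/
theorem exists_rpow_sum_gaussWeight_le {c s : ℝ} (hc : 0 < c) (hs : 0 < s) :
    ∃ C c' : ℝ, 0 < C ∧ 0 < c' ∧ ∀ (J : Finset (ℤ × ℤ)) (a : ℤ × ℤ → ℝ≥0∞) (z : ℂ),
      (∑ j ∈ J, a j * gaussWeight c (z - latticePoint j)) ^ s ≤
        ENNReal.ofReal C * ∑ j ∈ J, a j ^ s * gaussWeight c' (z - latticePoint j) := by
  rcases le_total s 1 with h1 | h1
  · refine ⟨1, c * s, one_pos, by positivity, fun J a z => ?_⟩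
    refine (rpow_sum_le_sum_rpow_of_le_one hs h1 J _).trans (le_of_eq ?_)
    rw [ENNReal.ofReal_one, one_mul]
    refine Finset.sum_congr rfl fun j _ => ?_
    rw [ENNReal.mul_rpow_of_nonneg _ _ hs.le, gaussWeight_rpow]
  · obtain ⟨K, hK, hK'⟩ := exists_tsum_gaussWeight_le hc
    refine ⟨K ^ (s - 1), c, by positivity, hc, fun J a z => ?_⟩
    have h2 := ENNReal.inner_le_weight_mul_Lp_of_nonneg J h1
      (fun j => gaussWeight c (z - latticePoint j)) a
    have h3 := ENNReal.rpow_le_rpow h2 hs.le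
    rw [ENNReal.mul_rpow_of_nonneg _ _ hs.le, ← ENNReal.rpow_mul, ← ENNReal.rpow_mul,
      inv_mul_cancel₀ hs.ne', ENNReal.rpow_one, sub_mul, one_mul, inv_mul_cancel₀ hs.ne'] at h3
    simp_rw [mul_comm (gaussWeight c _)] at h3
    refine h3.trans ?_
    gcongr
    rw [← ENNReal.ofReal_rpow_of_pos hK]
    exact ENNReal.rpow_le_rpow ((ENNReal.sum_le_tsum J).trans (hK' z)) (by linarith)

theorem exists_lintegral_sum_gaussWeight_le {c s : ℝ} (hc : 0 < c) (hs : 0 < s) :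
    ∃ C : ℝ, 0 < C ∧ ∀ (J : Finset (ℤ × ℤ)) (a : ℤ × ℤ → ℝ≥0∞),
      ∫⁻ z, (∑ j ∈ J, a j * gaussWeight c (z - latticePoint j)) ^ s ≤
        ENNReal.ofReal C * ∑ j ∈ J, a j ^ s := by
  obtain ⟨C, c', hC, hc', h⟩ := exists_rpow_sum_gaussWeight_le hc hs
  refine ⟨C * (Real.pi / c'), by positivity, fun J a => ?_⟩
  have hm : ∀ j, Measurable fun z : ℂ => gaussWeight c' (z - latticePoint j) := fun j => by fun_prop
  refine (lintegral_mono (h J a)).trans (le_of_eq ?_)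
  rw [lintegral_const_mul' _ _ ENNReal.ofReal_ne_top,
    lintegral_finsetSum _ fun j _ => (hm j).const_mul _]
  simp_rw [lintegral_const_mul _ (hm _), lintegral_gaussWeight_sub hc']
  rw [← Finset.sum_mul, ENNReal.ofReal_mul hC.le]
  ring

theorem exists_lintegral_tsum_gaussWeight_le {c s : ℝ} (hc : 0 < c) (hs : 0 < s) :
    ∃ C : ℝ, 0 < C ∧ ∀ a : ℤ × ℤ → ℝ≥0∞,
      ∫⁻ z, (∑' j, a j * gaussWeight c (z - latticePoint j)) ^ s ≤
        ENNReal.ofReal C * ∑' j, a j ^ s := by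
  obtain ⟨C, c', hC, hc', h⟩ := exists_rpow_sum_gaussWeight_le hc hs
  refine ⟨C * (Real.pi / c'), by positivity, fun a => ?_⟩
  have hm : ∀ j, Measurable fun z : ℂ => gaussWeight c' (z - latticePoint j) := fun j => by fun_prop
  have hpt : ∀ z, (∑' j, a j * gaussWeight c (z - latticePoint j)) ^ s ≤
      ENNReal.ofReal C * ∑' j, a j ^ s * gaussWeight c' (z - latticePoint j) := by
    intro z
    rw [← ENNReal.le_rpow_inv_iff hs, ENNReal.tsum_eq_iSup_sum]
    refine iSup_le fun J => ?_
    rw [ENNReal.le_rpow_inv_iff hs]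
    refine (h J a z).trans ?_
    gcongr
    exact ENNReal.sum_le_tsum J
  refine (lintegral_mono hpt).trans (le_of_eq ?_)
  rw [lintegral_const_mul' _ _ ENNReal.ofReal_ne_top,
    lintegral_tsum fun j => ((hm j).const_mul _).aemeasurable]
  simp_rw [lintegral_const_mul _ (hm _), lintegral_gaussWeight_sub hc']
  rw [ENNReal.tsum_mul_right, ENNReal.ofReal_mul hC.le]
  ring

/-- On each cell the Gaussian may be recentred at the lattice point, which bounds the average of μ
by a lattice sum with coefficients μ(Q_j). -/
theorem exists_lintegral_rpow_le_tsum_latticeCell {c s : ℝ} (hc : 0 < c) (hs : 0 < s) :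
    ∃ C : ℝ, 0 < C ∧ ∀ μ : Measure ℂ,
      ∫⁻ w, (∫⁻ ζ, gaussWeight c (ζ - w) ∂μ) ^ s ≤
        ENNReal.ofReal C * ∑' j, μ (latticeCell j) ^ s := by
  obtain ⟨C, hC, h⟩ := exists_lintegral_tsum_gaussWeight_le (c := c / 2) (by positivity) hs
  refine ⟨Real.exp (2 * c) ^ s * C, by positivity, fun μ => ?_⟩
  have hpt : ∀ w, ∫⁻ ζ, gaussWeight c (ζ - w) ∂μ ≤ ENNReal.ofReal (Real.exp (2 * c)) *
      ∑' j, μ (latticeCell j) * gaussWeight (c / 2) (w - latticePoint j) := by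
    intro w
    rw [lintegral_eq_tsum_latticeCell, ← ENNReal.tsum_mul_left]
    refine ENNReal.tsum_le_tsum fun j => ?_
    calc ∫⁻ ζ in latticeCell j, gaussWeight c (ζ - w) ∂μ
        ≤ ∫⁻ _ in latticeCell j, ENNReal.ofReal (Real.exp (2 * c)) *
          gaussWeight (c / 2) (w - latticePoint j) ∂μ := by
          refine setLIntegral_mono' (measurableSet_latticeCell j) fun ζ hζ => ?_
          rw [gaussWeight_neg_sub _ ζ w]
          refine gaussWeight_le_of_norm_sub_sq_le hc.le ?_
          rw [norm_sub_rev]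
          exact norm_sub_latticePoint_sq_le hζ
      _ = _ := by
          rw [setLIntegral_const]
          ring
  calc _ ≤ ∫⁻ w, (ENNReal.ofReal (Real.exp (2 * c)) *
        ∑' j, μ (latticeCell j) * gaussWeight (c / 2) (w - latticePoint j)) ^ s :=
        lintegral_mono fun w => ENNReal.rpow_le_rpow (hpt w) hs.le
    _ = ENNReal.ofReal (Real.exp (2 * c)) ^ s *
        ∫⁻ w, (∑' j, μ (latticeCell j) * gaussWeight (c / 2) (w - latticePoint j)) ^ s := by
        simp_rw [ENNReal.mul_rpow_of_nonneg _ _ hs.le]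
        rw [lintegral_const_mul' _ _ (ENNReal.rpow_ne_top_of_nonneg hs.le ENNReal.ofReal_ne_top)]
    _ ≤ ENNReal.ofReal (Real.exp (2 * c)) ^ s *
        (ENNReal.ofReal C * ∑' j, μ (latticeCell j) ^ s) := by
        gcongr
        exact h _
    _ = _ := by
        rw [ENNReal.ofReal_rpow_of_pos (Real.exp_pos _), ENNReal.ofReal_mul (by positivity), mul_assoc]

/-! ### Random signs -/

/-- Pair each choice of signs with the one flipped at i. The two sums differ by 2x_i up to sign, so
one of them is at least |x_i|. This single-term bound is all that is needed from Khinchine's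
inequality, since the cells are disjoint. -/
theorem card_mul_enorm_rpow_le_sum_signs {ι : Type*} [Fintype ι] [DecidableEq ι] {p : ℝ}
    (hp : 0 < p) (x : ι → ℂ) (i : ι) :
    (Fintype.card (ι → ℤˣ) : ℝ≥0∞) * ‖x i‖ₑ ^ p ≤
      2 * ∑ ε : ι → ℤˣ, ‖∑ j, ((ε j : ℤ) : ℂ) * x j‖ₑ ^ p := by
  set σ : ι → ℤˣ := Pi.mulSingle i (-1) with hσ
  set G : (ι → ℤˣ) → ℝ≥0∞ := fun ε => ‖∑ j, ((ε j : ℤ) : ℂ) * x j‖ₑ ^ p with hG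
  have hflip : ∑ ε, G (σ * ε) = ∑ ε, G ε := Equiv.sum_comp (Equiv.mulLeft σ) G
  have hpair : ∀ ε, ‖x i‖ₑ ^ p ≤ G ε + G (σ * ε) := by
    intro ε
    have e : (∑ j, ((ε j : ℤ) : ℂ) * x j) - ∑ j, (((σ * ε) j : ℤ) : ℂ) * x j =
        2 * (((ε i : ℤ) : ℂ) * x i) := by
      rw [← Finset.sum_sub_distrib, Finset.sum_eq_single i]
      · simp [hσ]
        ring
      · intro j _ hj
        simp [hσ, Pi.mulSingle_eq_of_ne hj]
      · simp
    have hunit : ‖((ε i : ℤ) : ℂ)‖ = 1 := by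
      rcases Int.units_eq_one_or (ε i) with h | h <;> simp [h]
    set a := ∑ j, ((ε j : ℤ) : ℂ) * x j with ha
    set b := ∑ j, (((σ * ε) j : ℤ) : ℂ) * x j with hb
    have h1 : 2 * ‖x i‖ ≤ ‖a‖ + ‖b‖ := by
      have h2 := norm_sub_le a b
      rw [e, norm_mul, norm_mul, hunit, one_mul] at h2
      simpa using h2
    rcases le_total ‖a‖ ‖b‖ with hab | hab
    · have : ‖x i‖ₑ ≤ ‖b‖ₑ := enorm_le_iff_norm_le.2 (by linarith)
      exact (ENNReal.rpow_le_rpow this hp.le).trans le_add_self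
    · have : ‖x i‖ₑ ≤ ‖a‖ₑ := enorm_le_iff_norm_le.2 (by linarith)
      exact (ENNReal.rpow_le_rpow this hp.le).trans le_self_add
  calc (Fintype.card (ι → ℤˣ) : ℝ≥0∞) * ‖x i‖ₑ ^ p = ∑ _ε : ι → ℤˣ, ‖x i‖ₑ ^ p := by
        rw [Finset.sum_const, Finset.card_univ, nsmul_eq_mul]
    _ ≤ ∑ ε, (G ε + G (σ * ε)) := Finset.sum_le_sum fun ε _ => hpair ε
    _ = 2 * ∑ ε, G ε := by rw [Finset.sum_add_distrib, hflip, two_mul]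

/-- The combination of normalized kernels at lattice points with coefficients `a` and signs `ε`. -/
def kernelSum (α : ℝ) (J : Finset (ℤ × ℤ)) (a : ℤ × ℤ → ℂ) (ε : J → ℤˣ) (z : ℂ) : ℂ :=
  ∑ j : J, ((ε j : ℤ) : ℂ) * (a j * normKernel α (latticePoint j) z)

theorem differentiable_kernelSum (α : ℝ) (J : Finset (ℤ × ℤ)) (a : ℤ × ℤ → ℂ) (ε : J → ℤˣ) :
    Differentiable ℂ (kernelSum α J a ε) := by
  unfold kernelSum
  refine Differentiable.fun_sum fun j _ => ?_
  exact ((differentiable_normKernel α _).const_mul _).const_mul _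

/-- By the triangle inequality the signs disappear, and the weighted kernels are Gaussians at
lattice points. -/
theorem exists_fockNorm_kernelSum_le {α q : ℝ} (hα : 0 < α) (hq : 0 < q) :
    ∃ C : ℝ, 0 < C ∧ ∀ (J : Finset (ℤ × ℤ)) (a : ℤ × ℤ → ℂ) (ε : J → ℤˣ),
      fockNorm α q (kernelSum α J a ε) ^ q ≤ ENNReal.ofReal C * ∑ j ∈ J, ‖a j‖ₑ ^ q := by
  obtain ⟨C, hC, h⟩ := exists_lintegral_sum_gaussWeight_le (c := α / 2) (by positivity) hq
  refine ⟨α * q / (2 * Real.pi) * C, by positivity, fun J a ε => ?_⟩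
  rw [fockNorm_rpow hq, ENNReal.ofReal_mul (by positivity), mul_assoc]
  gcongr
  refine le_trans (lintegral_mono fun z => ?_) (h J fun j => ‖a j‖ₑ)
  have e : gaussWeight (α * q / 2) z = gaussWeight (α / 2) z ^ q := by
    rw [gaussWeight_rpow]
    congr 1
    ring
  rw [e, ← ENNReal.mul_rpow_of_nonneg _ _ hq.le]
  refine ENNReal.rpow_le_rpow ?_ hq.le
  have h1 : ‖kernelSum α J a ε z‖ₑ ≤ ∑ j ∈ J, ‖a j‖ₑ * ‖normKernel α (latticePoint j) z‖ₑ := by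
    rw [← Finset.sum_coe_sort J fun j => ‖a j‖ₑ * ‖normKernel α (latticePoint j) z‖ₑ]
    refine (enorm_sum_le _ _).trans (Finset.sum_le_sum fun j _ => ?_)
    have hunit : ‖((ε j : ℤ) : ℂ)‖ₑ = 1 := by
      rcases Int.units_eq_one_or (ε j) with h | h <;> simp [h]
    rw [enorm_mul, enorm_mul, hunit, one_mul]
  calc _ ≤ (∑ j ∈ J, ‖a j‖ₑ * ‖normKernel α (latticePoint j) z‖ₑ) * gaussWeight (α / 2) z := by
        gcongr
    _ = _ := by
        rw [Finset.sum_mul]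
        refine Finset.sum_congr rfl fun j _ => ?_
        have := enorm_normKernel_rpow_mul α (p := 1) zero_le_one (latticePoint j) z
        rw [ENNReal.rpow_one, mul_one] at this
        rw [mul_assoc, this]

/-- The averaging argument over signs. -/
theorem exists_sum_measure_latticeCell_le {α p : ℝ} (hα : 0 < α) (hp : 0 < p) :
    ∃ C : ℝ, 0 < C ∧ ∀ (μ : Measure ℂ) (J : Finset (ℤ × ℤ)) (a : ℤ × ℤ → ℂ) (X : ℝ≥0∞),
      (∀ ε : J → ℤˣ, ∫⁻ ζ, ‖kernelSum α J a ε ζ‖ₑ ^ p * gaussWeight (α * p / 2) ζ ∂μ ≤ X) →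
      ∑ j ∈ J, ‖a j‖ₑ ^ p * μ (latticeCell j) ≤ ENNReal.ofReal C * X := by
  classical
  set c := α * p / 2 with hc
  have hc0 : 0 < c := by positivity
  refine ⟨Real.exp (2 * c) * 2, by positivity, fun μ J a X hX => ?_⟩
  set N : ℝ≥0∞ := (Fintype.card (J → ℤˣ) : ℝ≥0∞) with hN
  have hN0 : N ≠ 0 := by
    rw [hN]
    exact_mod_cast Fintype.card_ne_zero
  have hNt : N ≠ ⊤ := ENNReal.natCast_ne_top _
  have hm : ∀ ε : J → ℤˣ, Measurable fun ζ => ‖kernelSum α J a ε ζ‖ₑ ^ p * gaussWeight c ζ :=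
    fun ε => (measurable_enorm_rpow (differentiable_kernelSum α J a ε).continuous p).mul
      (measurable_gaussWeight c)
  -- On the j-th cell only the j-th term is kept; there the weighted kernel is at least e^{-2c}, as
  -- |ζ - j|² ≤ 2. The factor 2 comes from the sign lemma.
  have hpt : ∀ (j : J) (ζ : ℂ), ζ ∈ latticeCell j → N * ‖a j‖ₑ ^ p ≤
      ENNReal.ofReal (Real.exp (2 * c) * 2) *
        ∑ ε : J → ℤˣ, ‖kernelSum α J a ε ζ‖ₑ ^ p * gaussWeight c ζ := by
    intro j ζ hζ
    have h1 := card_mul_enorm_rpow_le_sum_signs hp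
      (fun i : J => a i * normKernel α (latticePoint i) ζ) j
    have h2 : 1 ≤ ENNReal.ofReal (Real.exp (2 * c)) * gaussWeight c (ζ - latticePoint j) := by
      rw [gaussWeight, ← ENNReal.ofReal_mul (Real.exp_pos _).le, ← Real.exp_add,
        ENNReal.one_le_ofReal, Real.one_le_exp_iff]
      have := norm_sub_latticePoint_sq_le hζ
      nlinarith
    calc N * ‖a j‖ₑ ^ p ≤ N * ‖a j‖ₑ ^ p *
          (ENNReal.ofReal (Real.exp (2 * c)) * gaussWeight c (ζ - latticePoint j)) :=
          le_mul_of_one_le_right' h2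
      _ = ENNReal.ofReal (Real.exp (2 * c)) *
          ((N * ‖a j * normKernel α (latticePoint j) ζ‖ₑ ^ p) * gaussWeight c ζ) := by
          rw [← enorm_normKernel_rpow_mul α hp.le, enorm_mul, ENNReal.mul_rpow_of_nonneg _ _ hp.le]
          ring
      _ ≤ ENNReal.ofReal (Real.exp (2 * c)) *
          ((2 * ∑ ε : J → ℤˣ, ‖kernelSum α J a ε ζ‖ₑ ^ p) * gaussWeight c ζ) := by
          exact mul_le_mul' le_rfl (mul_le_mul' h1 le_rfl)
      _ = _ := by
          rw [ENNReal.ofReal_mul (Real.exp_pos _).le, ENNReal.ofReal_ofNat, ← Finset.sum_mul]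
          ring
  have hsum : N * ∑ j ∈ J, ‖a j‖ₑ ^ p * μ (latticeCell j) ≤
      ENNReal.ofReal (Real.exp (2 * c) * 2) * (N * X) := by
    calc N * ∑ j ∈ J, ‖a j‖ₑ ^ p * μ (latticeCell j)
        = ∑ j : J, ∫⁻ _ in latticeCell j, N * ‖a j‖ₑ ^ p ∂μ := by
          rw [Finset.mul_sum, ← Finset.sum_coe_sort]
          refine Finset.sum_congr rfl fun j _ => ?_
          rw [setLIntegral_const, mul_assoc]
      _ ≤ ∑ j : J, ∫⁻ ζ in latticeCell j, ENNReal.ofReal (Real.exp (2 * c) * 2) *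
          ∑ ε : J → ℤˣ, ‖kernelSum α J a ε ζ‖ₑ ^ p * gaussWeight c ζ ∂μ :=
          Finset.sum_le_sum fun j _ =>
            setLIntegral_mono' (measurableSet_latticeCell j) fun ζ hζ => hpt j ζ hζ
      _ = ∑ j ∈ J, ∫⁻ ζ in latticeCell j, ENNReal.ofReal (Real.exp (2 * c) * 2) *
          ∑ ε : J → ℤˣ, ‖kernelSum α J a ε ζ‖ₑ ^ p * gaussWeight c ζ ∂μ :=
          Finset.sum_coe_sort J fun j => ∫⁻ ζ in latticeCell j,
            ENNReal.ofReal (Real.exp (2 * c) * 2) *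
              ∑ ε : J → ℤˣ, ‖kernelSum α J a ε ζ‖ₑ ^ p * gaussWeight c ζ ∂μ
      _ ≤ ∫⁻ ζ, ENNReal.ofReal (Real.exp (2 * c) * 2) *
          ∑ ε : J → ℤˣ, ‖kernelSum α J a ε ζ‖ₑ ^ p * gaussWeight c ζ ∂μ := by
          rw [lintegral_eq_tsum_latticeCell μ]
          exact ENNReal.sum_le_tsum J
      _ = ENNReal.ofReal (Real.exp (2 * c) * 2) * ∑ ε : J → ℤˣ,
          ∫⁻ ζ, ‖kernelSum α J a ε ζ‖ₑ ^ p * gaussWeight c ζ ∂μ := by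
          rw [lintegral_const_mul' _ _ ENNReal.ofReal_ne_top, lintegral_finsetSum _ fun ε _ => hm ε]
      _ ≤ ENNReal.ofReal (Real.exp (2 * c) * 2) * ∑ _ε : J → ℤˣ, X := by
          gcongr with ε
          exact hX ε
      _ = _ := by rw [Finset.sum_const, Finset.card_univ, nsmul_eq_mul]
  rw [mul_left_comm] at hsum
  exact (ENNReal.mul_le_mul_iff_right hN0 hNt).1 hsum

/-- Division by X^{p/q}; the finiteness of X is essential. -/
theorem le_rpow_of_le_mul_rpow {p q : ℝ} (hp : 0 < p) (hpq : p < q) {X D : ℝ≥0∞} (hX : X ≠ ⊤)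
    (h : X ≤ D * X ^ (p / q)) : X ≤ D ^ (q / (q - p)) := by
  have hq : 0 < q := hp.trans hpq
  have hqp : 0 < q - p := by linarith
  rcases eq_or_ne X 0 with h0 | h0
  · rw [h0]
    exact zero_le
  have h1 : X ^ ((q - p) / q) ≤ D := by
    have e : X = X ^ ((q - p) / q) * X ^ (p / q) := by
      rw [← ENNReal.rpow_add _ _ h0 hX, ← add_div, sub_add_cancel, div_self hq.ne', ENNReal.rpow_one]
    nth_rewrite 1 [e] at h
    refine (ENNReal.mul_le_mul_iff_left ?_ ?_).1 h
    · simp [h0, hX]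
    · exact ENNReal.rpow_ne_top_of_nonneg (by positivity) hX
  have h2 := ENNReal.rpow_le_rpow h1 (show 0 ≤ q / (q - p) by positivity)
  rwa [← ENNReal.rpow_mul, div_mul_div_cancel₀ hq.ne', div_self hqp.ne', ENNReal.rpow_one] at h2

/-- With μ the symbol measure, the test functions bound Σ |a_j|^p μ(Q_j) by a constant times ‖C‖^p
(Σ |a_j|^q)^{p/q}. The extremal coefficients for this duality recover the ℓ^s norm of μ(Q_j), s =
q/(q-p), which dominates the integral of M^s. -/
theorem exists_lintegral_berezinM_le_opNorm {α p q : ℝ} (hα : 0 < α) (hp : 0 < p) (hpq : p < q) :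
    ∃ A : ℝ, 0 < A ∧ ∀ ψ g : ℂ → ℂ, Differentiable ℂ ψ → Differentiable ℂ g →
      ∫⁻ w, berezinM α p ψ g w ^ (q / (q - p)) ≤
        ENNReal.ofReal A * opNorm α q p (compVolterra ψ g) ^ (p * q / (q - p)) := by
  have hq : 0 < q := hp.trans hpq
  have hqp : 0 < q - p := by linarith
  set s := q / (q - p) with hs
  have hs0 : 0 < s := by positivity
  set c := α * p / 2 with hc
  have hc0 : 0 < c := by positivity
  obtain ⟨C₁, hC₁, h₁⟩ := exists_lintegral_rpow_le_tsum_latticeCell hc0 hs0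
  obtain ⟨C₂, hC₂, h₂⟩ := exists_sum_measure_latticeCell_le hα hp
  obtain ⟨C₃, hC₃, h₃⟩ := exists_fockNorm_kernelSum_le hα hq
  obtain ⟨C₄, hC₄, h₄⟩ := exists_lpInt_le_fockNorm hα hp
  obtain ⟨C₅, hC₅, h₅⟩ := exists_berezinM_le_opNorm (q := p) hα hq hp
  obtain ⟨C₆, hC₆, h₆⟩ := exists_symbolMeasure_ball_le hα hp 2
  set D := C₂ * (C₄ * C₃ ^ (p / q)) with hD
  have hD0 : 0 < D := by positivity
  refine ⟨C₁ * D ^ s, by positivity, fun ψ g hψ hg => ?_⟩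
  set K := opNorm α q p (compVolterra ψ g) with hK
  rcases eq_or_ne K ⊤ with hKt | hKt
  · rw [hKt, ENNReal.top_rpow_of_pos (by positivity), ENNReal.mul_top]
    · exact le_top
    · rw [Ne, ENNReal.ofReal_eq_zero, not_le]
      positivity
  set μ := symbolMeasure p c ψ g with hμ
  -- A finite operator norm bounds the transform through kernels, so the coefficients below are
  -- finite.
  have hcell : ∀ j, μ (latticeCell j) ≠ ⊤ := by
    intro j
    refine ne_top_of_le_ne_top (b := ENNReal.ofReal C₆ * (ENNReal.ofReal C₅ * K ^ p)) ?_ ?_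
    · exact ENNReal.mul_ne_top ENNReal.ofReal_ne_top (ENNReal.mul_ne_top ENNReal.ofReal_ne_top
        (ENNReal.rpow_ne_top_of_nonneg hp.le hKt))
    · calc μ (latticeCell j) ≤ μ (ball (latticePoint j) 2) := by
            refine measure_mono fun z hz => ?_
            rw [mem_ball_iff_norm]
            have := norm_sub_latticePoint_sq_le hz
            nlinarith [norm_nonneg (z - latticePoint j)]
        _ ≤ _ := h₆ ψ g hψ hg _
        _ ≤ _ := by
            gcongr
            exact (h₅ ψ g hψ hg _).2
  have hfinite : ∀ J : Finset (ℤ × ℤ), ∑ j ∈ J, μ (latticeCell j) ^ s ≤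
      (ENNReal.ofReal D * K ^ p) ^ s := by
    intro J
    -- With exponent 1/(q-p), both |a_j|^q and |a_j|^p μ(Q_j) equal μ(Q_j)^{q/(q-p)}, so the same
    -- sum X stands on both sides.
    set b : ℤ × ℤ → ℝ≥0∞ := fun j => μ (latticeCell j) ^ (1 / (q - p)) with hb
    have hbt : ∀ j, b j ≠ ⊤ := fun j => ENNReal.rpow_ne_top_of_nonneg (by positivity) (hcell j)
    set a : ℤ × ℤ → ℂ := fun j => ((b j).toReal : ℂ) with ha
    have hae : ∀ j, ‖a j‖ₑ = b j := fun j => by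
      rw [ha, ← ofReal_norm, Complex.norm_real, Real.norm_of_nonneg ENNReal.toReal_nonneg,
        ENNReal.ofReal_toReal (hbt j)]
    set X := ∑ j ∈ J, μ (latticeCell j) ^ s with hX
    have hXt : X ≠ ⊤ := (ENNReal.sum_lt_top.2 fun j _ =>
      (ENNReal.rpow_ne_top_of_nonneg hs0.le (hcell j)).lt_top).ne
    have hXq : ∑ j ∈ J, ‖a j‖ₑ ^ q = X := by
      refine Finset.sum_congr rfl fun j _ => ?_
      rw [hae, hb, ← ENNReal.rpow_mul, hs]
      congr 1
      field_simp
    have hXp : ∑ j ∈ J, ‖a j‖ₑ ^ p * μ (latticeCell j) = X := by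
      refine Finset.sum_congr rfl fun j _ => ?_
      rw [hae, hb, ← ENNReal.rpow_mul]
      nth_rewrite 2 [← ENNReal.rpow_one (μ (latticeCell j))]
      rw [← ENNReal.rpow_add_of_nonneg _ _ (by positivity) zero_le_one, hs]
      congr 1
      field_simp
      ring
    have hstep : ∀ ε : J → ℤˣ, ∫⁻ ζ, ‖kernelSum α J a ε ζ‖ₑ ^ p * gaussWeight c ζ ∂μ ≤
        ENNReal.ofReal (C₄ * C₃ ^ (p / q)) * K ^ p * X ^ (p / q) := by
      intro ε
      have hd := differentiable_kernelSum α J a ε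
      have hn := h₃ J a ε
      rw [hXq] at hn
      have hmem : kernelSum α J a ε ∈ FockSpace α q := by
        refine ⟨hd, (ENNReal.rpow_lt_top_iff_of_pos hq).1 (hn.trans_lt ?_)⟩
        exact ENNReal.mul_lt_top ENNReal.ofReal_lt_top hXt.lt_top
      have hn' : fockNorm α q (kernelSum α J a ε) ^ p ≤
          ENNReal.ofReal (C₃ ^ (p / q)) * X ^ (p / q) := by
        have := ENNReal.rpow_le_rpow hn (show 0 ≤ p / q by positivity)
        rwa [← ENNReal.rpow_mul, mul_div_cancel₀ _ hq.ne', ENNReal.mul_rpow_of_nonneg _ _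
          (by positivity), ENNReal.ofReal_rpow_of_pos hC₃] at this
      rw [hμ, ← lpInt_compVolterra hp c hψ hg hd]
      calc _ ≤ ENNReal.ofReal C₄ * fockNorm α p (compVolterra ψ g (kernelSum α J a ε)) ^ p :=
            h₄ _ (differentiable_compVolterra hψ hg hd)
        _ ≤ ENNReal.ofReal C₄ * (K * fockNorm α q (kernelSum α J a ε)) ^ p := by
            gcongr
            exact fockNorm_compVolterra_le_opNorm_mul hα hq hp hmem
        _ ≤ ENNReal.ofReal C₄ * (K ^ p * (ENNReal.ofReal (C₃ ^ (p / q)) * X ^ (p / q))) := by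
            rw [ENNReal.mul_rpow_of_nonneg _ _ hp.le]
            gcongr
        _ = _ := by
            rw [ENNReal.ofReal_mul hC₄.le]
            ring
    have hfin := h₂ μ J a _ hstep
    rw [hXp] at hfin
    refine le_rpow_of_le_mul_rpow hp hpq hXt (hfin.trans (le_of_eq ?_))
    rw [hD, ENNReal.ofReal_mul hC₂.le]
    ring
  have htsum : ∑' j, μ (latticeCell j) ^ s ≤ (ENNReal.ofReal D * K ^ p) ^ s := by
    rw [ENNReal.tsum_eq_iSup_sum]
    exact iSup_le hfinite
  calc ∫⁻ w, berezinM α p ψ g w ^ s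
      = ∫⁻ w, (∫⁻ ζ, gaussWeight c (ζ - w) ∂μ) ^ s := by
        refine lintegral_congr fun w => ?_
        rw [berezinM_eq_lintegral hp hψ hg]
    _ ≤ ENNReal.ofReal C₁ * ∑' j, μ (latticeCell j) ^ s := h₁ μ
    _ ≤ ENNReal.ofReal C₁ * (ENNReal.ofReal D * K ^ p) ^ s := by gcongr
    _ = _ := by
        rw [ENNReal.mul_rpow_of_nonneg _ _ hs0.le, ENNReal.ofReal_rpow_of_pos hD0,
          ← ENNReal.rpow_mul, ENNReal.ofReal_mul hC₁.le, hs, mul_div_assoc, mul_assoc]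

/-! ### Upper norm estimates -/

/-- The upper operator norm estimates follow from a Littlewood-Paley estimate without a term for the
value at the origin. -/
theorem exists_opNorm_rpow_le_iSup {α p q : ℝ} (hα : 0 < α) (hp : 0 < p) (hpq : p ≤ q) :
    ∃ C : ℝ, 0 < C ∧ ∀ ψ g : ℂ → ℂ, Differentiable ℂ ψ → Differentiable ℂ g → ∀ A : ℝ, 0 < A →
      (∀ f, Differentiable ℂ f → fockNorm α q (compVolterra ψ g f) ^ q ≤
        ENNReal.ofReal A * lpInt q (α * q / 2) (compVolterra ψ g f)) →
      opNorm α p q (compVolterra ψ g) ^ q ≤ ENNReal.ofReal (A * C) * ⨆ w, berezinM α q ψ g w := by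
  have hq : 0 < q := hp.trans_le hpq
  obtain ⟨C, hC, h⟩ := exists_lpInt_compVolterra_le_sup_berezinM hα hp hpq
  refine ⟨C, hC, fun ψ g hψ hg A hA hA' => opNorm_rpow_le hq fun f hf hf1 => ?_⟩
  refine (hA' f hf.1).trans ?_
  rw [ENNReal.ofReal_mul hA.le, mul_assoc]
  gcongr
  refine (h ψ g f hψ hg hf.1 _ (ae_of_all _ fun w => le_iSup (berezinM α q ψ g) w)).trans ?_
  refine mul_le_of_le_one_right' ?_
  exact (ENNReal.rpow_le_rpow hf1 hq.le).trans (by simp)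

theorem exists_opNorm_rpow_le_lintegral {α p q : ℝ} (hα : 0 < α) (hp : 0 < p) (hpq : p < q) :
    ∃ C : ℝ, 0 < C ∧ ∀ ψ g : ℂ → ℂ, Differentiable ℂ ψ → Differentiable ℂ g → ∀ A : ℝ, 0 < A →
      (∀ f, Differentiable ℂ f → fockNorm α p (compVolterra ψ g f) ^ p ≤
        ENNReal.ofReal A * lpInt p (α * p / 2) (compVolterra ψ g f)) →
      opNorm α q p (compVolterra ψ g) ^ (p * q / (q - p)) ≤
        ENNReal.ofReal ((A * C) ^ (q / (q - p))) *
          ∫⁻ w, berezinM α p ψ g w ^ (q / (q - p)) := by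
  have hq : 0 < q := hp.trans hpq
  have hqp : 0 < q - p := by linarith
  obtain ⟨C, hC, h⟩ := exists_lpInt_compVolterra_le_Lp hα hp hpq
  refine ⟨C, hC, fun ψ g hψ hg A hA hA' => ?_⟩
  set I := ∫⁻ w, berezinM α p ψ g w ^ (q / (q - p)) with hI
  have h1 : opNorm α q p (compVolterra ψ g) ^ p ≤ ENNReal.ofReal (A * C) * I ^ ((q - p) / q) := by
    refine opNorm_rpow_le hp fun f hf hf1 => (hA' f hf.1).trans ?_
    rw [ENNReal.ofReal_mul hA.le, mul_assoc]
    gcongr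
    refine (h ψ g f hψ hg hf.1).trans ?_
    refine mul_le_of_le_one_right' ?_
    exact (ENNReal.rpow_le_rpow hf1 hp.le).trans (by simp)
  have h2 := ENNReal.rpow_le_rpow h1 (show 0 ≤ q / (q - p) by positivity)
  rwa [← ENNReal.rpow_mul, ← mul_div_assoc, ENNReal.mul_rpow_of_nonneg _ _ (by positivity),
    ENNReal.ofReal_rpow_of_pos (by positivity), ← ENNReal.rpow_mul, div_mul_div_cancel₀ hq.ne',
    div_self hqp.ne', ENNReal.rpow_one] at h2

theorem ofReal_mul_le_toNNReal_mul {a b : ℝ} (hab : a ≤ b) (x : ℝ≥0∞) :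
    ENNReal.ofReal a * x ≤ (b.toNNReal : ℝ≥0∞) * x := by
  gcongr
  exact ENNReal.ofReal_le_ofReal hab

/-- Boundedness and compactness each imply a finite operator norm, so this form gives both
equivalences at once. -/
theorem isBoundedOp_compVolterra_iff_memLp {α p q : ℝ} (hα : 0 < α) (hp : 0 < p) (hpq : p < q)
    {ψ g : ℂ → ℂ} (hψ : Differentiable ℂ ψ) (hg : Differentiable ℂ g) :
    (opNorm α q p (compVolterra ψ g) < ⊤ →
      MemLp (berezinM α p ψ g) (ENNReal.ofReal (q / (q - p))) volume) ∧
    (MemLp (berezinM α p ψ g) (ENNReal.ofReal (q / (q - p))) volume →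
      IsBoundedOp α q p (compVolterra ψ g) ∧ IsCompactOp α q p (compVolterra ψ g)) := by
  rw [memLp_berezinM_iff hp hpq hψ hg]
  refine ⟨fun h => ?_, fun h => ⟨isBoundedOp_compVolterra_of_lintegral_lt_top hα hp hpq hψ hg h,
    isCompactOp_compVolterra_of_lintegral_lt_top hα hp hpq hψ hg h⟩⟩
  obtain ⟨A, -, hA⟩ := exists_lintegral_berezinM_le_opNorm hα hp hpq
  refine (hA ψ g hψ hg).trans_lt (ENNReal.mul_lt_top ENNReal.ofReal_lt_top ?_)
  refine ENNReal.rpow_lt_top_of_nonneg ?_ h.ne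
  exact div_nonneg (mul_nonneg hp.le (hp.trans hpq).le) (by linarith)

end Fock

end

/-! ### The main theorem -/

theorem proposition2p7 (α p q : ℝ) (hα : 0 < α) (hp : 0 < p) (hpq : p ≤ q) :
    -- boundedness and compactness
    (∀ ψ g : ℂ → ℂ, Differentiable ℂ ψ → Differentiable ℂ g →
      (Fock.IsBoundedOp α p q (Fock.compVolterra ψ g) ↔
        MemLp (Fock.berezinM α q ψ g) ⊤ volume) ∧
      (Fock.IsCompactOp α p q (Fock.compVolterra ψ g) ↔
        Tendsto (Fock.berezinM α q ψ g) (cocompact ℂ) (𝓝 0)) ∧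
      (p ≠ q →
        (Fock.IsBoundedOp α q p (Fock.compVolterra ψ g) ↔
          MemLp (Fock.berezinM α p ψ g) (ENNReal.ofReal (q / (q - p))) volume) ∧
        (Fock.IsCompactOp α q p (Fock.compVolterra ψ g) ↔
          MemLp (Fock.berezinM α p ψ g) (ENNReal.ofReal (q / (q - p))) volume))) ∧
    -- norm estimates with a constant that depends on `α`, `p`, `q` only
    (∃ A : ℝ≥0, 0 < A ∧ ∀ ψ g : ℂ → ℂ, Differentiable ℂ ψ → Differentiable ℂ g →
      (⨆ w, Fock.berezinM α q ψ g w) ≤ A * Fock.opNorm α p q (Fock.compVolterra ψ g) ^ q ∧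
      (ψ 0 = 0 →
        Fock.opNorm α p q (Fock.compVolterra ψ g) ^ q ≤ A * ⨆ w, Fock.berezinM α q ψ g w) ∧
      (p ≠ q →
        (∫⁻ w, Fock.berezinM α p ψ g w ^ (q / (q - p))) ≤
          A * Fock.opNorm α q p (Fock.compVolterra ψ g) ^ (p * q / (q - p)) ∧
        (ψ 0 = 0 →
          Fock.opNorm α q p (Fock.compVolterra ψ g) ^ (p * q / (q - p)) ≤
            A * ∫⁻ w, Fock.berezinM α p ψ g w ^ (q / (q - p))))) ∧
    -- upper norm estimates for a general nonconstant `ψ`, with a constant that may depend on `ψ`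
    (∀ ψ : ℂ → ℂ, Differentiable ℂ ψ → (¬ ∃ c : ℂ, ∀ z, ψ z = c) →
      ∃ B : ℝ≥0, 0 < B ∧ ∀ g : ℂ → ℂ, Differentiable ℂ g →
        Fock.opNorm α p q (Fock.compVolterra ψ g) ^ q ≤ B * (⨆ w, Fock.berezinM α q ψ g w) ∧
        (p ≠ q →
          Fock.opNorm α q p (Fock.compVolterra ψ g) ^ (p * q / (q - p)) ≤
            B * ∫⁻ w, Fock.berezinM α p ψ g w ^ (q / (q - p)))) := by
  have hq : 0 < q := hp.trans_le hpq
  refine ⟨fun ψ g hψ hg => ⟨?_, ⟨?_, ?_⟩, fun hne => ?_⟩, ?_, fun ψ hψ hne => ?_⟩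
  · exact Fock.isBoundedOp_compVolterra_iff_memLp_top hα hp hpq hψ hg
  · exact Fock.tendsto_berezinM_of_isCompactOp hα hp hq hψ hg
  · exact Fock.isCompactOp_compVolterra_of_tendsto hα hp hpq hψ hg
  · obtain ⟨h1, h2⟩ := Fock.isBoundedOp_compVolterra_iff_memLp hα hp (lt_of_le_of_ne hpq hne) hψ hg
    exact ⟨⟨fun h => h1 h.opNorm_lt_top, fun h => (h2 h).1⟩,
      ⟨fun h => h1 (h.opNorm_lt_top hp hψ hg), fun h => (h2 h).2⟩⟩
  · obtain ⟨A₁, hA₁, h₁⟩ := Fock.exists_berezinM_le_opNorm hα hp hq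
    obtain ⟨A₂, hA₂, h₂⟩ := Fock.exists_fockNorm_compVolterra_le_of_zero hα hq
    obtain ⟨A₃, hA₃, h₃⟩ := Fock.exists_fockNorm_compVolterra_le_of_zero hα hp
    obtain ⟨C₂, hC₂, k₂⟩ := Fock.exists_opNorm_rpow_le_iSup hα hp hpq
    -- The estimates for p ≠ q sit under the common existential; for p = q any positive constants
    -- will do.
    obtain ⟨A₄, A₅, hA₄, hA₅, h₄⟩ : ∃ A₄ A₅ : ℝ, 0 < A₄ ∧ 0 < A₅ ∧ (p ≠ q → ∀ ψ g : ℂ → ℂ,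
        Differentiable ℂ ψ → Differentiable ℂ g →
        (∫⁻ w, Fock.berezinM α p ψ g w ^ (q / (q - p))) ≤ ENNReal.ofReal A₄ *
          Fock.opNorm α q p (Fock.compVolterra ψ g) ^ (p * q / (q - p)) ∧
        (ψ 0 = 0 → Fock.opNorm α q p (Fock.compVolterra ψ g) ^ (p * q / (q - p)) ≤
          ENNReal.ofReal A₅ * ∫⁻ w, Fock.berezinM α p ψ g w ^ (q / (q - p)))) := by
      rcases eq_or_ne p q with h | h
      · exact ⟨1, 1, one_pos, one_pos, fun h' => absurd h h'⟩
      · have hlt := lt_of_le_of_ne hpq h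
        obtain ⟨A₄, hA₄, h₄⟩ := Fock.exists_lintegral_berezinM_le_opNorm hα hp hlt
        obtain ⟨C₃, hC₃, k₃⟩ := Fock.exists_opNorm_rpow_le_lintegral hα hp hlt
        exact ⟨A₄, _, hA₄, by positivity, fun _ ψ g hψ hg => ⟨h₄ ψ g hψ hg, fun h0 =>
          k₃ ψ g hψ hg A₃ hA₃ fun f hf => h₃ ψ hψ h0 g f hg hf⟩⟩
    -- The sum of the positive constants serves all four estimates.
    set A := A₁ + A₂ * C₂ + A₄ + A₅ with hA
    have hA₂C₂ : 0 < A₂ * C₂ := by positivity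
    refine ⟨A.toNNReal, Real.toNNReal_pos.2 (by positivity), fun ψ g hψ hg =>
      ⟨?_, fun h0 => ?_, fun hne => ⟨?_, fun h0 => ?_⟩⟩⟩
    · refine iSup_le fun w => (h₁ ψ g hψ hg w).2.trans (Fock.ofReal_mul_le_toNNReal_mul ?_ _)
      linarith
    · refine (k₂ ψ g hψ hg A₂ hA₂ fun f hf => h₂ ψ hψ h0 g f hg hf).trans
        (Fock.ofReal_mul_le_toNNReal_mul ?_ _)
      linarith
    · refine (h₄ hne ψ g hψ hg).1.trans (Fock.ofReal_mul_le_toNNReal_mul ?_ _)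
      linarith
    · refine ((h₄ hne ψ g hψ hg).2 h0).trans (Fock.ofReal_mul_le_toNNReal_mul ?_ _)
      linarith
  · obtain ⟨A₂, hA₂, h₂⟩ := Fock.exists_fockNorm_compVolterra_le_of_not_const hα hq hψ hne
    obtain ⟨A₃, hA₃, h₃⟩ := Fock.exists_fockNorm_compVolterra_le_of_not_const hα hp hψ hne
    obtain ⟨C₂, hC₂, k₂⟩ := Fock.exists_opNorm_rpow_le_iSup hα hp hpq
    obtain ⟨A₅, hA₅, h₅⟩ : ∃ A₅ : ℝ, 0 < A₅ ∧ (p ≠ q → ∀ g : ℂ → ℂ, Differentiable ℂ g →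
        Fock.opNorm α q p (Fock.compVolterra ψ g) ^ (p * q / (q - p)) ≤
          ENNReal.ofReal A₅ * ∫⁻ w, Fock.berezinM α p ψ g w ^ (q / (q - p))) := by
      rcases eq_or_ne p q with h | h
      · exact ⟨1, one_pos, fun h' => absurd h h'⟩
      · obtain ⟨C₃, hC₃, k₃⟩ :=
          Fock.exists_opNorm_rpow_le_lintegral hα hp (lt_of_le_of_ne hpq h)
        exact ⟨_, by positivity, fun _ g hg => k₃ ψ g hψ hg A₃ hA₃ fun f hf => h₃ g f hg hf⟩
    have hA₂C₂ : 0 < A₂ * C₂ := by positivity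
    refine ⟨(A₂ * C₂ + A₅).toNNReal, Real.toNNReal_pos.2 (by positivity), fun g hg =>
      ⟨?_, fun hne' => ?_⟩⟩
    · refine (k₂ ψ g hψ hg A₂ hA₂ fun f hf => h₂ g f hg hf).trans
        (Fock.ofReal_mul_le_toNNReal_mul ?_ _)
      linarith
    · refine (h₅ hne' g hg).trans (Fock.ofReal_mul_le_toNNReal_mul ?_ _)
      linarith
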